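/- **Conventions.** Let $\mathbb T=\{z\in\mathbb C:|z|=1\}$ and $w=e^{2\pi i/3}$. A complex Hadamard matrix of order $N$ is a matrix $H\in M_N(\mathbb T)$ whose rows are pairwise orthogonal for $\langle x,y\rangle=\sum_j x_j\bar y_j$. Two such matrices are equivalent, $H\sim K$, if one can pass from one to the other by permuting rows, permuting columns, and multiplying rows and columns by numbers in $\mathbb T$. A cycle is a formal sum $\sum_{k=1}^{l}q\,e^{2\pi i k/l}$ with $l\ge 2$ and $q\in\mathbb T$. The matrix $H$ is called regular if, for any two distinct rows $i\neq k$, the formal sum $\sum_j H_{ij}\bar H_{kj}$ (that is, the multiset of its terms) is a formal sum of cycles. For $r,s,q\in\mathbb T$ put $$F_6^{(rs)}=\begin{pmatrix}1&1&1&1&1&1\\1&w&w^2&1&w&w^2\\1&w^2&w&1&w^2&w\\1&r&s&-1&-r&-s\\1&wr&w^2s&-1&-wr&-w^2s\\1&w^2r&ws&-1&-w^2r&-ws\end{pmatrix},\qquad F_6^{\binom{r}{s}}=\begin{pmatrix}1&1&1&1&1&1\\1&-1&1&-1&1&-1\\1&r&w&wr&w^2&w^2r\\1&-r&w&-wr&w^2&-w^2r\\1&s&w^2&w^2s&w&ws\\1&-s&w^2&-w^2s&w&-ws\end{pmatrix},$$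 $$H_6^{q}=\begin{pmatrix}1&1&1&1&1&1\\1&-1&i&i&-i&-i\\1&i&-1&-i&q&-q\\1&i&-i&-1&-q&q\\1&-i&\bar q&-\bar q&i&-1\\1&-i&-\bar q&\bar q&-1&i\end{pmatrix},\qquad T_6=\begin{pmatrix}1&1&1&1&1&1\\1&1&w&w&w^2&w^2\\1&w&1&w^2&w^2&w\\1&w&w^2&1&w&w^2\\1&w^2&w^2&w&1&w\\1&w^2&w&w^2&w&1\end{pmatrix}.$$ **Theorem 6.20.** A matrix $H\in M_6(\mathbb C)$ is a regular complex Hadamard matrix if and only if it is equivalent to one of the following: 1. a deformed Fourier matrix $F_6^{(rs)}$ or $F_6^{\binom{r}{s}}$, for some $r,s\in\mathbb T$; 2. a Haagerup matrix $H_6^{q}$, for some $q\in\mathbb T$; 3. the Tao matrix $T_6$. Moreover, these three kinds are pairwise disjoint up to equivalence: for all $r,s,q\in\mathbb T$, no matrix of one of the kinds 1, 2, 3 is equivalent to a matrix of another of these kinds. -/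

import Mathlib

open scoped ComplexConjugate

namespace CHadamard

/-- A complex Hadamard matrix: all entries lie on the unit circle, and the rows are pairwise
orthogonal for the scalar product `⟨x, y⟩ = ∑ j, x j * conj (y j)`. -/
def IsComplexHadamard {N : ℕ} (H : Matrix (Fin N) (Fin N) ℂ) : Prop :=
  (∀ i j, ‖H i j‖ = 1) ∧ ∀ i k, i ≠ k → ∑ j, H i j * conj (H k j) = 0

/-- Equivalence of complex Hadamard matrices: `K` is obtained from `H` by permuting the rows,
permuting the columns, and multiplying rows and columns by numbers of modulus one. -/
def HadamardEquiv {N : ℕ} (H K : Matrix (Fin N) (Fin N) ℂ) : Prop :=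
  ∃ (σ τ : Equiv.Perm (Fin N)) (a b : Fin N → ℂ),
    (∀ i, ‖a i‖ = 1) ∧ (∀ j, ‖b j‖ = 1) ∧ ∀ i j, K i j = a i * b j * H (σ i) (τ j)

/-- The cycle of length `l` rotated by `q`: the formal sum `∑_{k=1}^l q w^k` with
`w = exp (2 π i / l)`, recorded as the multiset of its terms. -/
noncomputable def cycle (l : ℕ) (q : ℂ) : Multiset ℂ :=
  (Multiset.range l).map fun k => q * Complex.exp (2 * Real.pi * Complex.I / l) ^ (k + 1)

/-- A formal sum is a cycle if it is the full sum of the `l`-th roots of unity for some `l ≥ 2`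
(so that its value is `0`), rotated by a number of modulus one. -/
def IsCycle (c : Multiset ℂ) : Prop :=
  ∃ (l : ℕ) (q : ℂ), 2 ≤ l ∧ ‖q‖ = 1 ∧ c = cycle l q

/-- A formal sum (a multiset of terms) is a sum of cycles if it is a union, with multiplicities,
of finitely many cycles. -/
def IsSumOfCycles (S : Multiset ℂ) : Prop :=
  ∃ C : Multiset (Multiset ℂ), (∀ c ∈ C, IsCycle c) ∧ C.sum = S

/-- The scalar product of the rows `i` and `k` as a formal sum: the multiset of its terms. -/
noncomputable def formalScalarProduct {N : ℕ} (H : Matrix (Fin N) (Fin N) ℂ) (i k : Fin N) :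
    Multiset ℂ :=
  (Finset.univ : Finset (Fin N)).val.map fun j => H i j * conj (H k j)

/-- A regular complex Hadamard matrix: the scalar products between distinct rows decompose, as
formal sums, into sums of cycles. -/
def IsRegularHadamard {N : ℕ} (H : Matrix (Fin N) (Fin N) ℂ) : Prop :=
  IsComplexHadamard H ∧ ∀ i k, i ≠ k → IsSumOfCycles (formalScalarProduct H i k)

/-- The cube root of unity `w = exp (2 π i / 3)`. -/
noncomputable def w : ℂ := Complex.exp (2 * Real.pi * Complex.I / 3)

/-- The deformation of the Fourier matrix coming from `F_2 ⊗ F_3`, with parameters `r, s`. -/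
noncomputable def fourierA (r s : ℂ) : Matrix (Fin 6) (Fin 6) ℂ :=
  !![1, 1, 1, 1, 1, 1;
     1, w, w ^ 2, 1, w, w ^ 2;
     1, w ^ 2, w, 1, w ^ 2, w;
     1, r, s, -1, -r, -s;
     1, w * r, w ^ 2 * s, -1, -(w * r), -(w ^ 2 * s);
     1, w ^ 2 * r, w * s, -1, -(w ^ 2 * r), -(w * s)]

/-- The deformation of the Fourier matrix coming from `F_3 ⊗ F_2`, with parameters `r, s`. -/
noncomputable def fourierB (r s : ℂ) : Matrix (Fin 6) (Fin 6) ℂ :=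
  !![1, 1, 1, 1, 1, 1;
     1, -1, 1, -1, 1, -1;
     1, r, w, w * r, w ^ 2, w ^ 2 * r;
     1, -r, w, -(w * r), w ^ 2, -(w ^ 2 * r);
     1, s, w ^ 2, w ^ 2 * s, w, w * s;
     1, -s, w ^ 2, -(w ^ 2 * s), w, -(w * s)]

/-- The Haagerup matrix with parameter `q`. -/
noncomputable def haagerup (q : ℂ) : Matrix (Fin 6) (Fin 6) ℂ :=
  !![1, 1, 1, 1, 1, 1;
     1, -1, Complex.I, Complex.I, -Complex.I, -Complex.I;
     1, Complex.I, -1, -Complex.I, q, -q;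
     1, Complex.I, -Complex.I, -1, -q, q;
     1, -Complex.I, conj q, -conj q, Complex.I, -1;
     1, -Complex.I, -conj q, conj q, -1, Complex.I]

/-- The Tao matrix. -/
noncomputable def tao : Matrix (Fin 6) (Fin 6) ℂ :=
  !![1, 1, 1, 1, 1, 1;
     1, 1, w, w, w ^ 2, w ^ 2;
     1, w, 1, w ^ 2, w ^ 2, w;
     1, w, w ^ 2, 1, w, w ^ 2;
     1, w ^ 2, w ^ 2, w, 1, w;
     1, w ^ 2, w, w ^ 2, w, 1]

end CHadamard

open scoped ComplexConjugate

namespace CHadamard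

/-! ### The cube root of unity -/

/-! A union of cycles with six terms consists either of three antipodal pairs or of two rotated
copies of the cube roots of unity: even cycles are stable under negation, and an odd cycle leaves
room only for a 3-cycle beside another one. So regularity says that every quotient of two distinct
rows is `NegPaired` or `CubeSplit` (possibly both), and equivalence preserves these two properties
(`isSumOfCycles_iff`, `isRegularHadamard_iff`, `HadamardEquiv.exists_ratio`). The classification
depends on which pairs of rows are `CubeSplit`.

If all are, the entries of a normalized matrix are cube roots of unity (`cube_ratio_eq`). The
problem becomes one about exponents modulo 3, where a finite search leaves only the Tao matrix
(`equiv_tao_of_cubeSplit`).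

If none is, all quotients are antipodal. A count of columns yields a quotient whose squares agree up
to sign (`exists_isQuadUpToScalar`). Either this quotient is real up to a scalar, or it can be
brought to the form (1, -1, i, i, -i, -i), and then the other rows are forced to be those of a
Haagerup matrix (`classified_of_negPaired`).

Otherwise some row i is related to a row k by 3-cycles and to a row l only by antipodal pairs
(`exists_mixed_triple`). Then some quotient is real up to a scalar, or one pairing of the columns
serves both i/l and k/l (`isRealUpToScalar_of_cubeSplit`, `real_or_common_pairing`). Two rows, or
two columns, proportional up to signs force a deformed Fourier matrix (`fourierB_of_real`), and a
common pairing leads back to this situation (`classified_of_common_pairing`).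

For disjointness, Fourier matrices have row quotients of both types, whereas no quotient is
`CubeSplit` for Haagerup matrices and none is `NegPaired` for the Tao matrix. Power sums of the
entries detect this. -/

theorem w_pow_three : w ^ 3 = 1 := by
  rw [w, ← Complex.exp_nat_mul, ← Complex.exp_two_pi_mul_I]
  congr 1
  push_cast
  ring

theorem isPrimitiveRoot_w : IsPrimitiveRoot w 3 := by
  simpa [w] using Complex.isPrimitiveRoot_exp 3 (by norm_num)

theorem w_ne_one : w ≠ 1 := isPrimitiveRoot_w.ne_one (by norm_num)

theorem w_sum : 1 + w + w ^ 2 = 0 := by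
  have h : (w - 1) * (1 + w + w ^ 2) = 0 := by linear_combination w_pow_three
  exact (mul_eq_zero.1 h).resolve_left (sub_ne_zero.2 w_ne_one)

theorem norm_w : ‖w‖ = 1 := by
  simpa [w] using Complex.norm_exp_ofReal_mul_I (2 * Real.pi / 3) ▸
    congrArg norm (show Complex.exp (2 * Real.pi * Complex.I / 3) =
      Complex.exp ((2 * Real.pi / 3 : ℝ) * Complex.I) by congr 1; push_cast; ring)

theorem w_ne_zero : w ≠ 0 := by
  intro h
  simpa [h] using norm_w

theorem conj_eq_inv {z : ℂ} (h : ‖z‖ = 1) : conj z = z⁻¹ := by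
  rw [Complex.inv_def, Complex.normSq_eq_norm_sq, h]; simp

theorem ne_zero_of_norm {z : ℂ} (h : ‖z‖ = 1) : z ≠ 0 := by
  intro h0
  simp [h0] at h

theorem conj_w : conj w = w ^ 2 := by
  rw [conj_eq_inv norm_w]
  field_simp [w_ne_zero]
  linear_combination -w_pow_three

/-- Numbers with equal cubes differ by a cube root of unity. -/
theorem eq_or_of_cube_eq {a b : ℂ} (h : a ^ 3 = b ^ 3) : a = b ∨ a = w * b ∨ a = w ^ 2 * b := by
  have : (a - b) * ((a - w * b) * (a - w ^ 2 * b)) = 0 := by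
    linear_combination h + (-a ^ 2 * b + a * b ^ 2 * w) * w_sum - b ^ 3 * w_pow_three
  rcases mul_eq_zero.1 this with h | h
  · exact Or.inl (sub_eq_zero.1 h)
  rcases mul_eq_zero.1 h with h | h
  · exact Or.inr (Or.inl (sub_eq_zero.1 h))
  · exact Or.inr (Or.inr (sub_eq_zero.1 h))

/-- Three unimodular numbers with sum zero are the vertices of an equilateral triangle. -/
theorem eq_of_add_add_eq_zero {a b c : ℂ} (ha : ‖a‖ = 1) (hb : ‖b‖ = 1) (hc : ‖c‖ = 1)
    (h : a + b + c = 0) :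
    (b = w * a ∧ c = w ^ 2 * a) ∨ (b = w ^ 2 * a ∧ c = w * a) := by
  have ha0 := ne_zero_of_norm ha
  have hb0 := ne_zero_of_norm hb
  have hc0 := ne_zero_of_norm hc
  -- As the inverse of a unimodular number is its conjugate, conjugation turns `h` into ab + bc + ca
  -- = 0. Eliminating c leaves a² + ab + b² = 0.
  have h' := congrArg conj h
  rw [map_add, map_add, conj_eq_inv ha, conj_eq_inv hb, conj_eq_inv hc, map_zero] at h'
  field_simp at h'
  have h3 : (b - w * a) * (b - w ^ 2 * a) = 0 := by
    linear_combination -h' + (b + a) * h - a * b * w_sum + a ^ 2 * w_pow_three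
  rcases mul_eq_zero.1 h3 with h3 | h3
  · left
    have hb := sub_eq_zero.1 h3
    refine ⟨hb, ?_⟩
    linear_combination h - hb - a * w_sum
  · right
    have hb := sub_eq_zero.1 h3
    refine ⟨hb, ?_⟩
    linear_combination h - hb - a * w_sum

/-! ### Reordering -/

/-- Two families with the same multiset of values differ by a permutation of the indices. -/
theorem exists_perm_of_map_eq {ι α : Type*} [Fintype ι] {f g : ι → α}
    (h : (Finset.univ : Finset ι).val.map f = (Finset.univ : Finset ι).val.map g) :
    ∃ σ : Equiv.Perm ι, ∀ i, g (σ i) = f i := by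
  classical
  have key : ∀ v, Nonempty ({i // f i = v} ≃ {i // g i = v}) := by
    intro v
    rw [← Fintype.card_eq, Fintype.card_subtype, Fintype.card_subtype]
    have := congrArg (Multiset.count v) h
    rw [Multiset.count_map, Multiset.count_map] at this
    simpa [Finset.card, Finset.filter, eq_comm] using this
  refine ⟨((Equiv.sigmaFiberEquiv f).symm.trans
    (Equiv.sigmaCongrRight fun v => (key v).some)).trans (Equiv.sigmaFiberEquiv g), fun i => ?_⟩
  simp only [Equiv.trans_apply]
  exact ((key (f i)).some ⟨i, rfl⟩).2

theorem map_univ_six {α : Type*} (f : Fin 6 → α) :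
    (Finset.univ : Finset (Fin 6)).val.map f = {f 0, f 1, f 2, f 3, f 4, f 5} := by
  rfl

/-- A fixed point free permutation of prime order p has only cycles of length p, so on six points
its cycle type is determined by p. -/
theorem conj_of_pow_eq_one {p : ℕ} (hp : p.Prime) {g g' : Equiv.Perm (Fin 6)}
    (hg : g ^ p = 1) (hg' : g' ^ p = 1) (h : ∀ j, g j ≠ j) (h' : ∀ j, g' j ≠ j) :
    IsConj g g' := by
  have key : ∀ k : Equiv.Perm (Fin 6), k ^ p = 1 → (∀ j, k j ≠ j) →
      k.cycleType = Multiset.replicate (6 / p) p := by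
    intro k hk hf
    have ho : orderOf k = p := by
      have := Fact.mk hp
      refine orderOf_eq_prime hk ?_
      rintro rfl
      exact hf 0 rfl
    obtain ⟨n, hn⟩ := Equiv.Perm.cycleType_prime_order (σ := k) (ho ▸ hp)
    have hs := Equiv.Perm.sum_cycleType k
    have hsup : k.support = Finset.univ := by
      ext j; simp [hf j]
    rw [hn, hsup, ho] at hs
    simp at hs
    rw [hn, ho, Nat.div_eq_of_eq_mul_left hp.pos (k := n + 1) (by rw [← hs]; ring)]
  rw [Equiv.Perm.isConj_iff_cycleType_eq, key g hg h, key g' hg' h']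

theorem exists_conj_of_pow_eq_one {p : ℕ} (hp : p.Prime) {g g' : Equiv.Perm (Fin 6)}
    (hg : g ^ p = 1) (hg' : g' ^ p = 1) (h : ∀ j, g j ≠ j) (h' : ∀ j, g' j ≠ j) :
    ∃ σ : Equiv.Perm (Fin 6), ∀ j, g (σ j) = σ (g' j) := by
  obtain ⟨c, hc⟩ := isConj_iff.1 (conj_of_pow_eq_one hp hg' hg h' h)
  exact ⟨c, fun j => by rw [← hc]; simp⟩

/-! ### The two types of vanishing sums of length six -/

/-- The entries can be grouped into three antipodal pairs. -/
def NegPaired (z : Fin 6 → ℂ) : Prop :=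
  ∃ m : Equiv.Perm (Fin 6), (∀ j, m (m j) = j) ∧ ∀ j, z (m j) = -z j

/-- The entries can be grouped into two rotated copies of the cube roots of unity. -/
def CubeSplit (z : Fin 6 → ℂ) : Prop :=
  ∃ g : Equiv.Perm (Fin 6), (∀ j, g (g (g j)) = j) ∧ ∀ j, z (g j) = w * z j

/-- The involution `(0 1)(2 3)(4 5)`. -/
def pairPerm : Equiv.Perm (Fin 6) :=
  ⟨![1, 0, 3, 2, 5, 4], ![1, 0, 3, 2, 5, 4], by decide, by decide⟩

/-- The permutation `(0 1 2)(3 4 5)`. -/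
def triplePerm : Equiv.Perm (Fin 6) :=
  ⟨![1, 2, 0, 4, 5, 3], ![2, 0, 1, 5, 3, 4], by decide, by decide⟩

theorem pairPerm_apply (j : Fin 6) : pairPerm j = ![1, 0, 3, 2, 5, 4] j := rfl

theorem triplePerm_apply (j : Fin 6) : triplePerm j = ![1, 2, 0, 4, 5, 3] j := rfl

theorem NegPaired.comp {z : Fin 6 → ℂ} (h : NegPaired z) (σ : Equiv.Perm (Fin 6)) :
    NegPaired fun j => z (σ j) := by
  obtain ⟨m, h1, h2⟩ := h
  exact ⟨(σ.trans m).trans σ.symm, fun j => by simp [h1], fun j => by simp [h2]⟩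

theorem CubeSplit.comp {z : Fin 6 → ℂ} (h : CubeSplit z) (σ : Equiv.Perm (Fin 6)) :
    CubeSplit fun j => z (σ j) := by
  obtain ⟨m, h1, h2⟩ := h
  exact ⟨(σ.trans m).trans σ.symm, fun j => by simp [h1], fun j => by simp [h2]⟩

theorem NegPaired.const_mul {z : Fin 6 → ℂ} (h : NegPaired z) (c : ℂ) :
    NegPaired fun j => c * z j := by
  obtain ⟨m, h1, h2⟩ := h
  exact ⟨m, h1, fun j => by simp [h2]⟩

theorem CubeSplit.const_mul {z : Fin 6 → ℂ} (h : CubeSplit z) (c : ℂ) :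
    CubeSplit fun j => c * z j := by
  obtain ⟨m, h1, h2⟩ := h
  exact ⟨m, h1, fun j => by simp only [h2]; ring⟩

theorem NegPaired.inv {z : Fin 6 → ℂ} (h : NegPaired z) : NegPaired fun j => (z j)⁻¹ := by
  obtain ⟨m, h1, h2⟩ := h
  exact ⟨m, h1, fun j => by simp [h2, inv_neg]⟩

theorem CubeSplit.inv {z : Fin 6 → ℂ} (h : CubeSplit z) : CubeSplit fun j => (z j)⁻¹ := by
  obtain ⟨m, h1, h2⟩ := h
  have h3 : ∀ j, z j = w * z (m.symm j) := fun j => by simpa using h2 (m.symm j)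
  refine ⟨m.symm, fun j => ?_, fun j => ?_⟩
  · rw [Equiv.symm_apply_eq, Equiv.symm_apply_eq, Equiv.symm_apply_eq, h1]
  · change (z (m.symm j))⁻¹ = w * (z j)⁻¹
    rw [h3 j, mul_inv, ← mul_assoc, mul_inv_cancel₀ w_ne_zero, one_mul]

/-- Reindexing by the pairing turns the power sum into its negative. Together with
`CubeSplit.sum_pow` this gives numerical obstructions to the two types; exponent 1 gives
orthogonality. -/
theorem NegPaired.sum_odd_pow {z : Fin 6 → ℂ} (h : NegPaired z) {n : ℕ} (hn : Odd n) :
    ∑ j, z j ^ n = 0 := by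
  obtain ⟨m, h1, h2⟩ := h
  have := Equiv.sum_comp m fun j => z j ^ n
  simp only [h2, hn.neg_pow, Finset.sum_neg_distrib] at this
  linear_combination -this / 2

theorem CubeSplit.sum_pow {z : Fin 6 → ℂ} (h : CubeSplit z) {n : ℕ} (hn : ¬ 3 ∣ n) :
    ∑ j, z j ^ n = 0 := by
  obtain ⟨m, h1, h2⟩ := h
  have := Equiv.sum_comp m fun j => z j ^ n
  simp only [h2, mul_pow, ← Finset.mul_sum] at this
  have hw : w ^ n - 1 ≠ 0 := fun h => hn ((isPrimitiveRoot_w.pow_eq_one_iff_dvd n).1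
    (sub_eq_zero.1 h))
  have h0 : (w ^ n - 1) * ∑ j, z j ^ n = 0 := by linear_combination this
  exact (mul_eq_zero.1 h0).resolve_left hw

/-- `NegPaired` does not demand that the involution be free of fixed points; this follows from the
entries being nonzero. -/
theorem ne_of_apply_eq_neg {z : Fin 6 → ℂ} (hz : ∀ j, z j ≠ 0) {m : Equiv.Perm (Fin 6)}
    (h : ∀ j, z (m j) = -z j) (j : Fin 6) : m j ≠ j := by
  intro hj
  have := h j
  rw [hj, self_eq_neg] at this
  exact hz j this

theorem ne_of_apply_eq_w_mul {z : Fin 6 → ℂ} (hz : ∀ j, z j ≠ 0) {g : Equiv.Perm (Fin 6)}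
    (h : ∀ j, z (g j) = w * z j) (j : Fin 6) : g j ≠ j := by
  intro hj
  have := h j
  rw [hj, eq_comm] at this
  exact w_ne_one (mul_right_cancel₀ (hz j) (by rw [this, one_mul]))

theorem exists_conj_pairPerm {m : Equiv.Perm (Fin 6)} (h1 : ∀ j, m (m j) = j)
    (h2 : ∀ j, m j ≠ j) : ∃ σ : Equiv.Perm (Fin 6), ∀ j, m (σ j) = σ (pairPerm j) :=
  exists_conj_of_pow_eq_one Nat.prime_two
    (by ext j; simp [pow_two, h1]) (by ext j; fin_cases j <;> rfl) h2 (by decide)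

theorem exists_conj_triplePerm {g : Equiv.Perm (Fin 6)} (h1 : ∀ j, g (g (g j)) = j)
    (h2 : ∀ j, g j ≠ j) : ∃ σ : Equiv.Perm (Fin 6), ∀ j, g (σ j) = σ (triplePerm j) :=
  exists_conj_of_pow_eq_one Nat.prime_three
    (by ext j; simp [pow_succ, h1]) (by ext j; fin_cases j <;> rfl) h2 (by decide)

theorem NegPaired.exists_perm {z : Fin 6 → ℂ} (hz : ∀ j, z j ≠ 0) (h : NegPaired z) :
    ∃ σ : Equiv.Perm (Fin 6), z (σ 1) = -z (σ 0) ∧ z (σ 3) = -z (σ 2) ∧ z (σ 5) = -z (σ 4) := by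
  obtain ⟨m, h1, h2⟩ := h
  obtain ⟨σ, hσ⟩ := exists_conj_pairPerm h1 (ne_of_apply_eq_neg hz h2)
  have key : ∀ j, z (σ (pairPerm j)) = -z (σ j) := fun j => by rw [← hσ, h2]
  exact ⟨σ, key 0, key 2, key 4⟩

theorem CubeSplit.exists_perm {z : Fin 6 → ℂ} (hz : ∀ j, z j ≠ 0) (h : CubeSplit z) :
    ∃ σ : Equiv.Perm (Fin 6), (z (σ 1) = w * z (σ 0) ∧ z (σ 2) = w ^ 2 * z (σ 0)) ∧
      z (σ 4) = w * z (σ 3) ∧ z (σ 5) = w ^ 2 * z (σ 3) := by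
  obtain ⟨m, h1, h2⟩ := h
  obtain ⟨σ, hσ⟩ := exists_conj_triplePerm h1 (ne_of_apply_eq_w_mul hz h2)
  have key : ∀ j, z (σ (triplePerm j)) = w * z (σ j) := fun j => by rw [← hσ, h2]
  have k0 : z (σ 1) = _ := key 0
  have k1 : z (σ 2) = _ := key 1
  have k3 : z (σ 4) = _ := key 3
  have k4 : z (σ 5) = _ := key 4
  refine ⟨σ, ⟨k0, ?_⟩, k3, ?_⟩
  · rw [k1, k0]; ring
  · rw [k4, k3]; ring

theorem negPaired_of_perm {z : Fin 6 → ℂ} (σ : Equiv.Perm (Fin 6)) (h0 : z (σ 1) = -z (σ 0))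
    (h1 : z (σ 3) = -z (σ 2)) (h2 : z (σ 5) = -z (σ 4)) : NegPaired z := by
  have : NegPaired fun j => z (σ j) := by
    refine ⟨pairPerm, by decide, fun j => ?_⟩
    fin_cases j <;> simp [pairPerm_apply, h0, h1, h2]
  simpa using this.comp σ.symm

theorem cubeSplit_of_perm {z : Fin 6 → ℂ} (σ : Equiv.Perm (Fin 6))
    (h1 : z (σ 1) = w * z (σ 0)) (h2 : z (σ 2) = w ^ 2 * z (σ 0))
    (h4 : z (σ 4) = w * z (σ 3)) (h5 : z (σ 5) = w ^ 2 * z (σ 3)) : CubeSplit z := by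
  have : CubeSplit fun j => z (σ j) := by
    refine ⟨triplePerm, by decide, fun j => ?_⟩
    have e2 : ∀ c : ℂ, w * (w * c) = w ^ 2 * c := fun c => by ring
    have e3 : ∀ c : ℂ, w * (w ^ 2 * c) = c := fun c => by linear_combination c * w_pow_three
    fin_cases j <;> simp [triplePerm_apply, h1, h2, h4, h5, e2, e3]
  simpa using this.comp σ.symm

/-! ### Cycles -/

theorem cycle_two (q : ℂ) : cycle 2 q = {q, -q} := by
  have h : Complex.exp (2 * Real.pi * Complex.I / (2 : ℕ)) = -1 := by
    rw [← Complex.exp_pi_mul_I]; congr 1; push_cast; ring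
  rw [cycle, h]
  simp [Multiset.range_succ]

theorem cycle_three (q : ℂ) : cycle 3 q = {q, w * q, w ^ 2 * q} := by
  have h : Complex.exp (2 * Real.pi * Complex.I / (3 : ℕ)) = w := by
    rw [w]; norm_num
  rw [cycle, h]
  have e : q * w ^ 3 = q := by rw [w_pow_three, mul_one]
  simp [Multiset.range_succ, e]
  simp only [mul_comm q]
  exact Multiset.pair_comm _ _

/-- For l = 2k the k-th power of the generating root is -1, so the second half of the cycle is the
negative of the first. -/
theorem cycle_add_self (k : ℕ) (hk : k ≠ 0) (q : ℂ) :
    ∃ A : Multiset ℂ, A.card = k ∧ cycle (k + k) q = A + A.map fun a => -a := by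
  have h : Complex.exp (2 * Real.pi * Complex.I / ((k + k : ℕ) : ℂ)) ^ k = -1 := by
    have hk' : (k : ℂ) ≠ 0 := by exact_mod_cast hk
    rw [← Complex.exp_nat_mul, ← Complex.exp_pi_mul_I]
    congr 1
    push_cast
    field_simp
    ring
  set ζ := Complex.exp (2 * Real.pi * Complex.I / ((k + k : ℕ) : ℂ)) with hζ
  refine ⟨(Multiset.range k).map fun i => q * ζ ^ (i + 1), by simp, ?_⟩
  rw [cycle, ← hζ, Multiset.range_add, Multiset.map_add, Multiset.map_map, Multiset.map_map]
  congr 1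
  refine Multiset.map_congr rfl fun i _ => ?_
  simp only [Function.comp_apply, add_assoc, pow_add ζ k, h]
  ring

theorem card_cycle (l : ℕ) (q : ℂ) : (cycle l q).card = l := by simp [cycle]

/-- Sums of cycles with at most six terms. -/
theorem sum_cycles_cases (C : Multiset (Multiset ℂ)) (hC : ∀ c ∈ C, IsCycle c) :
    C.sum.card ≤ 6 → C.sum.card ≠ 1 ∧ (C.sum.card = 3 → ∃ q, C.sum = cycle 3 q) ∧
      (C.sum.card ≠ 3 → C.sum.card ≠ 5 → (∃ A : Multiset ℂ, C.sum = A + A.map fun a => -a) ∨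
        ∃ p q, C.sum = cycle 3 p + cycle 3 q) := by
  induction C using Multiset.induction with
  | empty => exact fun _ => ⟨by simp, by simp, fun _ _ => Or.inl ⟨0, by simp⟩⟩
  | cons c C ih =>
    have ih' := ih fun d hd => hC d (Multiset.mem_cons_of_mem hd)
    obtain ⟨l, q, hl, -, rfl⟩ := hC c (Multiset.mem_cons_self _ _)
    rw [Multiset.sum_cons, Multiset.card_add, card_cycle]
    intro h6
    obtain ⟨h1, h3, he⟩ := ih' (by omega)
    refine ⟨by omega, fun h => ?_, fun hn3 hn5 => ?_⟩
    · have hl3 : l = 3 := by omega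
      have : C.sum = 0 := Multiset.card_eq_zero.1 (by omega)
      exact ⟨q, by rw [this, hl3, add_zero]⟩
    -- An even cycle adds antipodal pairs to a rest that must itself be antipodal, since two
    -- 3-cycles would already use all six terms.
    · rcases Nat.even_or_odd' l with ⟨k, rfl | rfl⟩
      · obtain ⟨A, -, hA⟩ := cycle_add_self k (by omega) q
        rw [two_mul, hA]
        rcases he (by omega) (by omega) with ⟨B, hB⟩ | ⟨p, r, hpr⟩
        · refine Or.inl ⟨A + B, ?_⟩
          rw [hB, Multiset.map_add]
          abel
        · rw [hpr, Multiset.card_add, card_cycle, card_cycle] at h6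
          omega
      -- Length 5 is impossible here: the rest would have no term, giving the excluded total 5, or a
      -- single term. So l = 3, and only a rest of three terms avoids the excluded cases.
      · have hk : k = 1 := by omega
        subst hk
        obtain ⟨p, hp⟩ := h3 (by omega)
        exact Or.inr ⟨q, p, by rw [hp]⟩

theorem isSumOfCycles_iff {z : Fin 6 → ℂ} (hz : ∀ j, ‖z j‖ = 1) :
    IsSumOfCycles ((Finset.univ : Finset (Fin 6)).val.map z) ↔ NegPaired z ∨ CubeSplit z := by
  have hz0 : ∀ j, z j ≠ 0 := fun j => ne_zero_of_norm (hz j)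
  have hcomp : ∀ σ : Equiv.Perm (Fin 6), (Finset.univ : Finset (Fin 6)).val.map z =
      {z (σ 0), z (σ 1), z (σ 2), z (σ 3), z (σ 4), z (σ 5)} := fun σ => by
    rw [← map_univ_six fun j => z (σ j)]
    have := Multiset.map_univ_val_equiv σ
    conv_lhs => rw [← this]
    rw [Multiset.map_map]
    rfl
  constructor
  · rintro ⟨C, hC, hS⟩
    have hcard : C.sum.card = 6 := by rw [hS]; simp
    obtain ⟨-, -, h⟩ := sum_cycles_cases C hC hcard.le
    rcases h (by omega) (by omega) with ⟨A, hA⟩ | ⟨p, q, hpq⟩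
    · left
      have hA3 : A.card = 3 := by
        rw [hA, Multiset.card_add, Multiset.card_map] at hcard
        omega
      obtain ⟨a, b, c, rfl⟩ := Multiset.card_eq_three.1 hA3
      have : (Finset.univ : Finset (Fin 6)).val.map ![a, -a, b, -b, c, -c] =
          (Finset.univ : Finset (Fin 6)).val.map z := by
        rw [← hS, hA, map_univ_six]
        simp only [Multiset.insert_eq_cons, ← Multiset.singleton_add, Multiset.map_add,
          Multiset.map_singleton]
        simp only [Matrix.cons_val]
        abel
      obtain ⟨σ, hσ⟩ := exists_perm_of_map_eq this
      exact negPaired_of_perm σ (by simp [hσ]) (by simp [hσ]) (by simp [hσ])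
    · right
      have : (Finset.univ : Finset (Fin 6)).val.map
          ![p, w * p, w ^ 2 * p, q, w * q, w ^ 2 * q] =
          (Finset.univ : Finset (Fin 6)).val.map z := by
        rw [← hS, hpq, map_univ_six, cycle_three, cycle_three]
        rfl
      obtain ⟨σ, hσ⟩ := exists_perm_of_map_eq this
      exact cubeSplit_of_perm σ (by simp [hσ]) (by simp [hσ]) (by simp [hσ]) (by simp [hσ])
  · rintro (h | h)
    · obtain ⟨σ, h0, h1, h2⟩ := h.exists_perm hz0
      refine ⟨{cycle 2 (z (σ 0)), cycle 2 (z (σ 2)), cycle 2 (z (σ 4))}, ?_, ?_⟩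
      · simp only [Multiset.insert_eq_cons, Multiset.mem_cons, Multiset.mem_singleton]
        rintro c (rfl | rfl | rfl) <;> exact ⟨2, _, le_rfl, hz _, rfl⟩
      · rw [hcomp σ, h0, h1, h2]
        simp only [Multiset.insert_eq_cons, Multiset.sum_cons, Multiset.sum_singleton, cycle_two]
        rfl
    · obtain ⟨σ, ⟨h1, h2⟩, h4, h5⟩ := h.exists_perm hz0
      refine ⟨{cycle 3 (z (σ 0)), cycle 3 (z (σ 3))}, ?_, ?_⟩
      · simp only [Multiset.insert_eq_cons, Multiset.mem_cons, Multiset.mem_singleton]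
        rintro c (rfl | rfl) <;> exact ⟨3, _, by norm_num, hz _, rfl⟩
      · rw [hcomp σ, h1, h2, h4, h5]
        simp only [Multiset.insert_eq_cons, Multiset.sum_cons, Multiset.sum_singleton, cycle_three]
        rfl

/-! ### Ratios of rows and equivalence -/

/-- The quotient of the rows `i` and `k`. -/
noncomputable def ratio (H : Matrix (Fin 6) (Fin 6) ℂ) (i k : Fin 6) : Fin 6 → ℂ :=
  fun j => H i j / H k j

section Ratio

variable {H : Matrix (Fin 6) (Fin 6) ℂ}

theorem IsComplexHadamard.ne_zero (hH : IsComplexHadamard H) (i j : Fin 6) : H i j ≠ 0 :=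
  ne_zero_of_norm (hH.1 i j)

theorem norm_ratio (hH : ∀ i j, ‖H i j‖ = 1) (i k j : Fin 6) : ‖ratio H i k j‖ = 1 := by
  simp [ratio, hH]

theorem ratio_ne_zero (hH : ∀ i j, ‖H i j‖ = 1) (i k j : Fin 6) : ratio H i k j ≠ 0 :=
  ne_zero_of_norm (norm_ratio hH i k j)

theorem ratio_inv (i k : Fin 6) : (fun j => (ratio H i k j)⁻¹) = ratio H k i := by
  ext j; simp [ratio]

/-- This translates statements about vectors x, y and y/x into statements about three rows. -/
theorem ratio_div_ratio (hH : ∀ i j, ‖H i j‖ = 1) (i k l : Fin 6) :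
    (fun j => ratio H i l j / ratio H k l j) = ratio H i k := by
  ext j
  exact div_div_div_cancel_right₀ (ne_zero_of_norm (hH l j)) _ _

theorem mul_conj_eq_ratio (hH : ∀ i j, ‖H i j‖ = 1) (i k j : Fin 6) :
    H i j * conj (H k j) = ratio H i k j := by
  rw [conj_eq_inv (hH k j), ratio, div_eq_mul_inv]

theorem IsComplexHadamard.sum_ratio (hH : IsComplexHadamard H) {i k : Fin 6} (h : i ≠ k) :
    ∑ j, ratio H i k j = 0 := by
  simpa only [mul_conj_eq_ratio hH.1] using hH.2 i k h

theorem isComplexHadamard_iff : IsComplexHadamard H ↔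
    (∀ i j, ‖H i j‖ = 1) ∧ ∀ i k, i ≠ k → ∑ j, ratio H i k j = 0 := by
  refine and_congr_right fun h => ?_
  simp only [mul_conj_eq_ratio h]

/-- Orthogonality need not be listed on the right: both kinds of sums vanish. -/
theorem isRegularHadamard_iff : IsRegularHadamard H ↔ (∀ i j, ‖H i j‖ = 1) ∧
    ∀ i k, i ≠ k → NegPaired (ratio H i k) ∨ CubeSplit (ratio H i k) := by
  have key : (∀ i j, ‖H i j‖ = 1) → ∀ i k,
      (IsSumOfCycles (formalScalarProduct H i k) ↔
        NegPaired (ratio H i k) ∨ CubeSplit (ratio H i k)) := fun h i k => by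
    rw [← isSumOfCycles_iff (norm_ratio h i k), formalScalarProduct]
    simp only [mul_conj_eq_ratio h]
  constructor
  · rintro ⟨h, hr⟩
    exact ⟨h.1, fun i k hik => (key h.1 i k).1 (hr i k hik)⟩
  · rintro ⟨h, hr⟩
    refine ⟨isComplexHadamard_iff.2 ⟨h, fun i k hik => ?_⟩,
      fun i k hik => (key h i k).2 (hr i k hik)⟩
    rcases hr i k hik with hr | hr
    · simpa using hr.sum_odd_pow odd_one
    · simpa using hr.sum_pow (n := 1) (by norm_num)

end Ratio

section Equiv

variable {N : ℕ} {H K L : Matrix (Fin N) (Fin N) ℂ}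

theorem HadamardEquiv.symm (h : HadamardEquiv H K) : HadamardEquiv K H := by
  obtain ⟨σ, τ, a, b, ha, hb, h⟩ := h
  refine ⟨σ.symm, τ.symm, fun i => (a (σ.symm i))⁻¹, fun j => (b (τ.symm j))⁻¹,
    fun i => by simp [ha], fun j => by simp [hb], fun i j => ?_⟩
  have h1 := ne_zero_of_norm (ha (σ.symm i))
  have h2 := ne_zero_of_norm (hb (τ.symm j))
  rw [h, σ.apply_symm_apply, τ.apply_symm_apply]
  field_simp

theorem HadamardEquiv.trans (h : HadamardEquiv H K) (h' : HadamardEquiv K L) :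
    HadamardEquiv H L := by
  obtain ⟨σ, τ, a, b, ha, hb, h⟩ := h
  obtain ⟨σ', τ', a', b', ha', hb', h'⟩ := h'
  refine ⟨σ'.trans σ, τ'.trans τ, fun i => a' i * a (σ' i), fun j => b' j * b (τ' j),
    fun i => by simp [ha, ha'], fun j => by simp [hb, hb'], fun i j => ?_⟩
  rw [h', h]
  simp only [Equiv.trans_apply]
  ring

theorem HadamardEquiv.transpose (h : HadamardEquiv H K) :
    HadamardEquiv H.transpose K.transpose := by
  obtain ⟨σ, τ, a, b, ha, hb, h⟩ := h
  refine ⟨τ, σ, b, a, hb, ha, fun i j => ?_⟩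
  rw [Matrix.transpose_apply, Matrix.transpose_apply, h]
  ring

theorem HadamardEquiv.reindex (H : Matrix (Fin N) (Fin N) ℂ) (σ τ : Equiv.Perm (Fin N)) :
    HadamardEquiv H (fun i j => H (σ i) (τ j)) :=
  ⟨σ, τ, fun _ => 1, fun _ => 1, by simp, by simp, by simp⟩

theorem HadamardEquiv.isComplexHadamard (h : HadamardEquiv H K) (hH : IsComplexHadamard H) :
    IsComplexHadamard K := by
  obtain ⟨σ, τ, a, b, ha, hb, h⟩ := h
  refine ⟨fun i j => by simp [h, ha, hb, hH.1], fun i k hik => ?_⟩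
  have : ∀ j, K i j * conj (K k j) =
      a i * conj (a k) * (H (σ i) (τ j) * conj (H (σ k) (τ j))) := fun j => by
    have hb' : b j * conj (b j) = 1 := by
      rw [conj_eq_inv (hb j), mul_inv_cancel₀ (ne_zero_of_norm (hb j))]
    rw [h, h, map_mul, map_mul]
    linear_combination (a i * conj (a k) * (H (σ i) (τ j) * conj (H (σ k) (τ j)))) * hb'
  rw [Finset.sum_congr rfl fun j _ => this j, ← Finset.mul_sum,
    Equiv.sum_comp τ fun j => H (σ i) j * conj (H (σ k) j), hH.2 _ _ (σ.injective.ne hik),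
    mul_zero]

end Equiv

/-- The column multipliers cancel in a quotient of rows, so only a scalar and a reordering remain.
Hence the types of the quotients are invariants of equivalence. -/
theorem HadamardEquiv.exists_ratio {H K : Matrix (Fin 6) (Fin 6) ℂ} (h : HadamardEquiv H K) :
    ∃ σ τ : Equiv.Perm (Fin 6), ∀ i k, ∃ c : ℂ, ‖c‖ = 1 ∧
      ratio K i k = fun j => c * ratio H (σ i) (σ k) (τ j) := by
  obtain ⟨σ, τ, a, b, ha, hb, h⟩ := h
  refine ⟨σ, τ, fun i k => ⟨a i / a k, by simp [ha], ?_⟩⟩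
  ext j
  have := ne_zero_of_norm (hb j)
  simp only [ratio, h]
  rw [mul_right_comm, mul_right_comm (a k), mul_div_mul_right _ _ this, mul_div_mul_comm]

/-- Orthogonality of the rows says H H* = N. A right inverse of a square matrix is a left inverse,
so H* H = N, which is orthogonality of the columns. -/
theorem IsComplexHadamard.transpose {N : ℕ} {H : Matrix (Fin N) (Fin N) ℂ}
    (hH : IsComplexHadamard H) : IsComplexHadamard H.transpose := by
  refine ⟨fun i j => hH.1 j i, fun i k hik => ?_⟩
  have hN : (N : ℂ) ≠ 0 := by
    have : 0 < N := i.pos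
    exact_mod_cast this.ne'
  have h1 : H * ((N : ℂ)⁻¹ • H.conjTranspose) = 1 := by
    ext r s
    rw [Matrix.mul_smul, Matrix.smul_apply, Matrix.mul_apply]
    simp only [Matrix.conjTranspose_apply, RCLike.star_def]
    by_cases hrs : r = s
    · subst hrs
      have : ∀ j, H r j * conj (H r j) = 1 := fun j => by
        rw [conj_eq_inv (hH.1 r j), mul_inv_cancel₀ (ne_zero_of_norm (hH.1 r j))]
      simp [this, hN]
    · rw [hH.2 r s hrs, Matrix.one_apply_ne hrs, smul_zero]
  have h2 := mul_eq_one_comm.1 h1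
  have h3 := congrFun (congrFun h2 k) i
  rw [Matrix.smul_mul, Matrix.smul_apply, Matrix.mul_apply, Matrix.one_apply_ne hik.symm,
    smul_eq_mul] at h3
  have h4 := (mul_eq_zero.1 h3).resolve_left (inv_ne_zero hN)
  rw [← h4]
  refine Finset.sum_congr rfl fun j _ => ?_
  simp [mul_comm]

/-- The matrices in the classification. -/
def IsClassified (H : Matrix (Fin 6) (Fin 6) ℂ) : Prop :=
  (∃ r s : ℂ, ‖r‖ = 1 ∧ ‖s‖ = 1 ∧
    (HadamardEquiv H (fourierA r s) ∨ HadamardEquiv H (fourierB r s))) ∨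
  (∃ q : ℂ, ‖q‖ = 1 ∧ HadamardEquiv H (haagerup q)) ∨ HadamardEquiv H tao

theorem IsClassified.of_equiv {H K : Matrix (Fin 6) (Fin 6) ℂ} (hK : IsClassified K)
    (h : HadamardEquiv H K) : IsClassified H := by
  rcases hK with ⟨r, s, hr, hs, hK | hK⟩ | ⟨q, hq, hK⟩ | hK
  · exact Or.inl ⟨r, s, hr, hs, Or.inl (h.trans hK)⟩
  · exact Or.inl ⟨r, s, hr, hs, Or.inr (h.trans hK)⟩
  · exact Or.inr (Or.inl ⟨q, hq, h.trans hK⟩)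
  · exact Or.inr (Or.inr (h.trans hK))

theorem isRegularHadamard_of_equiv {H K : Matrix (Fin 6) (Fin 6) ℂ} (h : HadamardEquiv H K)
    (hH : IsRegularHadamard H) : IsRegularHadamard K := by
  have hK := (h.isComplexHadamard hH.1).1
  obtain ⟨σ, τ, hr⟩ := h.exists_ratio
  refine isRegularHadamard_iff.2 ⟨hK, fun i k hik => ?_⟩
  obtain ⟨c, -, hc⟩ := hr i k
  rw [hc]
  exact ((isRegularHadamard_iff.1 hH).2 _ _ (σ.injective.ne hik)).imp
    (fun h => (h.comp τ).const_mul c) (fun h => (h.comp τ).const_mul c)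

/-- The matrix with reordered rows and columns, normalized to have first row and column `1`. -/
noncomputable def dephase (H : Matrix (Fin 6) (Fin 6) ℂ) (σ τ : Equiv.Perm (Fin 6)) :
    Matrix (Fin 6) (Fin 6) ℂ :=
  fun l j => ratio H (σ l) (σ 0) (τ j) / ratio H (σ l) (σ 0) (τ 0)

section Dephase

variable {H : Matrix (Fin 6) (Fin 6) ℂ} (hH : IsComplexHadamard H) (σ τ : Equiv.Perm (Fin 6))

include hH in
theorem equiv_dephase : HadamardEquiv H (dephase H σ τ) := by
  refine ⟨σ, τ, fun l => (H (σ l) (τ 0))⁻¹ * H (σ 0) (τ 0), fun j => (H (σ 0) (τ j))⁻¹,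
    fun i => by simp [hH.1], fun j => by simp [hH.1], fun l j => ?_⟩
  have := hH.ne_zero
  simp only [dephase, ratio]
  field_simp [this]

include hH in
theorem isComplexHadamard_dephase : IsComplexHadamard (dephase H σ τ) :=
  (equiv_dephase hH σ τ).isComplexHadamard hH

include hH in
theorem dephase_zero_left (j : Fin 6) : dephase H σ τ 0 j = 1 := by
  have := hH.ne_zero
  simp only [dephase, ratio]
  field_simp [this]

include hH in
theorem dephase_zero_right (l : Fin 6) : dephase H σ τ l 0 = 1 :=
  div_self (ratio_ne_zero hH.1 _ _ _)

end Dephase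

theorem exists_perm_two {i k : Fin 6} (h : i ≠ k) :
    ∃ σ : Equiv.Perm (Fin 6), σ 0 = i ∧ σ 1 = k := by
  refine ⟨Equiv.swap 0 i * Equiv.swap 1 (Equiv.swap 0 i k), ?_⟩
  revert i k
  decide

theorem exists_perm_three {i k l : Fin 6} (h : i ≠ k) (h' : i ≠ l) (h'' : k ≠ l) :
    ∃ σ : Equiv.Perm (Fin 6), σ 0 = i ∧ σ 1 = k ∧ σ 2 = l := by
  obtain ⟨σ, h0, h1⟩ := exists_perm_two h
  refine ⟨σ * Equiv.swap 2 (σ.symm l), ?_⟩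
  have a : σ.symm l ≠ 0 := fun h => h' (by rw [← h0, ← h, Equiv.apply_symm_apply])
  have b : σ.symm l ≠ 1 := fun h => h'' (by rw [← h1, ← h, Equiv.apply_symm_apply])
  simp [Equiv.swap_apply_of_ne_of_ne (show (0 : Fin 6) ≠ 2 by decide) a.symm,
    Equiv.swap_apply_of_ne_of_ne (show (1 : Fin 6) ≠ 2 by decide) b.symm, h0, h1]

/-! ### Deformed Fourier matrices -/

/-- All entries agree up to sign. -/
def IsRealUpToScalar (z : Fin 6 → ℂ) : Prop := ∀ j k, z j ^ 2 = z k ^ 2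

theorem exists_perm_of_sum_signs (s : Fin 6 → Bool)
    (hs : ∑ j, (if s j then 1 else -1 : ℤ) = 0) :
    ∃ τ : Equiv.Perm (Fin 6), ∀ j, s (τ j) = ![true, false, true, false, true, false] j := by
  refine exists_perm_of_map_eq ?_
  revert s
  decide

theorem IsRealUpToScalar.exists_perm {z : Fin 6 → ℂ} (h : IsRealUpToScalar z)
    (hz : ∀ j, z j ≠ 0) (hs : ∑ j, z j = 0) :
    ∃ τ : Equiv.Perm (Fin 6), ∀ j, z (τ j) = ![1, -1, 1, -1, 1, -1] j * z (τ 0) := by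
  classical
  have hs' : ∀ j, z j = (((if decide (z j = z 0) then 1 else -1 : ℤ)) : ℂ) * z 0 := fun j => by
    rcases sq_eq_sq_iff_eq_or_eq_neg.1 (h j 0) with h | h
    · simp [h]
    · have : -z 0 ≠ z 0 := fun h' => hz 0 (neg_eq_self.1 h')
      simp [h, this]
  have h0 : ∑ j, (if decide (z j = z 0) then 1 else -1 : ℤ) = 0 := by
    rw [Finset.sum_congr rfl fun j _ => hs' j, ← Finset.sum_mul, ← Int.cast_sum] at hs
    exact_mod_cast (mul_eq_zero.1 hs).resolve_right (hz 0)
  obtain ⟨τ, hτ⟩ := exists_perm_of_sum_signs (fun j => decide (z j = z 0)) h0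
  refine ⟨τ, fun j => ?_⟩
  rw [hs' (τ j), hs' (τ 0)]
  have h1 := hτ j
  have h2 := hτ 0
  rw [h1, h2]
  fin_cases j <;> simp

/-- Among the four indices 2, …, 5 no three carry the same label, so each label occurs exactly twice
and the indices can be sorted by label. -/
theorem exists_perm_of_no_three (e : Fin 6 → Bool)
    (h : ∀ i j k : Fin 6, 2 ≤ i → i < j → j < k → ¬ (e i = e j ∧ e i = e k)) :
    ∃ ρ : Equiv.Perm (Fin 6), ρ 0 = 0 ∧ ρ 1 = 1 ∧ (2 ≤ ρ 2 ∧ 2 ≤ ρ 3 ∧ 2 ≤ ρ 4 ∧ 2 ≤ ρ 5) ∧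
      e (ρ 2) = true ∧ e (ρ 3) = true ∧ e (ρ 4) = false ∧ e (ρ 5) = false := by
  have a := h 2 3 4 (by decide) (by decide) (by decide)
  have b := h 2 3 5 (by decide) (by decide) (by decide)
  have c := h 2 4 5 (by decide) (by decide) (by decide)
  have d := h 3 4 5 (by decide) (by decide) (by decide)
  clear h
  cases h2 : e 2 <;> cases h3 : e 3 <;> cases h4 : e 4 <;> cases h5 : e 5 <;>
    simp [h2, h3, h4, h5] at a b c d
  · exact ⟨Equiv.swap 2 4 * Equiv.swap 3 5, by decide, by decide, by decide, h4, h5, h2, h3⟩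
  · exact ⟨Equiv.swap 2 5, by decide, by decide, by decide, h5, h3, h4, h2⟩
  · exact ⟨Equiv.swap 2 4, by decide, by decide, by decide, h4, h3, h2, h5⟩
  · exact ⟨Equiv.swap 3 5, by decide, by decide, by decide, h2, h5, h4, h3⟩
  · exact ⟨Equiv.swap 3 4, by decide, by decide, by decide, h2, h4, h3, h5⟩
  · exact ⟨1, by decide, by decide, by decide, h2, h3, h4, h5⟩

theorem forall_fin_six {P : Fin 6 → Prop} :
    (∀ i, P i) ↔ P 0 ∧ P 1 ∧ P 2 ∧ P 3 ∧ P 4 ∧ P 5 :=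
  ⟨fun h => ⟨h 0, h 1, h 2, h 3, h 4, h 5⟩, fun ⟨h0, h1, h2, h3, h4, h5⟩ i => by
    fin_cases i <;> assumption⟩

theorem conj_mul_self {z : ℂ} (h : ‖z‖ = 1) : z * conj z = 1 := by
  rw [conj_eq_inv h, mul_inv_cancel₀ (ne_zero_of_norm h)]

/-- Equivalence to a deformed Fourier matrix of the second kind. -/
def IsFourierB (H : Matrix (Fin 6) (Fin 6) ℂ) : Prop :=
  ∃ r s : ℂ, ‖r‖ = 1 ∧ ‖s‖ = 1 ∧ HadamardEquiv H (fourierB r s)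

theorem IsFourierB.of_equiv {H K : Matrix (Fin 6) (Fin 6) ℂ} (hK : IsFourierB K)
    (h : HadamardEquiv H K) : IsFourierB H := by
  obtain ⟨r, s, hr, hs, hK⟩ := hK
  exact ⟨r, s, hr, hs, h.trans hK⟩

/-- Two rows with the same order of the cube roots have scalar product 3(1 + p p̄'), so
orthogonality forces p' = -p. Three such rows would give p = -p; hence each order occurs twice, with
opposite parameters. -/
theorem fourierB_of_fourier_rows {K : Matrix (Fin 6) (Fin 6) ℂ} (hK : IsComplexHadamard K)
    (h0 : K 0 = ![1, 1, 1, 1, 1, 1]) (h1 : K 1 = ![1, -1, 1, -1, 1, -1])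
    (h : ∀ l, 2 ≤ l → ∃ p, ‖p‖ = 1 ∧ (K l = ![1, p, w, w * p, w ^ 2, w ^ 2 * p] ∨
      K l = ![1, p, w ^ 2, w ^ 2 * p, w, w * p])) : IsFourierB K := by
  classical
  choose! p hp hrow using h
  let e : Fin 6 → Bool := fun l => decide (K l 2 = w)
  have hne : w ^ 2 ≠ w := fun h => w_ne_one (mul_left_cancel₀ w_ne_zero (by linear_combination h))
  have ht : ∀ l, 2 ≤ l → e l = true → K l = ![1, p l, w, w * p l, w ^ 2, w ^ 2 * p l] :=
    fun l hl he => (hrow l hl).resolve_right fun h => by simp [e, h, hne] at he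
  have hf : ∀ l, 2 ≤ l → e l = false → K l = ![1, p l, w ^ 2, w ^ 2 * p l, w, w * p l] :=
    fun l hl he => (hrow l hl).resolve_left fun h => by simp [e, h] at he
  have hneg : ∀ l l', 2 ≤ l → 2 ≤ l' → l ≠ l' → e l = e l' → p l' = -p l := by
    intro l l' hl hl' hll he
    have ho := hK.2 l l' hll
    have hpc := conj_mul_self (hp l' hl')
    have h3 : (1 + p l * conj (p l')) * 3 = 0 := by
      rw [Fin.sum_univ_six] at ho
      cases hel : e l
      · rw [hf l hl hel, hf l' hl' (he ▸ hel)] at ho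
        simp [conj_w] at ho
        linear_combination ho - (1 + p l * conj (p l')) * (2 + w ^ 3) * w_pow_three
      · rw [ht l hl hel, ht l' hl' (he ▸ hel)] at ho
        simp [conj_w] at ho
        linear_combination ho - (1 + p l * conj (p l')) * (2 + w ^ 3) * w_pow_three
    have h4 := (mul_eq_zero.1 h3).resolve_right (by norm_num)
    linear_combination p l' * h4 - p l * hpc
  obtain ⟨ρ, hρ0, hρ1, ⟨l2, l3, l4, l5⟩, e2, e3, e4, e5⟩ := exists_perm_of_no_three e (by
    rintro i j k hi hij hjk ⟨h, h'⟩
    have hj := hi.trans hij.le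
    have a := hneg i j hi hj hij.ne h
    have b := hneg i k hi (hj.trans hjk.le) (hij.trans hjk).ne h'
    have c := hneg j k hj (hj.trans hjk.le) hjk.ne (h ▸ h')
    refine ne_zero_of_norm (hp i hi) ?_
    linear_combination (a + b - c) / 2)
  refine ⟨p (ρ 2), p (ρ 4), hp _ l2, hp _ l4,
    ⟨ρ, 1, fun _ => 1, fun _ => 1, by simp, by simp, fun i j => ?_⟩⟩
  have r2 := ht _ l2 e2
  have r3 := ht _ l3 e3
  have r4 := hf _ l4 e4
  have r5 := hf _ l5 e5
  rw [hneg _ _ l2 l3 (ρ.injective.ne (by decide)) (by rw [e2, e3])] at r3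
  rw [hneg _ _ l4 l5 (ρ.injective.ne (by decide)) (by rw [e4, e5])] at r5
  rw [one_mul, one_mul, Equiv.Perm.one_apply]
  simp only [mul_neg] at r3 r5
  have key : ∀ i, fourierB (p (ρ 2)) (p (ρ 4)) i = K (ρ i) :=
    forall_fin_six.2 ⟨by rw [hρ0, h0]; rfl, by rw [hρ1, h1]; rfl, r2.symm, r3.symm, r4.symm,
      r5.symm⟩
  rw [key]

/-- The two primitive cube roots of unity. -/
noncomputable def omega (e : Bool) : ℂ := cond e w (w ^ 2)

theorem conj_omega (e : Bool) : conj (omega e) = omega !e := by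
  cases e
  · simp only [omega, cond_false, cond_true, Bool.not_false, map_pow, conj_w]
    linear_combination w * w_pow_three
  · simp [omega, conj_w]

theorem omega_mul_omega_not (e : Bool) : omega e * omega (!e) = 1 := by
  cases e <;> simp [omega] <;> linear_combination w_pow_three

theorem omega_sq (e : Bool) : omega e * omega e = omega !e := by
  cases e
  · simp [omega]; linear_combination w * w_pow_three
  · simp [omega]; ring

theorem omega_not_sq (e : Bool) : omega (!e) * omega (!e) = omega e := by
  rw [omega_sq, Bool.not_not]

theorem omega_sum (e : Bool) : 1 + omega e + omega (!e) = 0 := by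
  cases e <;> simp [omega] <;> linear_combination w_sum

theorem exists_omega {a b c : ℂ} (ha : ‖a‖ = 1) (hb : ‖b‖ = 1) (hc : ‖c‖ = 1)
    (h : a + b + c = 0) : ∃ e, b = omega e * a ∧ c = omega (!e) * a := by
  rcases eq_of_add_add_eq_zero ha hb hc h with h | h
  · exact ⟨true, h⟩
  · exact ⟨false, h⟩

/-- Orthogonality to the first two rows makes the entries in even columns, and those in odd columns,
sum to zero; each triple is an equilateral triangle, with orientations `e` and `o`. A row with `e =
o` cannot be orthogonal to one with `e ≠ o`: exactly one of the two triples contributes, and with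
modulus 3. -/
theorem fourierB_of_real_normalized {K : Matrix (Fin 6) (Fin 6) ℂ} (hK : IsComplexHadamard K)
    (h0 : K 0 = ![1, 1, 1, 1, 1, 1]) (h1 : K 1 = ![1, -1, 1, -1, 1, -1])
    (hc : ∀ l, K l 0 = 1) : IsFourierB K := by
  have hrow : ∀ l, 2 ≤ l → ∃ e o,
      K l = ![1, K l 1, omega e, omega o * K l 1, omega !e, (omega !o) * K l 1] := by
    intro l hl
    have a := hK.2 l 0 (by rintro rfl; exact absurd hl (by decide))
    have b := hK.2 l 1 (by rintro rfl; exact absurd hl (by decide))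
    rw [h0, Fin.sum_univ_six] at a
    rw [h1, Fin.sum_univ_six] at b
    simp at a b
    obtain ⟨e, e1, e2⟩ := exists_omega (hK.1 l 0) (hK.1 l 2) (hK.1 l 4)
      (by linear_combination (a + b) / 2)
    obtain ⟨o, o1, o2⟩ := exists_omega (hK.1 l 1) (hK.1 l 3) (hK.1 l 5)
      (by linear_combination (a - b) / 2)
    rw [hc, mul_one] at e1 e2
    refine ⟨e, o, ?_⟩
    rw [← e1, ← e2, ← o1, ← o2]
    ext j
    fin_cases j <;> simp [hc]
  choose! e o hrow using hrow
  by_cases hall : ∀ l, 2 ≤ l → e l = o l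
  · refine fourierB_of_fourier_rows hK h0 h1 fun l hl => ⟨K l 1, hK.1 _ _, ?_⟩
    have hl' := hrow l hl
    rw [← hall l hl] at hl'
    cases he : e l <;> rw [he] at hl'
    · exact Or.inr hl'
    · exact Or.inl hl'
  · push Not at hall
    obtain ⟨l, hl, hlo⟩ := hall
    have hall' : ∀ k, 2 ≤ k → o k = !e k := by
      intro k hk
      by_contra hk'
      have hko : o k = e k := by simpa using hk'
      have hlo' : o l = !e l := by
        cases h : o l <;> cases h' : e l <;> simp_all
      have hlk : l ≠ k := by
        rintro rfl
        exact hlo hko.symm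
      have ho := hK.2 l k hlk
      have hp : K l 1 * conj (K k 1) * 3 ≠ 0 := by
        simpa using ⟨ne_zero_of_norm (hK.1 l 1), ne_zero_of_norm (hK.1 k 1)⟩
      rw [Fin.sum_univ_six, hrow l hl, hrow k hk, hko, hlo'] at ho
      simp [conj_omega] at ho
      rcases Bool.eq_or_eq_not (e l) (e k) with he | he <;> rw [he] at ho <;>
        try simp only [Bool.not_not] at ho
      · refine three_ne_zero (α := ℂ) ?_
        linear_combination ho - 2 * omega_mul_omega_not (e k) -
          K l 1 * conj (K k 1) * (omega_sum (e k) + omega_sq (e k) + omega_not_sq (e k))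
      · refine hp ?_
        linear_combination ho - 2 * K l 1 * conj (K k 1) * omega_mul_omega_not (e k) -
          (omega_sum (e k) + omega_sq (e k) + omega_not_sq (e k))
    -- Exchanging the columns 3 and 5 reverses the orientation of the odd triangles and leads back
    -- to equal orientations.
    refine IsFourierB.of_equiv ?_ (HadamardEquiv.reindex K 1 (Equiv.swap 3 5))
    have hrw : ∀ l, (fun i j => K ((1 : Equiv.Perm (Fin 6)) i) (Equiv.swap 3 5 j)) l =
        ![K l 0, K l 1, K l 2, K l 5, K l 4, K l 3] := fun l => by
      ext j; fin_cases j <;> rfl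
    refine fourierB_of_fourier_rows ((HadamardEquiv.reindex K 1 _).isComplexHadamard hK)
      ((hrw 0).trans (by rw [h0]; rfl)) ((hrw 1).trans (by rw [h1]; rfl))
      fun l hl => ⟨K l 1, hK.1 _ _, ?_⟩
    refine Or.imp (hrw l).trans (hrw l).trans ?_
    rw [hc]
    have hl' := hrow l hl
    have h2 := congrFun hl' 2
    have h3 := congrFun hl' 3
    have h4 := congrFun hl' 4
    have h5 := congrFun hl' 5
    rw [hall' l hl] at h3 h5
    rw [h2, h3, h4, h5]
    cases he : e l
    · exact Or.inr (by simp [omega])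
    · exact Or.inl (by simp [omega])

theorem fourierB_of_real {H : Matrix (Fin 6) (Fin 6) ℂ} (hH : IsComplexHadamard H)
    {i k : Fin 6} (hik : i ≠ k) (h : IsRealUpToScalar (ratio H k i)) : IsFourierB H := by
  obtain ⟨σ, rfl, rfl⟩ := exists_perm_two hik
  obtain ⟨τ, hτ⟩ := h.exists_perm (ratio_ne_zero hH.1 _ _) (hH.sum_ratio hik.symm)
  refine IsFourierB.of_equiv ?_ (equiv_dephase hH σ τ)
  refine fourierB_of_real_normalized (isComplexHadamard_dephase hH σ τ) ?_ ?_
    (dephase_zero_right hH σ τ)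
  · ext j
    rw [dephase_zero_left hH]
    fin_cases j <;> rfl
  · ext j
    rw [dephase, hτ, mul_div_assoc, div_self (ratio_ne_zero hH.1 _ _ _), mul_one]

/-- A complex Hadamard matrix with two rows that are proportional up to signs is a deformed
Fourier matrix. -/
theorem classified_of_real {H : Matrix (Fin 6) (Fin 6) ℂ} (hH : IsComplexHadamard H)
    {i k : Fin 6} (hik : i ≠ k) (h : IsRealUpToScalar (ratio H k i)) : IsClassified H := by
  obtain ⟨r, s, hr, hs, hB⟩ := fourierB_of_real hH hik h
  exact Or.inl ⟨r, s, hr, hs, Or.inr hB⟩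

/-- Listing the even indices before the odd ones passes from the ordering of F₃ ⊗ F₂ to that of F₂ ⊗
F₃. -/
theorem fourierB_transpose_equiv (r s : ℂ) :
    HadamardEquiv (fourierB r s).transpose (fourierA r s) := by
  obtain ⟨σ, hσ⟩ : ∃ σ : Equiv.Perm (Fin 6), ∀ i, σ i = ![0, 2, 4, 1, 3, 5] i :=
    ⟨⟨![0, 2, 4, 1, 3, 5], ![0, 3, 1, 4, 2, 5], by decide, by decide⟩, fun _ => rfl⟩
  refine ⟨σ, σ, fun _ => 1, fun _ => 1, by simp, by simp, fun i j => ?_⟩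
  rw [Matrix.transpose_apply, hσ, hσ, one_mul, one_mul]
  fin_cases i <;> fin_cases j <;> simp [fourierA, fourierB]

/-- A complex Hadamard matrix with two columns that are proportional up to signs is a deformed
Fourier matrix. -/
theorem classified_of_real_columns {H : Matrix (Fin 6) (Fin 6) ℂ} (hH : IsComplexHadamard H)
    {i k : Fin 6} (hik : i ≠ k) (h : IsRealUpToScalar (ratio H.transpose k i)) :
    IsClassified H := by
  obtain ⟨r, s, hr, hs, hB⟩ := fourierB_of_real hH.transpose hik h
  exact Or.inl ⟨r, s, hr, hs, Or.inl (hB.transpose.trans (fourierB_transpose_equiv r s))⟩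

/-! ### Rows with a common pairing of the columns -/

theorem norm_omega (e : Bool) : ‖omega e‖ = 1 := by
  cases e <;> simp [omega, norm_w]

theorem norm_eq_one_of_sq {u : ℂ} (h : ‖u ^ 2‖ = 1) : ‖u‖ = 1 := by
  rw [norm_pow] at h
  exact (pow_eq_one_iff_of_nonneg (norm_nonneg u) two_ne_zero).1 h

/-- A row orthogonal to `1`, to `(1, 1, ω, ω, ω', ω')` and to `(1, -1, a, -a, b, -b)`. -/
theorem row_cases_of_common_pairing {y : Fin 6 → ℂ} (hy : ∀ j, ‖y j‖ = 1) {a b : ℂ}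
    (ha : ‖a‖ = 1) (hb : ‖b‖ = 1) (e : Bool)
    (h0 : y 0 + y 1 + (y 2 + y 3) + (y 4 + y 5) = 0)
    (h1 : y 0 + y 1 + omega (!e) * (y 2 + y 3) + omega e * (y 4 + y 5) = 0)
    (h2 : y 0 - y 1 + conj a * (y 2 - y 3) + conj b * (y 4 - y 5) = 0) :
    y 1 = y 0 ∨ y 1 = -y 0 ∨ (a ^ 2 = 1 ∧ b ^ 2 = 1) ∨
      (a ^ 2 = omega e ^ 2 ∧ b ^ 2 = omega (!e) ^ 2) := by
  have hm := omega_mul_omega_not e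
  have hs := omega_sum e
  have hq := omega_sq e
  have hq' := omega_not_sq e
  have hne : ∀ f, omega f ≠ 0 := fun f => ne_zero_of_norm (norm_omega f)
  have hne1 : omega e - omega (!e) ≠ 0 := by
    intro h
    have h3 : (3 : ℂ) = 0 := by
      linear_combination -(omega e - omega (!e)) * h + hq + hq' - 2 * hm + hs
    norm_num at h3
  have hs2 : y 2 + y 3 = omega (!e) * (y 0 + y 1) := by
    refine mul_left_cancel₀ hne1 ?_
    linear_combination omega e * h0 - h1 - (y 0 + y 1) * (hm - hq')
  have hs3 : y 4 + y 5 = omega e * (y 0 + y 1) := by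
    linear_combination h0 - hs2 - (y 0 + y 1) * hs
  by_cases hs0 : y 0 + y 1 = 0
  · exact Or.inr (Or.inl (by linear_combination hs0))
  by_cases hd0 : y 0 - y 1 = 0
  · exact Or.inl (by linear_combination -hd0)
  -- With s = y₀ + y₁ nonzero, the other two pair sums are cube roots of unity times s. A nonzero
  -- sum of two unimodular numbers determines their product by conjugation, so the squared
  -- differences of the pairs are also known relative to (y₀ - y₁)².
  refine Or.inr (Or.inr ?_)
  have hy0 : ∀ j, y j ≠ 0 := fun j => ne_zero_of_norm (hy j)
  have hc2 := congrArg conj hs2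
  have hc3 := congrArg conj hs3
  simp only [map_add, map_mul, conj_omega, Bool.not_not, conj_eq_inv (hy _)] at hc2 hc3
  have hinv : ∀ {s t : ℂ}, s ≠ 0 → t ≠ 0 → (s⁻¹ + t⁻¹) * (s * t) = s + t := fun hs ht => by
    field_simp; ring
  have h01 := hinv (hy0 0) (hy0 1)
  have h23 := hinv (hy0 2) (hy0 3)
  have h45 := hinv (hy0 4) (hy0 5)
  have hp2 : y 2 * y 3 = omega e * (y 0 * y 1) := by
    refine mul_left_cancel₀ hs0 ?_
    linear_combination (-y 2 * y 3 * omega (!e) * y 0 * y 1) * hc2 +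
      omega (!e) * y 0 * y 1 * h23 - omega (!e) * omega e * y 2 * y 3 * h01 -
      (y 0 + y 1) * y 2 * y 3 * hm + omega (!e) * y 0 * y 1 * hs2 +
      (y 0 + y 1) * y 0 * y 1 * hq'
  have hp3 : y 4 * y 5 = omega (!e) * (y 0 * y 1) := by
    refine mul_left_cancel₀ hs0 ?_
    linear_combination (-y 4 * y 5 * omega e * y 0 * y 1) * hc3 +
      omega e * y 0 * y 1 * h45 - omega (!e) * omega e * y 4 * y 5 * h01 -
      (y 0 + y 1) * y 4 * y 5 * hm + omega e * y 0 * y 1 * hs3 +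
      (y 0 + y 1) * y 0 * y 1 * hq
  have hd2 : (y 2 - y 3) ^ 2 = omega e * (y 0 - y 1) ^ 2 := by
    linear_combination (y 2 + y 3 + omega (!e) * (y 0 + y 1)) * hs2 - 4 * hp2 +
      (y 0 + y 1) ^ 2 * hq'
  have hd3 : (y 4 - y 5) ^ 2 = omega (!e) * (y 0 - y 1) ^ 2 := by
    linear_combination (y 4 + y 5 + omega e * (y 0 + y 1)) * hs3 - 4 * hp3 +
      (y 0 + y 1) ^ 2 * hq
  -- Divided by y₀ - y₁, the third orthogonality relation reads 1 + u + v = 0 with u and v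
  -- unimodular. This triangle fixes u and v, and then the squares of a and b.
  set u := conj a * (y 2 - y 3) / (y 0 - y 1) with hu
  set v := conj b * (y 4 - y 5) / (y 0 - y 1) with hv
  have hu2 : u ^ 2 = conj a ^ 2 * omega e := by
    rw [hu, div_pow, mul_pow, hd2]; field_simp
  have hv2 : v ^ 2 = conj b ^ 2 * omega (!e) := by
    rw [hv, div_pow, mul_pow, hd3]; field_simp
  have huv : 1 + u + v = 0 := by
    rw [hu, hv]; field_simp; linear_combination h2
  obtain ⟨f, hf, hf'⟩ := exists_omega (a := 1) (by simp)
    (norm_eq_one_of_sq (u := u) (by rw [hu2]; simp [ha, norm_omega]))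
    (norm_eq_one_of_sq (u := v) (by rw [hv2]; simp [hb, norm_omega])) huv
  rw [mul_one] at hf hf'
  rw [hf, pow_two, omega_sq] at hu2
  rw [hf', pow_two, omega_not_sq] at hv2
  have hca := conj_mul_self ha
  have hcb := conj_mul_self hb
  have ha2 : a ^ 2 = omega e * omega f := by
    linear_combination omega f * a ^ 2 * hu2 - a ^ 2 * omega_mul_omega_not f +
      omega e * omega f * (a * conj a + 1) * hca
  have hb2 : b ^ 2 = omega (!e) * omega !f := by
    linear_combination omega (!f) * b ^ 2 * hv2 - b ^ 2 * omega_mul_omega_not f +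
      omega (!e) * omega (!f) * (b * conj b + 1) * hcb
  rcases Bool.eq_or_eq_not f e with rfl | rfl
  · exact Or.inr ⟨by rw [ha2, pow_two], by rw [hb2, pow_two]⟩
  · rw [Bool.not_not] at hb2
    exact Or.inl ⟨by rw [ha2, hm], by rw [hb2, mul_comm, hm]⟩

/-- If a pairing of the columns is antisymmetric for one quotient of rows and symmetric for another
one with the same denominator, then the matrix is a deformed Fourier matrix. -/
theorem classified_of_common_pairing {H : Matrix (Fin 6) (Fin 6) ℂ} (hH : IsComplexHadamard H)
    {i k l : Fin 6} (hik : i ≠ k) (hil : i ≠ l) (hkl : k ≠ l) {m : Equiv.Perm (Fin 6)}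
    (hm : ∀ j, m (m j) = j) (hz : ∀ j, ratio H k i (m j) = ratio H k i j)
    (hx : ∀ j, ratio H l i (m j) = -ratio H l i j) : IsClassified H := by
  obtain ⟨σ, rfl, rfl, rfl⟩ := exists_perm_three hik hil hkl
  obtain ⟨τ, hτ⟩ := exists_conj_pairPerm hm (ne_of_apply_eq_neg (ratio_ne_zero hH.1 _ _) hx)
  refine IsClassified.of_equiv ?_ (equiv_dephase hH σ τ)
  set K := dephase H σ τ with hK'
  have hK : IsComplexHadamard K := isComplexHadamard_dephase hH σ τ
  have h0 : ∀ j, K 0 j = 1 := dephase_zero_left hH σ τ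
  have hc : ∀ l, K l 0 = 1 := dephase_zero_right hH σ τ
  have hz' : ∀ j, K 1 (pairPerm j) = K 1 j := fun j => by
    simp only [hK', dephase, ← hτ, hz]
  have hx' : ∀ j, K 2 (pairPerm j) = -K 2 j := fun j => by
    simp only [hK', dephase, ← hτ, hx, neg_div]
  have z1 : K 1 1 = K 1 0 := hz' 0
  have z3 : K 1 3 = K 1 2 := hz' 2
  have z5 : K 1 5 = K 1 4 := hz' 4
  have x1 : K 2 1 = -K 2 0 := hx' 0
  have x3 : K 2 3 = -K 2 2 := hx' 2
  have x5 : K 2 5 = -K 2 4 := hx' 4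
  have hsz := hK.2 1 0 (by decide)
  simp only [h0, Fin.sum_univ_six, map_one, mul_one, z1, z3, z5] at hsz
  obtain ⟨e, he2, he4⟩ := exists_omega (hK.1 1 0) (hK.1 1 2) (hK.1 1 4)
    (by linear_combination hsz / 2)
  rw [hc, mul_one] at he2 he4
  rw [hc] at z1 x1
  rw [he2] at z3
  rw [he4] at z5
  by_cases hreal : K 2 2 ^ 2 = 1 ∧ K 2 4 ^ 2 = 1
  · refine classified_of_real hK (show (0 : Fin 6) ≠ 2 by decide) ?_
    have : ∀ j, ratio K 2 0 j ^ 2 = 1 := forall_fin_six.2 (by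
      simp [ratio, h0, hc, x1, x3, x5, hreal.1, hreal.2])
    intro j j'
    rw [this, this]
  by_cases hreal' : K 2 2 ^ 2 = omega e ^ 2 ∧ K 2 4 ^ 2 = omega (!e) ^ 2
  · refine classified_of_real hK (show (1 : Fin 6) ≠ 2 by decide) ?_
    have hne : ∀ f, omega f ≠ 0 := fun f => ne_zero_of_norm (norm_omega f)
    have : ∀ j, ratio K 2 1 j ^ 2 = 1 := forall_fin_six.2 (by
      simp [ratio, hc, he2, he4, z1, z3, z5, x1, x3, x5, div_pow, hreal'.1, hreal'.2, hne])
    intro j j'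
    rw [this, this]
  -- Outside the two real cases, every further row has entry ±1 in column 1, so the columns 0 and 1
  -- agree up to signs.
  have hcol : ∀ l, K l 1 = 1 ∨ K l 1 = -1 := by
    intro l
    by_cases l0 : l = 0
    · exact Or.inl (by rw [l0, h0])
    by_cases l1 : l = 1
    · exact Or.inl (by rw [l1, z1])
    by_cases l2 : l = 2
    · exact Or.inr (by rw [l2, x1])
    have a0 := hK.2 l 0 l0
    have a1 := hK.2 l 1 l1
    have a2 := hK.2 l 2 l2
    simp only [Fin.sum_univ_six, h0, hc, z1, z3, z5, x1, x3, x5, he2, he4, conj_omega,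
      Bool.not_not, map_one, map_neg] at a0 a1 a2
    have := row_cases_of_common_pairing (hK.1 l) (hK.1 2 2) (hK.1 2 4) e
      (by rw [hc]; linear_combination a0) (by rw [hc]; linear_combination a1)
      (by rw [hc]; linear_combination a2)
    rw [hc] at this
    tauto
  refine classified_of_real_columns hK (show (0 : Fin 6) ≠ 1 by decide) ?_
  have : ∀ l, ratio K.transpose 1 0 l ^ 2 = 1 := fun l => by
    rcases hcol l with h | h <;> simp [ratio, hc, h]
  intro j j'
  rw [this, this]

/-! ### Cubes of sums of two `3`-cycles -/

/-- In a rotated 3-cycle a, wa, w²a the entries are distinct, and both the common cube and the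
product equal a³. The function `p` marks the indices of one of the two cycles. -/
theorem CubeSplit.exists_blocks {z : Fin 6 → ℂ} (hz : ∀ j, z j ≠ 0) (h : CubeSplit z) :
    ∃ (p : Fin 6 → Bool) (α β : ℂ), (∑ j, (p j).toNat) = 3 ∧
      (∀ j, z j ^ 3 = cond (p j) α β) ∧ (∀ j k, j ≠ k → p j = p k → z j ≠ z k) ∧
      (∏ j, cond (p j) (z j) 1) = α ∧ (∏ j, cond (p j) 1 (z j)) = β := by
  obtain ⟨σ, ⟨h1, h2⟩, h4, h5⟩ := h.exists_perm hz
  let q : Fin 6 → Bool := ![true, true, true, false, false, false]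
  have hc : ∀ j, z (σ j) ^ 3 = cond (q j) (z (σ 0) ^ 3) (z (σ 3) ^ 3) := by
    refine forall_fin_six.2 ⟨rfl, ?_, ?_, rfl, ?_, ?_⟩
    · change z (σ 1) ^ 3 = z (σ 0) ^ 3
      rw [h1]; linear_combination z (σ 0) ^ 3 * w_pow_three
    · change z (σ 2) ^ 3 = z (σ 0) ^ 3
      rw [h2]; linear_combination z (σ 0) ^ 3 * (w ^ 3 + 1) * w_pow_three
    · change z (σ 4) ^ 3 = z (σ 3) ^ 3
      rw [h4]; linear_combination z (σ 3) ^ 3 * w_pow_three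
    · change z (σ 5) ^ 3 = z (σ 3) ^ 3
      rw [h5]; linear_combination z (σ 3) ^ 3 * (w ^ 3 + 1) * w_pow_three
  have hw2 : w ^ 2 ≠ 1 := isPrimitiveRoot_w.pow_ne_one_of_pos_of_lt (by norm_num) (by norm_num)
  have hne : ∀ j k, j < k → q j = q k → z (σ j) ≠ z (σ k) := by
    have key : ∀ a : ℂ, a ≠ 0 → a ≠ w * a ∧ a ≠ w ^ 2 * a ∧ w * a ≠ w ^ 2 * a := by
      intro a ha
      refine ⟨fun h => w_ne_one (mul_right_cancel₀ ha (by rw [← h, one_mul])),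
        fun h => hw2 (mul_right_cancel₀ ha (by rw [← h, one_mul])),
        fun h => w_ne_one (mul_right_cancel₀ (mul_ne_zero w_ne_zero ha)
          (by linear_combination -h))⟩
    obtain ⟨k1, k2, k3⟩ := key _ (hz (σ 0))
    obtain ⟨k1', k2', k3'⟩ := key _ (hz (σ 3))
    rw [← h1] at k1 k3
    rw [← h2] at k2 k3
    rw [← h4] at k1' k3'
    rw [← h5] at k2' k3'
    intro j k
    fin_cases j <;> fin_cases k <;> first | exact fun h => absurd h (by decide) |
      exact fun _ h => absurd h (by decide) | exact fun _ _ => by assumption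
  refine ⟨fun j => q (σ.symm j), z (σ 0) ^ 3, z (σ 3) ^ 3, ?_, fun j => ?_, fun j k hjk hq => ?_,
    ?_, ?_⟩
  · rw [Equiv.sum_comp σ.symm fun j => (q j).toNat]; rfl
  · simpa using hc (σ.symm j)
  · rcases lt_or_gt_of_ne (σ.symm.injective.ne hjk) with h | h
    · simpa using hne _ _ h hq
    · simpa using (hne _ _ h hq.symm).symm
  · rw [← Equiv.prod_comp σ]
    simp only [Equiv.symm_apply_apply]
    rw [Fin.prod_univ_six]
    change z (σ 0) * z (σ 1) * z (σ 2) * 1 * 1 * 1 = _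
    rw [h1, h2]; linear_combination z (σ 0) ^ 3 * w_pow_three
  · rw [← Equiv.prod_comp σ]
    simp only [Equiv.symm_apply_apply]
    rw [Fin.prod_univ_six]
    change 1 * 1 * 1 * z (σ 3) * z (σ 4) * z (σ 5) = _
    rw [h4, h5]; linear_combination z (σ 3) ^ 3 * w_pow_three

/-- Equal entries lie in different cycles, so the common cubes of the two cycles coincide. -/
theorem CubeSplit.cube_eq_of_eq {z : Fin 6 → ℂ} (hz : ∀ j, z j ≠ 0) (h : CubeSplit z)
    {j k : Fin 6} (hjk : j ≠ k) (he : z j = z k) (i i' : Fin 6) : z i ^ 3 = z i' ^ 3 := by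
  obtain ⟨p, α, β, -, hc, hn, -⟩ := h.exists_blocks hz
  have hp : p j ≠ p k := fun h => hn j k hjk h he
  have hαβ : α = β := by
    have h1 := hc j
    have h2 := hc k
    rw [he, h2] at h1
    cases hj : p j <;> cases hk : p k <;> simp_all
  rw [hc, hc, hαβ, Bool.cond_self, Bool.cond_self]

/-- Two of three equal entries would lie in the same cycle. -/
theorem CubeSplit.not_three_eq {z : Fin 6 → ℂ} (hz : ∀ j, z j ≠ 0) (h : CubeSplit z)
    {i j k : Fin 6} (hij : i ≠ j) (hik : i ≠ k) (hjk : j ≠ k) (h1 : z i = z j) (h2 : z i = z k) :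
    False := by
  obtain ⟨p, α, β, -, hc, hn, -⟩ := h.exists_blocks hz
  have a := fun h => hn i j hij h h1
  have b := fun h => hn i k hik h h2
  have c := fun h => hn j k hjk h (h1 ▸ h2)
  cases hi : p i <;> cases hj : p j <;> cases hk : p k <;> simp_all

/-- The combinatorial core of `cube_eq_on_blocks`: unless `p` or `q` is the splitting {0, 1, 2}, {3,
4, 5}, either they disagree about a pair inside a block or they agree in joining two points of
different blocks. -/
theorem exists_index_of_two_splittings (p q : Fin 6 → Bool) (hp : ∑ j, (p j).toNat = 3)
    (hq : ∑ j, (q j).toNat = 3) :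
    (p 0 = p 1 ∧ p 0 = p 2 ∧ p 3 = p 4 ∧ p 3 = p 5) ∨
    (q 0 = q 1 ∧ q 0 = q 2 ∧ q 3 = q 4 ∧ q 3 = q 5) ∨
    (∃ a b : Fin 6, (a < 3 ↔ b < 3) ∧ p a = p b ∧ q a ≠ q b) ∨
    (∃ a b : Fin 6, (a < 3 ↔ b < 3) ∧ p a ≠ p b ∧ q a = q b) ∨
    ∃ a b : Fin 6, a < 3 ∧ ¬ b < 3 ∧ p a = p b ∧ q a = q b := by
  revert q hq
  revert hp
  revert p
  set_option maxRecDepth 100000 in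
  decide +kernel

/-- If the cubes of two sums of `3`-cycles differ by a nonconstant factor that is constant on the
blocks `{0, 1, 2}` and `{3, 4, 5}`, then these cubes are constant on these blocks as well. -/
theorem cube_eq_on_blocks {y z : Fin 6 → ℂ} (hy0 : ∀ j, y j ≠ 0) (hz0 : ∀ j, z j ≠ 0)
    (hy : CubeSplit y) (hz : CubeSplit z) {ξ η : ℂ} (hne : ξ ≠ η)
    (h : ∀ j, y j ^ 3 = (if j < 3 then ξ else η) * z j ^ 3) :
    ∀ a b : Fin 6, (a < 3 ↔ b < 3) → y a ^ 3 = y b ^ 3 := by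
  obtain ⟨p, α, β, hp, hpy, -⟩ := hy.exists_blocks hy0
  obtain ⟨q, γ, δ, hq, hqz, -⟩ := hz.exists_blocks hz0
  have hyz : ∀ a b : Fin 6, (a < 3 ↔ b < 3) → (y a ^ 3 = y b ^ 3 ↔ z a ^ 3 = z b ^ 3) := by
    intro a b hab
    have hf : (if b < 3 then ξ else η) ≠ 0 := fun h0 => by
      have := h b
      rw [h0, zero_mul] at this
      exact hy0 b (pow_eq_zero_iff (by norm_num) |>.1 this)
    rw [h a, h b, if_congr hab rfl rfl, mul_right_inj' hf]
  have hblock : ∀ r : Fin 6 → Bool, r 0 = r 1 ∧ r 0 = r 2 ∧ r 3 = r 4 ∧ r 3 = r 5 →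
      ∀ a b : Fin 6, (a < 3 ↔ b < 3) → r a = r b := by
    rintro r ⟨h1, h2, h4, h5⟩ a b hab
    have : ∀ a : Fin 6, r a = if a < 3 then r 0 else r 3 := forall_fin_six.2
      ⟨rfl, h1.symm, h2.symm, rfl, h4.symm, h5.symm⟩
    rw [this a, this b, if_congr hab rfl rfl]
  rcases exists_index_of_two_splittings p q hp hq with h' | h' | ⟨a, b, hab, h1, h2⟩ |
    ⟨a, b, hab, h1, h2⟩ | ⟨a, b, ha, hb, h1, h2⟩
  · intro a b hab
    rw [hpy, hpy, hblock p h' a b hab]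
  · intro a b hab
    rw [hyz a b hab, hqz, hqz, hblock q h' a b hab]
  -- A pair joined by `p` but separated by `q` inside a block has equal cubes of y, hence of z, so
  -- all cubes of z coincide.
  · have hγδ : γ = δ := by
      have := (hyz a b hab).1 (by rw [hpy, hpy, h1])
      rw [hqz, hqz] at this
      cases ha : q a <;> cases hb : q b <;> simp_all
    intro a b hab
    rw [hyz a b hab, hqz, hqz, hγδ, Bool.cond_self, Bool.cond_self]
  · have hαβ : α = β := by
      have := (hyz a b hab).2 (by rw [hqz, hqz, h2])
      rw [hpy, hpy] at this
      cases ha : p a <;> cases hb : p b <;> simp_all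
    intro a b _
    rw [hpy, hpy, hαβ, Bool.cond_self, Bool.cond_self]
  -- A pair across the blocks joined by both splittings has equal cubes of y and of z, contradicting
  -- ξ ≠ η.
  · have e1 := h a
    have e2 := h b
    rw [if_pos ha, hqz, h2] at e1
    rw [if_neg hb, hqz] at e2
    rw [hpy, h1, ← hpy b, e2] at e1
    refine absurd (mul_right_cancel₀ ?_ e1).symm hne
    rw [← hqz b]
    exact pow_ne_zero _ (hz0 b)

theorem CubeSplit.apply_ne {z : Fin 6 → ℂ} (hz : ∀ j, z j ≠ 0) (h : CubeSplit z)
    (hn : ∃ i i', z i ^ 3 ≠ z i' ^ 3) {j k : Fin 6} (hjk : j ≠ k) : z j ≠ z k := by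
  obtain ⟨i, i', hn⟩ := hn
  exact fun he => hn (h.cube_eq_of_eq hz hjk he i i')

/-- If three rows are related by sums of `3`-cycles only, and the cubes are not constant for one
pair, then the cycles of the two other rows run through the same blocks, in opposite order. -/
theorem apply_eq_w_sq_mul {x y : Fin 6 → ℂ} (hx0 : ∀ j, x j ≠ 0) (hy0 : ∀ j, y j ≠ 0)
    {g : Equiv.Perm (Fin 6)} (hg : ∀ j, g (g (g j)) = j) (hx : ∀ j, x (g j) = w * x j)
    (hn : ∃ i i', x i ^ 3 ≠ x i' ^ 3) (hy : CubeSplit y) (hz : CubeSplit fun j => y j / x j)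
    (j : Fin 6) : y (g j) = w ^ 2 * y j := by
  have hz0 : ∀ j, y j / x j ≠ 0 := fun j => div_ne_zero (hy0 j) (hx0 j)
  have hgj := ne_of_apply_eq_w_mul hx0 hx
  have hg2 : ∀ j, g (g j) ≠ j := fun j h => hgj j (by
    have := hg j
    rw [h] at this
    exact this)
  have hx3 : ∀ j, x (g j) ^ 3 = x j ^ 3 := fun j => by
    rw [hx]; linear_combination x j ^ 3 * w_pow_three
  have hy3 : ∀ j, y (g j) ^ 3 = y j ^ 3 := by
    obtain ⟨σ, hσ⟩ := exists_conj_triplePerm hg hgj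
    have hblock : ∀ j, x (σ j) ^ 3 = if j < 3 then x (σ 0) ^ 3 else x (σ 3) ^ 3 := by
      have key : ∀ j, x (σ (triplePerm j)) ^ 3 = x (σ j) ^ 3 := fun j => by rw [← hσ, hx3]
      have k1 : x (σ 1) ^ 3 = x (σ 0) ^ 3 := key 0
      have k2 : x (σ 2) ^ 3 = x (σ 1) ^ 3 := key 1
      have k4 : x (σ 4) ^ 3 = x (σ 3) ^ 3 := key 3
      have k5 : x (σ 5) ^ 3 = x (σ 4) ^ 3 := key 4
      exact forall_fin_six.2 ⟨rfl, k1, k2.trans k1, rfl, k4, k5.trans k4⟩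
    have hne : x (σ 0) ^ 3 ≠ x (σ 3) ^ 3 := by
      obtain ⟨i, i', hii⟩ := hn
      intro he
      have := hblock (σ.symm i)
      have h' := hblock (σ.symm i')
      simp only [he, ite_self, Equiv.apply_symm_apply] at this h'
      exact hii (this.trans h'.symm)
    intro j
    have := cube_eq_on_blocks (fun j => hy0 (σ j)) (fun j => hz0 (σ j)) (hy.comp σ) (hz.comp σ)
      hne (fun j => by rw [← hblock, div_pow]; field_simp [hx0 (σ j)])
      (triplePerm (σ.symm j)) (σ.symm j) (by generalize σ.symm j = k; revert k; decide)
    rwa [← hσ, Equiv.apply_symm_apply] at this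
  -- The cubes of x are quotients of those of y and of y/x, so one of these two families is not
  -- constant. That vector then has pairwise distinct entries.
  have hcase : (∃ i i', y i ^ 3 ≠ y i' ^ 3) ∨ ∃ i i', (y i / x i) ^ 3 ≠ (y i' / x i') ^ 3 := by
    by_contra hcon
    push Not at hcon
    obtain ⟨h1, h2⟩ := hcon
    obtain ⟨i, i', hii⟩ := hn
    apply hii
    have := h2 i i'
    rw [div_pow, div_pow, h1 i i', div_eq_div_iff (pow_ne_zero _ (hx0 i)) (pow_ne_zero _ (hx0 i'))]
      at this
    exact (mul_left_cancel₀ (pow_ne_zero _ (hy0 i')) this).symm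
  have hw : ∀ c : ℂ, w * (w ^ 2 * c) = c := fun c => by linear_combination c * w_pow_three
  rcases hcase with hcase | hcase
  · have hinj := fun {j k} => hy.apply_ne hy0 hcase (j := j) (k := k)
    rcases eq_or_of_cube_eq (hy3 j) with h | h | h
    · exact absurd h (hinj (hgj j))
    -- If y were multiplied by w along the first step of an orbit of `g`, then the second step would
    -- either return to the value at j or make y/x equal at three indices.
    · exfalso
      rcases eq_or_of_cube_eq (hy3 (g j)) with h' | h' | h'
      · exact absurd h' (hinj (hgj _))
      · refine hz.not_three_eq hz0 (hgj j).symm (hg2 j).symm (hgj (g j)).symm ?_ ?_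
        · rw [h, hx, mul_div_mul_left _ _ w_ne_zero]
        · rw [h', h, hx, hx, mul_div_mul_left _ _ w_ne_zero, mul_div_mul_left _ _ w_ne_zero]
      · refine absurd ?_ (hinj (hg2 j))
        rw [h', h]; linear_combination y j * w_pow_three
    · exact h
  · have hinj := fun {j k} => hz.apply_ne hz0 hcase (j := j) (k := k)
    have hz3 : ∀ j, (y (g j) / x (g j)) ^ 3 = (y j / x j) ^ 3 := fun j => by
      rw [div_pow, div_pow, hy3, hx3]
    have hy' : ∀ (j : Fin 6) {c : ℂ}, y (g j) / x (g j) = c * (y j / x j) →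
        y (g j) = c * w * y j := fun j c h => by
      have h1 := hx0 j
      have h2 := w_ne_zero
      rw [hx] at h
      field_simp at h
      linear_combination h
    rcases eq_or_of_cube_eq (hz3 j) with h | h | h
    · exact absurd h (hinj (hgj j))
    · rw [hy' j h, pow_two]
    · exfalso
      rcases eq_or_of_cube_eq (hz3 (g j)) with h' | h' | h'
      · exact absurd h' (hinj (hgj _))
      · refine absurd ?_ (hinj (hg2 j))
        rw [h', h, hw]
      · have e1 := hy' j h
        have e2 := hy' (g j) h'
        refine hy.not_three_eq hy0 (hgj j).symm (hg2 j).symm (hgj (g j)).symm ?_ ?_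
        · rw [e1]; linear_combination -y j * w_pow_three
        · rw [e2, e1]; linear_combination -y j * (w ^ 3 + 1) * w_pow_three

/-- If all pairs among four rows are related by sums of `3`-cycles, the cubes are constant. -/
theorem cube_ratio_eq {H : Matrix (Fin 6) (Fin 6) ℂ} (hH : ∀ i j, ‖H i j‖ = 1) {i k l l' : Fin 6}
    (hik : CubeSplit (ratio H i k)) (hli : CubeSplit (ratio H l i))
    (hli' : CubeSplit (ratio H l' i)) (hlk : CubeSplit (ratio H l k))
    (hlk' : CubeSplit (ratio H l' k)) (hll : CubeSplit (ratio H l l')) (j j' : Fin 6) :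
    ratio H i k j ^ 3 = ratio H i k j' ^ 3 := by
  by_contra hne
  obtain ⟨g, hg, hx⟩ := hik
  have hx0 := ratio_ne_zero hH i k
  have hgj := ne_of_apply_eq_w_mul hx0 hx
  have a := apply_eq_w_sq_mul hx0 (ratio_ne_zero hH l k) hg hx ⟨j, j', hne⟩ hlk
    (by rwa [ratio_div_ratio hH])
  have b := apply_eq_w_sq_mul hx0 (ratio_ne_zero hH l' k) hg hx ⟨j, j', hne⟩ hlk'
    (by rwa [ratio_div_ratio hH])
  -- Both l/k and l'/k are multiplied by w² along `g`, so their quotient is constant on an orbit of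
  -- three columns, which 3-cycles do not allow.
  have hc : ∀ j, ratio H l l' (g j) = ratio H l l' j := fun j => by
    rw [← ratio_div_ratio hH l l' k]
    change ratio H l k (g j) / ratio H l' k (g j) = _
    rw [a, b, mul_div_mul_left _ _ (pow_ne_zero _ w_ne_zero)]
  refine hll.not_three_eq (ratio_ne_zero hH l l') (hgj j).symm (k := g (g j)) (fun h => hgj j ?_)
    (hgj (g j)).symm (hc j).symm (by rw [hc, hc])
  have := hg j
  rwa [← h] at this

/-! ### Antipodal quotients of two sums of 3-cycles -/

/-- Three pairs and two splittings into triples: the alternatives record which pairs are cut by `p`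
and by `q`, and whether the cuts have the same direction. They are exactly what the algebra of
`sq_eq_of_two_splittings` can use. -/
theorem exists_edge_of_two_splittings (p q : Fin 6 → Bool) (hp : ∑ j, (p j).toNat = 3)
    (hq : ∑ j, (q j).toNat = 3) :
    (∃ a, p a = p (pairPerm a) ∧ q a = q (pairPerm a)) ∨
    (∃ a b, p a ≠ p (pairPerm a) ∧ q a = q (pairPerm a) ∧
      p b ≠ p (pairPerm b) ∧ q b ≠ q (pairPerm b)) ∨
    (∃ a b, p a = p (pairPerm a) ∧ q a ≠ q (pairPerm a) ∧
      p b ≠ p (pairPerm b) ∧ q b ≠ q (pairPerm b)) ∨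
    (∃ a b, (p a ≠ p (pairPerm a) ∧ q a ≠ q (pairPerm a) ∧ p a = q a) ∧
      p b ≠ p (pairPerm b) ∧ q b ≠ q (pairPerm b) ∧ p b ≠ q b) ∨
    ((∃ a, p a ≠ p (pairPerm a) ∧ q a ≠ q (pairPerm a) ∧ p a = q a) ∧ ∀ j, p j = q j) ∨
    ((∃ a, p a ≠ p (pairPerm a) ∧ q a ≠ q (pairPerm a) ∧ p a ≠ q a) ∧ ∀ j, p j ≠ q j) := by
  revert q hq
  revert hp
  revert p
  set_option maxRecDepth 100000 in
  decide +kernel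

theorem bool_ne_cases {a b : Bool} (h : a ≠ b) :
    (a = true ∧ b = false) ∨ (a = false ∧ b = true) := by
  revert a b; decide

/-- Comparing the two ends of a pair eliminates X and produces a sign (`hedge`). A pair cut by
neither splitting is impossible. A pair cut by both gives αδ = -βγ or αγ = -βδ according to
direction. Pairs of different kinds together force α² = β² and γ² = δ²; otherwise the two splittings
coincide and one relation suffices at every index. -/
theorem sq_eq_of_two_splittings {X : Fin 6 → ℂ} (hX : ∀ j, X (pairPerm j) = -X j)
    {p q : Fin 6 → Bool} (hp : ∑ j, (p j).toNat = 3)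
    (hq : ∑ j, (q j).toNat = 3) {α β γ δ : ℂ} (hα : α ≠ 0) (hβ : β ≠ 0) (hγ : γ ≠ 0) (hδ : δ ≠ 0)
    (h : ∀ j, cond (p j) α β = X j * cond (q j) γ δ) :
    ∀ j, α * β = -X j ^ 2 * (γ * δ) := by
  have hedge : ∀ a, cond (p (pairPerm a)) α β * cond (q a) γ δ =
      -(cond (p a) α β * cond (q (pairPerm a)) γ δ) := fun a => by
    rw [h, h a, hX]; ring
  have two : ∀ c : ℂ, c = -c → c = 0 := fun c hc => self_eq_neg.1 hc
  have same : ∀ a, p a ≠ p (pairPerm a) → q a ≠ q (pairPerm a) → p a = q a →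
      α * δ = -(β * γ) := by
    intro a h1 h2 h3
    have := hedge a
    rcases bool_ne_cases h1 with ⟨e1, e2⟩ | ⟨e1, e2⟩ <;>
    rcases bool_ne_cases h2 with ⟨e3, e4⟩ | ⟨e3, e4⟩ <;>
    simp only [e1, e2, e3, e4, cond_true, cond_false] at this h3
    · linear_combination this
    · exact absurd h3 (by decide)
    · exact absurd h3 (by decide)
    · linear_combination this
  have opp : ∀ a, p a ≠ p (pairPerm a) → q a ≠ q (pairPerm a) → p a ≠ q a →
      α * γ = -(β * δ) := by
    intro a h1 h2 h3
    have := hedge a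
    rcases bool_ne_cases h1 with ⟨e1, e2⟩ | ⟨e1, e2⟩ <;>
    rcases bool_ne_cases h2 with ⟨e3, e4⟩ | ⟨e3, e4⟩ <;>
    simp only [e1, e2, e3, e4, cond_true, cond_false, ne_eq, not_true_eq_false] at this h3
    · linear_combination this
    · linear_combination this
  have either : ∀ a, p a ≠ p (pairPerm a) → q a ≠ q (pairPerm a) →
      α * δ = -(β * γ) ∨ α * γ = -(β * δ) := fun a h1 h2 => by
    by_cases h3 : p a = q a
    · exact Or.inl (same a h1 h2 h3)
    · exact Or.inr (opp a h1 h2 h3)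
  have fin : α ^ 2 = β ^ 2 → γ ^ 2 = δ ^ 2 → α * β * γ ^ 2 = -α ^ 2 * (γ * δ) →
      ∀ j, α * β = -X j ^ 2 * (γ * δ) := by
    intro h1 h2 h3 j
    have e1 : cond (p j) α β ^ 2 = α ^ 2 := by cases p j <;> simp [h1]
    have e2 : cond (q j) γ δ ^ 2 = γ ^ 2 := by cases q j <;> simp [h2]
    have e3 : X j ^ 2 * γ ^ 2 = α ^ 2 := by rw [← e1, ← e2, h, mul_pow]
    refine mul_right_cancel₀ (pow_ne_zero 2 hγ) ?_
    linear_combination h3 + γ * δ * e3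
  rcases exists_edge_of_two_splittings p q hp hq with ⟨a, h1, h2⟩ | ⟨a, b, h1, h2, h3, h4⟩ |
    ⟨a, b, h1, h2, h3, h4⟩ | ⟨a, b, ⟨h1, h2, h3⟩, h4, h5, h6⟩ | ⟨⟨a, h1, h2, h3⟩, hpq⟩ |
    ⟨⟨a, h1, h2, h3⟩, hpq⟩
  · exfalso
    have := hedge a
    rw [← h1, ← h2] at this
    refine mul_ne_zero ?_ ?_ (two _ this)
    · cases p a <;> assumption
    · cases q a <;> assumption
  · have hβα : β = -α := by
      have := hedge a
      rw [← h2, ← neg_mul] at this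
      have := mul_right_cancel₀ (by cases q a <;> assumption) this
      rcases bool_ne_cases h1 with ⟨e1, e2⟩ | ⟨e1, e2⟩ <;>
        simp only [e1, e2, cond_true, cond_false] at this <;> linear_combination this
    have hγδ : γ = δ := by
      rcases either b h3 h4 with h | h <;> rw [hβα] at h <;> refine mul_left_cancel₀ hα ?_
      · linear_combination -h
      · linear_combination h
    subst hγδ hβα
    exact fin (by ring) rfl (by ring)
  · have hδγ : δ = -γ := by
      have := hedge a
      rw [← h1, ← mul_neg] at this
      have := mul_left_cancel₀ (by cases p a <;> assumption) this
      rcases bool_ne_cases h2 with ⟨e1, e2⟩ | ⟨e1, e2⟩ <;>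
        simp only [e1, e2, cond_true, cond_false] at this <;> linear_combination this
    have hαβ : α = β := by
      rcases either b h3 h4 with h | h <;> rw [hδγ] at h <;> refine mul_right_cancel₀ hγ ?_
      · linear_combination -h
      · linear_combination h
    subst hαβ hδγ
    exact fin rfl (by ring) (by ring)
  · have s := same a h1 h2 h3
    have o := opp b h4 h5 h6
    have e1 : α ^ 2 = β ^ 2 := by
      refine mul_right_cancel₀ (mul_ne_zero hγ hδ) ?_
      linear_combination α * γ * s - β * γ * o
    have e2 : γ ^ 2 = δ ^ 2 := by
      refine mul_right_cancel₀ (mul_ne_zero hα hβ) ?_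
      linear_combination β * γ * o - β * δ * s
    exact fin e1 e2 (by linear_combination (α * γ) * s)
  · have s := same a h1 h2 h3
    intro j
    have hj := h j
    rw [hpq] at hj
    cases hq : q j <;> simp only [hq, cond_true, cond_false] at hj
    · refine mul_right_cancel₀ hδ ?_
      rw [hj] at s ⊢
      linear_combination X j * δ * s
    · refine mul_right_cancel₀ hγ ?_
      rw [hj] at s ⊢
      linear_combination X j * γ * s
  · have o := opp a h1 h2 h3
    intro j
    have hj := h j
    rcases bool_ne_cases (hpq j) with ⟨e1, e2⟩ | ⟨e1, e2⟩ <;>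
      simp only [e1, e2, cond_true, cond_false] at hj
    · refine mul_right_cancel₀ hδ ?_
      rw [hj] at o ⊢
      linear_combination X j * δ * o
    · refine mul_right_cancel₀ hγ ?_
      rw [hj] at o ⊢
      linear_combination X j * γ * o

theorem cubeSplit_of_eq {x : Fin 6 → ℂ} (i : Fin 6 → Fin 6) (hi : Function.Injective i)
    (h1 : x (i 1) = w * x (i 0)) (h2 : x (i 2) = w ^ 2 * x (i 0))
    (h4 : x (i 4) = w * x (i 3)) (h5 : x (i 5) = w ^ 2 * x (i 3)) : CubeSplit x :=
  cubeSplit_of_perm (Equiv.ofBijective i (Finite.injective_iff_bijective.1 hi)) h1 h2 h4 h5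

theorem prod_cond_mul_prod_cond (p : Fin 6 → Bool) (y : Fin 6 → ℂ) :
    (∏ j, cond (p j) (y j) 1) * ∏ j, cond (p j) 1 (y j) = ∏ j, y j := by
  rw [← Finset.prod_mul_distrib]
  refine Finset.prod_congr rfl fun j _ => ?_
  cases p j <;> simp

/-- The entries are ±x₀, ±wx₀, ±w²x₀, a rotated 6-cycle, which also splits into two 3-cycles. -/
theorem cubeSplit_of_sq_eq {x : Fin 6 → ℂ} (hx : ∀ j, x (pairPerm j) = -x j)
    (h2 : x 2 ^ 2 = w * x 0 ^ 2) (h4 : x 4 ^ 2 = w ^ 2 * x 0 ^ 2) : CubeSplit x := by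
  have e1 : x 1 = -x 0 := hx 0
  have e3 : x 3 = -x 2 := hx 2
  have e5 : x 5 = -x 4 := hx 4
  have h2' : x 2 ^ 2 = (w ^ 2 * x 0) ^ 2 := by
    linear_combination h2 - w * x 0 ^ 2 * w_pow_three
  have h4' : x 4 ^ 2 = (w * x 0) ^ 2 := by linear_combination h4
  rcases sq_eq_sq_iff_eq_or_eq_neg.1 h2' with h2 | h2 <;>
  rcases sq_eq_sq_iff_eq_or_eq_neg.1 h4' with h4 | h4
  · exact cubeSplit_of_eq ![0, 4, 2, 1, 5, 3] (by decide) h4 h2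
      (by simp [e1, e5, h4]) (by simp [e1, e3, h2])
  · exact cubeSplit_of_eq ![0, 5, 2, 1, 4, 3] (by decide) (by simp [e5, h4]) h2
      (by simp [e1, h4]) (by simp [e1, e3, h2])
  · exact cubeSplit_of_eq ![0, 4, 3, 1, 5, 2] (by decide) h4 (by simp [e3, h2])
      (by simp [e1, e5, h4]) (by simp [e1, h2])
  · exact cubeSplit_of_eq ![0, 5, 3, 1, 4, 2] (by decide) (by simp [e5, h4]) (by simp [e3, h2])
      (by simp [e1, h4]) (by simp [e1, h2])

theorem cubeSplit_of_sq_eq' {x : Fin 6 → ℂ} (hx : ∀ j, x (pairPerm j) = -x j)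
    (h2 : x 2 ^ 2 = w ^ 2 * x 0 ^ 2) (h4 : x 4 ^ 2 = w * x 0 ^ 2) : CubeSplit x := by
  let ρ : Equiv.Perm (Fin 6) := Equiv.swap 2 4 * Equiv.swap 3 5
  have := cubeSplit_of_sq_eq (x := fun j => x (ρ j)) (fun j => by
    rw [← hx]; exact congrArg x (by revert j; decide)) h4 h2
  simpa using this.comp ρ.symm

theorem isRealUpToScalar_of_sq_eq {x : Fin 6 → ℂ} (hx : ∀ j, x (pairPerm j) = -x j)
    (h2 : x 2 ^ 2 = x 0 ^ 2) (h4 : x 4 ^ 2 = x 0 ^ 2) : IsRealUpToScalar x := by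
  have e1 : x 1 = -x 0 := hx 0
  have e3 : x 3 = -x 2 := hx 2
  have e5 : x 5 = -x 4 := hx 4
  have : ∀ j, x j ^ 2 = x 0 ^ 2 := forall_fin_six.2 (by simp [e1, e3, e5, h2, h4])
  exact fun j k => (this j).trans (this k).symm

/-- The product of a 3-cycle equals its common cube, so αβ and γδ are the products of all entries of
y and of y/x, with quotient ∏ x = -(x₀x₂x₄)². Applied to the cubes of x, `sq_eq_of_two_splittings`
gives (x₀x₂x₄)² = xⱼ⁶ for all j. So the squares of x₂ and x₄ are cube roots of unity times x₀², with
x₂²x₄² = x₀⁴: either all three squares agree, or x is a 6-cycle and hence `CubeSplit`. -/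
theorem isRealUpToScalar_of_cubeSplit_aux {x y : Fin 6 → ℂ} (hx0 : ∀ j, x j ≠ 0)
    (hy0 : ∀ j, y j ≠ 0) (hx : ∀ j, x (pairPerm j) = -x j) (hx' : ¬ CubeSplit x)
    (hy : CubeSplit y) (hz : CubeSplit fun j => y j / x j) : IsRealUpToScalar x := by
  have hz0 : ∀ j, y j / x j ≠ 0 := fun j => div_ne_zero (hy0 j) (hx0 j)
  obtain ⟨p, α, β, hp, hpc, -, hα, hβ⟩ := hy.exists_blocks hy0
  obtain ⟨q, γ, δ, hq, hqc, -, hγ, hδ⟩ := hz.exists_blocks hz0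
  have hne : ∀ (r : Fin 6 → Bool) {u : Fin 6 → ℂ}, (∀ j, u j ≠ 0) →
      ∏ j, cond (r j) (u j) 1 ≠ 0 ∧ ∏ j, cond (r j) 1 (u j) ≠ 0 := fun r u hu => by
    constructor <;> refine Finset.prod_ne_zero_iff.2 fun j _ => ?_ <;> cases r j <;>
      simp [hu j]
  have key := sq_eq_of_two_splittings (X := fun j => x j ^ 3)
    (fun j => by rw [hx]; ring) hp hq (α := α) (β := β) (γ := γ) (δ := δ)
    (hα ▸ (hne p hy0).1) (hβ ▸ (hne p hy0).2) (hγ ▸ (hne q hz0).1) (hδ ▸ (hne q hz0).2)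
    (fun j => by rw [← hpc, ← hqc, div_pow]; field_simp [hx0 j])
  have hprod : ∏ j, y j = (∏ j, x j) * ∏ j, y j / x j := by
    rw [← Finset.prod_mul_distrib]
    exact Finset.prod_congr rfl fun j _ => by field_simp [hx0 j]
  have e1 : x 1 = -x 0 := hx 0
  have e3 : x 3 = -x 2 := hx 2
  have e5 : x 5 = -x 4 := hx 4
  have hsq : ∀ j, (x 0 * x 2 * x 4) ^ 2 = (x j ^ 3) ^ 2 := by
    intro j
    have h := key j
    rw [← hα, ← hβ, ← hγ, ← hδ, prod_cond_mul_prod_cond, prod_cond_mul_prod_cond, hprod] at h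
    have h' := mul_right_cancel₀ (Finset.prod_ne_zero_iff.2 fun j _ => hz0 j) h
    rw [Fin.prod_univ_six, e1, e3, e5] at h'
    linear_combination -h'
  have h20 : (x 2 ^ 2) ^ 3 = (x 0 ^ 2) ^ 3 := by linear_combination hsq 0 - hsq 2
  have h40 : (x 4 ^ 2) ^ 3 = (x 0 ^ 2) ^ 3 := by linear_combination hsq 0 - hsq 4
  have h024 := hsq 0
  have h06 : x 0 ^ 6 ≠ 0 := pow_ne_zero _ (hx0 0)
  have hw2 : w ^ 2 ≠ 1 := isPrimitiveRoot_w.pow_ne_one_of_pos_of_lt (by norm_num) (by norm_num)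
  have hww : w ^ 4 ≠ 1 := fun h => w_ne_one (by linear_combination h - w * w_pow_three)
  have bad : ∀ c : ℂ, c ≠ 1 → x 2 ^ 2 * x 4 ^ 2 = c * x 0 ^ 4 → False := by
    intro c hc h
    refine hc (mul_right_cancel₀ h06 ?_)
    linear_combination h024 - x 0 ^ 2 * h
  rcases eq_or_of_cube_eq h20 with h2 | h2 | h2 <;> rcases eq_or_of_cube_eq h40 with h4 | h4 | h4
  · exact isRealUpToScalar_of_sq_eq hx h2 h4
  · exact (bad w w_ne_one (by rw [h2, h4]; ring)).elim
  · exact (bad (w ^ 2) hw2 (by rw [h2, h4]; ring)).elim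
  · exact (bad w w_ne_one (by rw [h2, h4]; ring)).elim
  · exact (bad (w ^ 2) hw2 (by rw [h2, h4]; ring)).elim
  · exact absurd (cubeSplit_of_sq_eq hx h2 h4) hx'
  · exact (bad (w ^ 2) hw2 (by rw [h2, h4]; ring)).elim
  · exact absurd (cubeSplit_of_sq_eq' hx h2 h4) hx'
  · exact (bad (w ^ 4) hww (by rw [h2, h4]; ring)).elim

/-- An entrywise quotient of sums of `3`-cycles that splits into antipodal pairs but not into
`3`-cycles is real up to a scalar. -/
theorem isRealUpToScalar_of_cubeSplit {x y : Fin 6 → ℂ} (hx0 : ∀ j, x j ≠ 0)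
    (hy0 : ∀ j, y j ≠ 0) (hx : NegPaired x) (hx' : ¬ CubeSplit x) (hy : CubeSplit y)
    (hz : CubeSplit fun j => y j / x j) : IsRealUpToScalar x := by
  obtain ⟨m, hm, hxm⟩ := hx
  obtain ⟨σ, hσ⟩ := exists_conj_pairPerm hm (ne_of_apply_eq_neg hx0 hxm)
  have h := isRealUpToScalar_of_cubeSplit_aux (fun j => hx0 (σ j)) (fun j => hy0 (σ j))
    (fun j => by rw [← hσ, hxm]) (fun h => hx' (by simpa using h.comp σ.symm)) (hy.comp σ)
    (hz.comp σ)
  intro j k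
  simpa using h (σ.symm j) (σ.symm k)

/-! ### Pairs of pairings -/

/-- The involution `(0 3)(1 2)(4 5)`. -/
def sharePerm : Equiv.Perm (Fin 6) :=
  ⟨![3, 2, 1, 0, 5, 4], ![3, 2, 1, 0, 5, 4], by decide, by decide⟩

/-- The involution `(0 5)(1 2)(3 4)`. -/
def hexPerm : Equiv.Perm (Fin 6) :=
  ⟨![5, 2, 1, 4, 3, 0], ![5, 2, 1, 4, 3, 0], by decide, by decide⟩

/-- Some permutations commuting with `pairPerm`. -/
def pairStabilizers : Fin 8 → Fin 6 → Fin 6 :=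
  ![![0, 1, 2, 3, 4, 5], ![0, 1, 3, 2, 4, 5], ![0, 1, 4, 5, 2, 3], ![0, 1, 5, 4, 2, 3],
    ![2, 3, 4, 5, 1, 0], ![2, 3, 5, 4, 0, 1], ![0, 1, 3, 2, 5, 4], ![0, 1, 4, 5, 3, 2]]

/-- The fifteen fixed point free involutions of six points. -/
def pairings : Fin 15 → Fin 6 → Fin 6 :=
  ![![1, 0, 3, 2, 5, 4], ![1, 0, 4, 5, 2, 3], ![1, 0, 5, 4, 3, 2], ![2, 3, 0, 1, 5, 4],
    ![2, 4, 0, 5, 1, 3], ![2, 5, 0, 4, 3, 1], ![3, 2, 1, 0, 5, 4], ![3, 4, 5, 0, 1, 2],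
    ![3, 5, 4, 0, 2, 1], ![4, 2, 1, 5, 0, 3], ![4, 3, 5, 1, 0, 2], ![4, 5, 3, 2, 0, 1],
    ![5, 2, 1, 4, 3, 0], ![5, 3, 4, 1, 2, 0], ![5, 4, 3, 2, 1, 0]]

-- The conditions for a fixed point free involution are interleaved with the quantifiers, so that
-- the enumeration abandons a branch at the first violation.
set_option synthInstance.maxHeartbeats 400000 in
set_option synthInstance.maxSize 10000 in
set_option maxRecDepth 100000 in
theorem exists_pairings_aux : ∀ p : Fin 6, p ≠ 0 → ∀ q : Fin 6, (q ≠ 1 ∧ (p = 1 ↔ q = 0)) →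
    ∀ r : Fin 6, (r ≠ 2 ∧ (p = 2 ↔ r = 0) ∧ (q = 2 ↔ r = 1)) →
    ∀ s : Fin 6, (s ≠ 3 ∧ (p = 3 ↔ s = 0) ∧ (q = 3 ↔ s = 1) ∧ (r = 3 ↔ s = 2)) →
    ∀ t : Fin 6, (t ≠ 4 ∧ (p = 4 ↔ t = 0) ∧ (q = 4 ↔ t = 1) ∧ (r = 4 ↔ t = 2) ∧
      (s = 4 ↔ t = 3)) →
    ∀ u : Fin 6, (u ≠ 5 ∧ (p = 5 ↔ u = 0) ∧ (q = 5 ↔ u = 1) ∧ (r = 5 ↔ u = 2) ∧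
      (s = 5 ↔ u = 3) ∧ (t = 5 ↔ u = 4)) → ∃ i, ![p, q, r, s, t, u] = pairings i := by
  decide +kernel

theorem exists_pairings {f : Fin 6 → Fin 6} (hr : ∀ j, f (f j) = j) (hr' : ∀ j, f j ≠ j) :
    ∃ i, f = pairings i := by
  have hiff : ∀ i j, f i = j ↔ f j = i := fun i j =>
    ⟨fun e => by rw [← e, hr], fun e => by rw [← e, hr]⟩
  have hvec : ![f 0, f 1, f 2, f 3, f 4, f 5] = f := by
    ext j; fin_cases j <;> rfl
  rw [← hvec]
  exact exists_pairings_aux (f 0) (hr' 0) (f 1) ⟨hr' 1, hiff 0 1⟩ (f 2) ⟨hr' 2, hiff 0 2, hiff 1 2⟩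
    (f 3) ⟨hr' 3, hiff 0 3, hiff 1 3, hiff 2 3⟩
    (f 4) ⟨hr' 4, hiff 0 4, hiff 1 4, hiff 2 4, hiff 3 4⟩
    (f 5) ⟨hr' 5, hiff 0 5, hiff 1 5, hiff 2 5, hiff 3 5, hiff 4 5⟩

/-- The union of two perfect matchings of six points is three double edges, a double edge with a
4-cycle, or a hexagon. Relative to a fixed matching these are orbits of sizes 1, 6 and 8, and the
chosen permutations move each matching to its representative. -/
theorem pairings_conj : ∀ i, ∃ k,
    (∀ j, pairings i (pairStabilizers k j) = pairStabilizers k (pairPerm j)) ∨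
    (∀ j, pairings i (pairStabilizers k j) = pairStabilizers k (sharePerm j)) ∨
      ∀ j, pairings i (pairStabilizers k j) = pairStabilizers k (hexPerm j) := by
  decide +kernel

theorem pairStabilizers_apply : ∀ k,
    (∀ i j, pairStabilizers k i = pairStabilizers k j → i = j) ∧
      ∀ j, pairPerm (pairStabilizers k j) = pairStabilizers k (pairPerm j) := by
  decide +kernel

/-- Two pairings of six points agree, or share a pair, or form a hexagon. -/
theorem exists_conj_two_pairings {m n : Equiv.Perm (Fin 6)} (hm : ∀ j, m (m j) = j)
    (hm' : ∀ j, m j ≠ j) (hn : ∀ j, n (n j) = j) (hn' : ∀ j, n j ≠ j) :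
    ∃ σ : Equiv.Perm (Fin 6), (∀ j, m (σ j) = σ (pairPerm j)) ∧
      ((∀ j, n (σ j) = σ (pairPerm j)) ∨ (∀ j, n (σ j) = σ (sharePerm j)) ∨
        ∀ j, n (σ j) = σ (hexPerm j)) := by
  obtain ⟨σ, hσ⟩ := exists_conj_pairPerm hm hm'
  let f : Fin 6 → Fin 6 := fun j => σ.symm (n (σ j))
  have hf : ∀ j, f j ≠ j := fun j h => hn' (σ j) ((Equiv.symm_apply_eq σ).1 h)
  have hff : ∀ j, f (f j) = j := fun j => by simp [f, hn]
  obtain ⟨i, hi⟩ := exists_pairings hff hf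
  obtain ⟨k, h⟩ := pairings_conj i
  rw [← hi] at h
  obtain ⟨hinj, hcomm⟩ := pairStabilizers_apply k
  set g := pairStabilizers k
  let ρ := Equiv.ofBijective g (Finite.injective_iff_bijective.1 fun i j => hinj i j)
  have key : ∀ {N : Equiv.Perm (Fin 6)}, (∀ j, f (g j) = g (N j)) →
      ∀ j, n (σ (g j)) = σ (g (N j)) := fun h j => (Equiv.symm_apply_eq σ).1 (h j)
  exact ⟨ρ.trans σ, fun j => (hσ (g j)).trans (congrArg σ (hcomm j)),
    h.imp key fun h => h.imp key key⟩

theorem pairing_cases {r : Equiv.Perm (Fin 6)} (hr : ∀ j, r (r j) = j) (hr' : ∀ j, r j ≠ j) :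
    (r 0 = 1 ∧ r 2 = 3 ∧ r 4 = 5) ∨ (r 0 = 1 ∧ r 2 = 4 ∧ r 3 = 5) ∨
    (r 0 = 1 ∧ r 2 = 5 ∧ r 3 = 4) ∨ (r 0 = 2 ∧ r 1 = 3 ∧ r 4 = 5) ∨
    (r 0 = 2 ∧ r 1 = 4 ∧ r 3 = 5) ∨ (r 0 = 2 ∧ r 1 = 5 ∧ r 3 = 4) ∨
    (r 0 = 3 ∧ r 1 = 2 ∧ r 4 = 5) ∨ (r 0 = 3 ∧ r 1 = 4 ∧ r 2 = 5) ∨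
    (r 0 = 3 ∧ r 1 = 5 ∧ r 2 = 4) ∨ (r 0 = 4 ∧ r 1 = 2 ∧ r 3 = 5) ∨
    (r 0 = 4 ∧ r 1 = 3 ∧ r 2 = 5) ∨ (r 0 = 4 ∧ r 1 = 5 ∧ r 2 = 3) ∨
    (r 0 = 5 ∧ r 1 = 2 ∧ r 3 = 4) ∨ (r 0 = 5 ∧ r 1 = 3 ∧ r 2 = 4) ∨
    (r 0 = 5 ∧ r 1 = 4 ∧ r 2 = 3) := by
  obtain ⟨i, hi⟩ := exists_pairings hr hr'
  rw [hi]
  clear hi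
  revert i
  decide +kernel

/-! ### Two antipodal rows whose quotient splits into `3`-cycles -/

theorem div_left_cancel_iff {a b c : ℂ} (ha : a ≠ 0) : a / b = a / c ↔ b = c := by
  rw [div_eq_mul_inv, div_eq_mul_inv, mul_right_inj' ha, inv_inj]

/-- For z = y/x the shared pair gives z₄ = z₅, so all cubes of z agree; moreover z₀z₂ = z₁z₃.
Writing z₀ = uz₁ and z₂ = vz₁ with cube roots of unity u, v, the vanishing sum reads (1 + u)(1 +
v)z₁ + 2z₄ = 0. If u, v ≠ 1 then (1 + u)(1 + v) is a cube root of unity and the moduli cannot match.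
The case u = 1 or v = 1 gives a common pairing. -/
theorem common_pairing_of_share_aux {x y : Fin 6 → ℂ} (hx0 : ∀ j, x j ≠ 0) (hy0 : ∀ j, y j ≠ 0)
    (hx : ∀ j, x (pairPerm j) = -x j) (hy : ∀ j, y (sharePerm j) = -y j)
    (hz : CubeSplit fun j => y j / x j) :
    (∀ j, y (pairPerm j) = -y j) ∨ ∀ j, x (sharePerm j) = -x j := by
  have hz0 : ∀ j, y j / x j ≠ 0 := fun j => div_ne_zero (hy0 j) (hx0 j)
  have x1 : x 1 = -x 0 := hx 0
  have x3 : x 3 = -x 2 := hx 2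
  have x5 : x 5 = -x 4 := hx 4
  have y3 : y 3 = -y 0 := hy 0
  have y2 : y 2 = -y 1 := hy 1
  have y5 : y 5 = -y 4 := hy 4
  have hcube := fun i i' => CubeSplit.cube_eq_of_eq hz0 hz (j := 4) (k := 5) (by decide)
    (by simp only [x5, y5, neg_div_neg_eq]) i i'
  have a0 := hx0 0
  have a2 := hx0 2
  have hprod : y 0 / x 0 * (y 2 / x 2) = y 1 / x 1 * (y 3 / x 3) := by
    rw [x1, x3, y3, y2]; field_simp
  have hsum := hz.sum_pow (n := 1) (by decide)
  simp only [pow_one, Fin.sum_univ_six] at hsum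
  have h54 : y 5 / x 5 = y 4 / x 4 := by rw [x5, y5, neg_div_neg_eq]
  rw [h54] at hsum
  have h1 := hz0 1
  have h4 := hz0 4
  have c41 := hcube 4 1
  have final : ∀ c : ℂ, c ^ 3 = 1 → c * (y 1 / x 1) + 2 * (y 4 / x 4) = 0 → False := by
    intro c hc h
    have : c * (y 1 / x 1) = -2 * (y 4 / x 4) := by linear_combination h
    have h' := congrArg (· ^ 3) this
    simp only [mul_pow, hc, ← c41] at h'
    have : 9 * (y 4 / x 4) ^ 3 = 0 := by linear_combination h'
    simp_all
  have z3 : ∀ u v : ℂ, y 0 / x 0 = u * (y 1 / x 1) → y 2 / x 2 = v * (y 1 / x 1) →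
      y 3 / x 3 = u * v * (y 1 / x 1) := by
    intro u v hu hv
    rw [hu, hv] at hprod
    refine mul_left_cancel₀ h1 ?_
    linear_combination -hprod
  have left : y 0 / x 0 = y 1 / x 1 → ∀ j, y (pairPerm j) = -y j := by
    intro h
    rw [x1, div_neg, ← neg_div, div_left_inj' a0] at h
    refine forall_fin_six.2 ?_
    simp [pairPerm_apply, y3, y2, y5, h]
  have right : y 2 / x 2 = y 1 / x 1 → ∀ j, x (sharePerm j) = -x j := by
    intro h
    rw [y2, x1, div_neg, neg_div, neg_inj, div_left_cancel_iff (hy0 1)] at h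
    refine forall_fin_six.2 ?_
    simp [sharePerm, x1, x3, x5, h]
  have w3 := w_pow_three
  have ws := w_sum
  rcases eq_or_of_cube_eq (hcube 0 1) with h0 | h0 | h0
  · exact Or.inl (left h0)
  all_goals
    rcases eq_or_of_cube_eq (hcube 2 1) with h2 | h2 | h2
    · exact Or.inr (right h2)
    all_goals
      exfalso
      rw [z3 _ _ h0 h2, h0, h2] at hsum
  · exact final (w ^ 4) (by grind) (by grind)
  · exact final 1 (by grind) (by grind)
  · exact final 1 (by grind) (by grind)
  · exact final (w ^ 2) (by grind) (by grind)

/-- If two pairings share a pair, the rows have a common pairing. -/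
theorem common_pairing_of_share {x y : Fin 6 → ℂ} (hx0 : ∀ j, x j ≠ 0) (hy0 : ∀ j, y j ≠ 0)
    {m n : Equiv.Perm (Fin 6)} (hm : ∀ j, m (m j) = j) (hn : ∀ j, n (n j) = j)
    (hx : ∀ j, x (m j) = -x j) (hy : ∀ j, y (n j) = -y j)
    (hz : CubeSplit fun j => y j / x j) {i : Fin 6} (hi : m i = n i) :
    ∃ r : Equiv.Perm (Fin 6), (∀ j, r (r j) = j) ∧ (∀ j, x (r j) = -x j) ∧
      ∀ j, y (r j) = -y j := by
  obtain ⟨σ, hσ, h⟩ := exists_conj_two_pairings hm (ne_of_apply_eq_neg hx0 hx) hn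
    (ne_of_apply_eq_neg hy0 hy)
  rcases h with h | h | h
  · refine ⟨m, hm, hx, fun j => ?_⟩
    have : m j = n j := by
      have h1 := hσ (σ.symm j)
      have h2 := h (σ.symm j)
      rw [← h2] at h1
      simpa using h1
    rw [this, hy]
  · rcases common_pairing_of_share_aux (fun j => hx0 (σ j)) (fun j => hy0 (σ j))
      (fun j => by rw [← hσ, hx]) (fun j => by rw [← h, hy]) (hz.comp σ) with h' | h'
    · refine ⟨m, hm, hx, fun j => ?_⟩
      have := h' (σ.symm j)
      rw [← hσ] at this
      simpa using this
    · refine ⟨n, hn, fun j => ?_, hy⟩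
      have := h' (σ.symm j)
      rw [← h] at this
      simpa using this
  · exfalso
    have h1 := hσ (σ.symm i)
    have h2 := h (σ.symm i)
    rw [Equiv.apply_symm_apply] at h1 h2
    rw [hi, h2] at h1
    have : ∀ j, hexPerm j ≠ pairPerm j := by decide
    exact this _ (σ.injective h1)

/-- The hexagon relation forces a sum of `3`-cycles to have constant cubes. -/
theorem CubeSplit.cube_eq_of_hexagon {z : Fin 6 → ℂ} (hz0 : ∀ j, z j ≠ 0) (hz : CubeSplit z)
    (h : z 0 * z 2 * z 4 = z 1 * z 3 * z 5) (i j : Fin 6) : z i ^ 3 = z j ^ 3 := by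
  obtain ⟨p, α, β, hp, hc, -, hα, hβ⟩ := hz.exists_blocks hz0
  have h3 : z 0 ^ 3 * z 2 ^ 3 * z 4 ^ 3 = z 1 ^ 3 * z 3 ^ 3 * z 5 ^ 3 := by
    rw [← mul_pow, ← mul_pow, ← mul_pow, ← mul_pow, h]
  have n0 : cond (p 0) α β ≠ 0 := hc 0 ▸ pow_ne_zero 3 (hz0 0)
  have n1 : cond (p 1) α β ≠ 0 := hc 1 ▸ pow_ne_zero 3 (hz0 1)
  have n2 : cond (p 2) α β ≠ 0 := hc 2 ▸ pow_ne_zero 3 (hz0 2)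
  have n3 : cond (p 3) α β ≠ 0 := hc 3 ▸ pow_ne_zero 3 (hz0 3)
  suffices hαβ : α = β by
    rw [hc, hc, hαβ]; cases p i <;> cases p j <;> rfl
  simp only [hc] at h3
  simp only [Fin.sum_univ_six] at hp
  simp only [Fin.prod_univ_six] at hα hβ
  generalize p 0 = p0 at *
  generalize p 1 = p1 at *
  generalize p 2 = p2 at *
  generalize p 3 = p3 at *
  generalize p 4 = p4 at *
  generalize p 5 = p5 at *
  clear hc
  -- If one block consists of the even indices, its product is α or β and the relation says α = β.
  -- Otherwise the cubed relation is α²β = αβ² up to order, and a nonzero factor cancels.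
  cases p0 <;> cases p1 <;> cases p2 <;> cases p3 <;> cases p4 <;> cases p5 <;>
    simp only [Bool.toNat_true, Bool.toNat_false, cond_true, cond_false, one_mul, mul_one,
      reduceCtorEq, Nat.reduceAdd, Nat.reduceEqDiff] at hp h3 hα hβ n0 n1 n2 n3 <;>
    first
    | (rw [← hα, ← hβ]; linear_combination h)
    | (rw [← hα, ← hβ]; linear_combination -h)
    | exact mul_right_cancel₀ (mul_ne_zero n0 n1) (by linear_combination h3)
    | exact mul_right_cancel₀ (mul_ne_zero n0 n1) (by linear_combination -h3)
    | exact mul_right_cancel₀ (mul_ne_zero n0 n2) (by linear_combination h3)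
    | exact mul_right_cancel₀ (mul_ne_zero n0 n2) (by linear_combination -h3)
    | exact mul_right_cancel₀ (mul_ne_zero n0 n3) (by linear_combination h3)
    | exact mul_right_cancel₀ (mul_ne_zero n0 n3) (by linear_combination -h3)

/-- The hexagon forces all cubes of y/x to agree, hence x₀³ = x₂³ = x₄³. If two of x₀, x₂, x₄ are
equal, x admits another pairing that shares a pair with `hexPerm`, which is the shared-pair case. If
they are distinct, x is a 6-cycle, contrary to `hx'`. -/
theorem hex_cases_aux {x y : Fin 6 → ℂ} (hx0 : ∀ j, x j ≠ 0) (hy0 : ∀ j, y j ≠ 0)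
    (hx : ∀ j, x (pairPerm j) = -x j) (hy : ∀ j, y (hexPerm j) = -y j)
    (hz : CubeSplit fun j => y j / x j) (hx' : ¬ CubeSplit x) :
    IsRealUpToScalar x ∨ ∃ r : Equiv.Perm (Fin 6), (∀ j, r (r j) = j) ∧ (∀ j, x (r j) = -x j) ∧
      ∀ j, y (r j) = -y j := by
  have hz0 : ∀ j, y j / x j ≠ 0 := fun j => div_ne_zero (hy0 j) (hx0 j)
  have x1 : x 1 = -x 0 := hx 0
  have x3 : x 3 = -x 2 := hx 2
  have x5 : x 5 = -x 4 := hx 4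
  have y5 : y 5 = -y 0 := hy 0
  have y2 : y 2 = -y 1 := hy 1
  have y4 : y 4 = -y 3 := hy 3
  have a0 := hx0 0
  have a2 := hx0 2
  have a4 := hx0 4
  have b1 := hy0 1
  have b3 := hy0 3
  have hcube := hz.cube_eq_of_hexagon hz0 (by
    rw [x1, x3, x5, y5, y2, y4]; field_simp)
  have c2 : x 2 ^ 3 = x 0 ^ 3 := by
    have := hcube 2 1
    rw [y2, x1, div_neg, ← neg_div, div_pow, div_pow] at this
    exact (div_left_cancel_iff (pow_ne_zero 3 (neg_ne_zero.2 b1))).1 this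
  have c4 : x 4 ^ 3 = x 2 ^ 3 := by
    have := hcube 4 3
    rw [y4, x3, div_neg, ← neg_div, div_pow, div_pow] at this
    exact (div_left_cancel_iff (pow_ne_zero 3 (neg_ne_zero.2 b3))).1 this
  have share : ∀ (m : Equiv.Perm (Fin 6)) (i : Fin 6), (∀ j, m (m j) = j) → m i = hexPerm i →
      (∀ j, x (m j) = -x j) → IsRealUpToScalar x ∨ ∃ r : Equiv.Perm (Fin 6),
      (∀ j, r (r j) = j) ∧ (∀ j, x (r j) = -x j) ∧ ∀ j, y (r j) = -y j :=
    fun m i hm hi h => Or.inr (common_pairing_of_share hx0 hy0 hm (by decide) h hy hz hi)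
  have e02 : x 2 = x 0 → IsRealUpToScalar x ∨ ∃ r : Equiv.Perm (Fin 6),
      (∀ j, r (r j) = j) ∧ (∀ j, x (r j) = -x j) ∧ ∀ j, y (r j) = -y j := fun h =>
    share sharePerm 1 (by decide) (by decide)
      (forall_fin_six.2 (by simp [sharePerm, x1, x3, x5, h]))
  have e04 : x 4 = x 0 → IsRealUpToScalar x ∨ ∃ r : Equiv.Perm (Fin 6),
      (∀ j, r (r j) = j) ∧ (∀ j, x (r j) = -x j) ∧ ∀ j, y (r j) = -y j := fun h =>
    share ⟨![5, 4, 3, 2, 1, 0], ![5, 4, 3, 2, 1, 0], by decide, by decide⟩ 0 (by decide)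
      (by decide) (forall_fin_six.2 (by simp [x1, x3, x5, h]))
  have e24 : x 4 = x 2 → IsRealUpToScalar x ∨ ∃ r : Equiv.Perm (Fin 6),
      (∀ j, r (r j) = j) ∧ (∀ j, x (r j) = -x j) ∧ ∀ j, y (r j) = -y j := fun h =>
    share ⟨![1, 0, 5, 4, 3, 2], ![1, 0, 5, 4, 3, 2], by decide, by decide⟩ 3 (by decide)
      (by decide) (forall_fin_six.2 (by simp [x1, x3, x5, h]))
  have w3 := w_pow_three
  rcases eq_or_of_cube_eq c2 with h2 | h2 | h2
  · exact e02 h2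
  · rcases eq_or_of_cube_eq c4 with h4 | h4 | h4
    · exact e24 h4
    · exact absurd (cubeSplit_of_sq_eq' hx (by rw [h2]; ring) (by rw [h4, h2]; grind)) hx'
    · exact e04 (by rw [h4, h2]; grind)
  · rcases eq_or_of_cube_eq c4 with h4 | h4 | h4
    · exact e24 h4
    · exact e04 (by rw [h4, h2]; grind)
    · exact absurd (cubeSplit_of_sq_eq hx (by rw [h2]; grind) (by rw [h4, h2]; grind)) hx'

/-- Two rows that split into antipodal pairs, with quotient a sum of `3`-cycles. -/
theorem real_or_common_pairing {x y : Fin 6 → ℂ} (hx0 : ∀ j, x j ≠ 0) (hy0 : ∀ j, y j ≠ 0)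
    (hx : NegPaired x) (hy : NegPaired y) (hz : CubeSplit fun j => y j / x j)
    (hx' : ¬ CubeSplit x) : IsRealUpToScalar x ∨
    ∃ r : Equiv.Perm (Fin 6), (∀ j, r (r j) = j) ∧ (∀ j, x (r j) = -x j) ∧
      ∀ j, y (r j) = -y j := by
  obtain ⟨m, hm, hx⟩ := hx
  obtain ⟨n, hn, hy⟩ := hy
  by_cases hi : ∃ i, m i = n i
  · obtain ⟨i, hi⟩ := hi
    exact Or.inr (common_pairing_of_share hx0 hy0 hm hn hx hy hz hi)
  obtain ⟨σ, hσ, h⟩ := exists_conj_two_pairings hm (ne_of_apply_eq_neg hx0 hx) hn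
    (ne_of_apply_eq_neg hy0 hy)
  rcases h with h | h | h
  · exact absurd ⟨σ 0, by rw [h, hσ]⟩ hi
  · exact absurd ⟨σ 4, by rw [h, hσ]; rfl⟩ hi
  · rcases hex_cases_aux (fun j => hx0 (σ j)) (fun j => hy0 (σ j))
      (fun j => by rw [← hσ, hx]) (fun j => by rw [← h, hy]) (hz.comp σ)
      (fun h => hx' (by simpa using h.comp σ.symm)) with h' | ⟨r, hr, h1, h2⟩
    · left
      intro j k
      simpa using h' (σ.symm j) (σ.symm k)
    · refine Or.inr ⟨(σ.symm.trans r).trans σ, fun j => by simp [hr], fun j => ?_, fun j => ?_⟩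
      · simpa using h1 (σ.symm j)
      · simpa using h2 (σ.symm j)

/-! ### Three rows with antipodal quotients -/

/-- The squares of the entries agree up to sign. -/
def IsQuadUpToScalar (z : Fin 6 → ℂ) : Prop := ∃ μ, ∀ j, z j ^ 2 = μ ∨ z j ^ 2 = -μ

theorem IsQuadUpToScalar.of_comp {z : Fin 6 → ℂ} (σ : Equiv.Perm (Fin 6))
    (h : IsQuadUpToScalar fun j => z (σ j)) : IsQuadUpToScalar z := by
  obtain ⟨μ, h⟩ := h
  exact ⟨μ, fun j => by simpa using h (σ.symm j)⟩

/-- An index whose entry is not `±i` times another entry. -/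
def IsSpecial (z : Fin 6 → ℂ) (j : Fin 6) : Prop := ∀ k, z k ^ 2 ≠ -z j ^ 2

theorem isSpecial_comp {z : Fin 6 → ℂ} (σ : Equiv.Perm (Fin 6)) (j : Fin 6) :
    IsSpecial (fun j => z (σ j)) j ↔ IsSpecial z (σ j) :=
  ⟨fun h k => by simpa using h (σ.symm k), fun h k => h (σ k)⟩

/-- The quotient y/x is (f/a, -d/a, -d/b, -e/b, -e/c, f/c). Each of the fifteen pairings of its
entries gives three monomial equations, which are contradictory or lead to one of the listed
outcomes. -/
theorem hexagon_relations {a b c d e f : ℂ} (ha : a ≠ 0) (hb : b ≠ 0) (hc : c ≠ 0) (hd : d ≠ 0)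
    (he : e ≠ 0) (hf : f ≠ 0) {x y : Fin 6 → ℂ} (hx : x = ![a, -a, b, -b, c, -c])
    (hy : y = ![f, d, -d, e, -e, -f]) {r : Equiv.Perm (Fin 6)} (hr : ∀ j, r (r j) = j)
    (hr' : ∀ j, r j ≠ j) (h : ∀ j, y (r j) * x j = -y j * x (r j)) :
    ((b ^ 2 = a ^ 2 ∨ b ^ 2 = -a ^ 2) ∧ (c ^ 2 = a ^ 2 ∨ c ^ 2 = -a ^ 2)) ∨
    ((d ^ 2 = f ^ 2 ∨ d ^ 2 = -f ^ 2) ∧ (e ^ 2 = f ^ 2 ∨ e ^ 2 = -f ^ 2)) ∨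
    (c ^ 2 = -a ^ 2 ∧ e ^ 2 = -d ^ 2) ∨
      (a ^ 2 = -b ^ 2 ∧ f ^ 2 = -e ^ 2) ∨ (b ^ 2 = -c ^ 2 ∧ d ^ 2 = -f ^ 2) := by
  have h0 := h 0
  have h1 := h 1
  have h2 := h 2
  have h3 := h 3
  have h4 := h 4
  clear h
  rcases pairing_cases hr hr' with ⟨e1, e2, e3⟩ | ⟨e1, e2, e3⟩ | ⟨e1, e2, e3⟩ | ⟨e1, e2, e3⟩ |
    ⟨e1, e2, e3⟩ | ⟨e1, e2, e3⟩ | ⟨e1, e2, e3⟩ | ⟨e1, e2, e3⟩ | ⟨e1, e2, e3⟩ | ⟨e1, e2, e3⟩ |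
    ⟨e1, e2, e3⟩ | ⟨e1, e2, e3⟩ | ⟨e1, e2, e3⟩ | ⟨e1, e2, e3⟩ | ⟨e1, e2, e3⟩ <;>
  clear hr' <;>
  simp only [e1, e2, e3] at h0 h1 h2 h3 h4 <;>
  clear e1 e2 e3 <;>
  simp [hx, hy, ha, hc] at h0 h1 h2 h3 h4 <;>
  clear hx hy
  -- Inverses become new variables subject to polynomial relations, so that nonzero factors can be
  -- cancelled by polynomial reasoning.
  all_goals
    have ia := mul_inv_cancel₀ ha
    have ib := mul_inv_cancel₀ hb
    have ic := mul_inv_cancel₀ hc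
    have id := mul_inv_cancel₀ hd
    have ie := mul_inv_cancel₀ he
    have jf := mul_inv_cancel₀ hf
    generalize a⁻¹ = a' at *
    generalize b⁻¹ = b' at *
    generalize c⁻¹ = c' at *
    generalize d⁻¹ = d' at *
    generalize e⁻¹ = e' at *
    generalize f⁻¹ = f' at *
    clear ha hb hc hd he hf hr
    first
    | (exfalso; grind)
    | exact Or.inr (Or.inr (Or.inl ⟨by grind, by grind⟩))
    | exact Or.inr (Or.inr (Or.inr (Or.inl ⟨by grind, by grind⟩)))
    | exact Or.inr (Or.inr (Or.inr (Or.inr ⟨by grind, by grind⟩)))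
    | exact Or.inl ⟨Or.inl (by grind), Or.inl (by grind)⟩
    | exact Or.inl ⟨Or.inl (by grind), Or.inr (by grind)⟩
    | exact Or.inl ⟨Or.inr (by grind), Or.inl (by grind)⟩
    | exact Or.inl ⟨Or.inr (by grind), Or.inr (by grind)⟩
    | exact Or.inr (Or.inl ⟨Or.inl (by grind), Or.inl (by grind)⟩)
    | exact Or.inr (Or.inl ⟨Or.inl (by grind), Or.inr (by grind)⟩)
    | exact Or.inr (Or.inl ⟨Or.inr (by grind), Or.inl (by grind)⟩)
    | exact Or.inr (Or.inl ⟨Or.inr (by grind), Or.inr (by grind)⟩)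

/-- The possible outcomes for two rows that are, with their quotient, split into antipodal
pairs. -/
def QuadOrSpecial (x y : Fin 6 → ℂ) : Prop :=
  IsQuadUpToScalar x ∨ IsQuadUpToScalar y ∨ (IsQuadUpToScalar fun j => y j / x j) ∨
    ((∃ j, IsSpecial x j) ∧ ∀ j, ¬ (IsSpecial x j ∧ IsSpecial y j))

theorem QuadOrSpecial.of_comp {x y : Fin 6 → ℂ} (σ : Equiv.Perm (Fin 6))
    (h : QuadOrSpecial (fun j => x (σ j)) fun j => y (σ j)) : QuadOrSpecial x y := by
  rcases h with h | h | h | ⟨⟨j, hj⟩, h⟩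
  · exact Or.inl (h.of_comp σ)
  · exact Or.inr (Or.inl (h.of_comp σ))
  · exact Or.inr (Or.inr (Or.inl (IsQuadUpToScalar.of_comp (z := fun j => y j / x j) σ h)))
  · refine Or.inr (Or.inr (Or.inr ⟨⟨σ j, (isSpecial_comp σ j).1 hj⟩, fun j hj => ?_⟩))
    refine h (σ.symm j) ⟨(isSpecial_comp σ _).2 ?_, (isSpecial_comp σ _).2 ?_⟩
    · simpa using hj.1
    · simpa using hj.2

/-- In the last three outcomes of `hexagon_relations` two pairs of x, and two pairs of y, differ by
factors ±i, so only one pair of each can be special. These two pairs are disjoint edges of the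
hexagon. If the remaining pair of x is not special, the squares of x agree up to sign. -/
theorem quadOrSpecial_of_hexagon {x y : Fin 6 → ℂ} (hx0 : ∀ j, x j ≠ 0) (hy0 : ∀ j, y j ≠ 0)
    (hx : ∀ j, x (pairPerm j) = -x j) (hy : ∀ j, y (hexPerm j) = -y j)
    (hz : NegPaired fun j => y j / x j) : QuadOrSpecial x y := by
  have hz0 : ∀ j, y j / x j ≠ 0 := fun j => div_ne_zero (hy0 j) (hx0 j)
  obtain ⟨r, hr, hz⟩ := hz
  have x1 : x 1 = -x 0 := hx 0
  have x3 : x 3 = -x 2 := hx 2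
  have x5 : x 5 = -x 4 := hx 4
  have y5 : y 5 = -y 0 := hy 0
  have y2 : y 2 = -y 1 := hy 1
  have y4 : y 4 = -y 3 := hy 3
  have hx' : x = ![x 0, -x 0, x 2, -x 2, x 4, -x 4] := by
    ext j; fin_cases j <;> simp [x1, x3, x5]
  have hy' : y = ![y 0, y 1, -y 1, y 3, -y 3, -y 0] := by
    ext j; fin_cases j <;> simp [y5, y2, y4]
  have hrel := hexagon_relations (hx0 0) (hx0 2) (hx0 4) (hy0 1) (hy0 3) (hy0 0) hx' hy' hr
    (ne_of_apply_eq_neg hz0 hz) fun j => by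
      have h1 := hz j
      have h2 := hx0 j
      have h3 := hx0 (r j)
      field_simp at h1
      linear_combination h1
  have hneg : ∀ {a : ℂ}, a ≠ 0 → a ^ 2 ≠ -a ^ 2 := fun ha h =>
    pow_ne_zero 2 ha (self_eq_neg.1 h)
  have case : ∀ {c : ℂ} (i : Fin 6), (∀ k, x k ^ 2 = c ∨ x k ^ 2 = -c ∨ x k ^ 2 = x i ^ 2) →
      (∀ j, ¬ (IsSpecial x j ∧ IsSpecial y j)) → QuadOrSpecial x y := by
    intro c i h h'
    by_cases hq : x i ^ 2 = c ∨ x i ^ 2 = -c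
    · exact Or.inl ⟨c, fun k => by rcases h k with h | h | h <;> simp [h, hq]⟩
    · refine Or.inr (Or.inr (Or.inr ⟨⟨i, fun k hk => ?_⟩, h'⟩))
      push Not at hq
      rcases h k with h | h | h
      · exact hq.2 (by linear_combination hk - h)
      · exact hq.1 (by linear_combination hk - h)
      · exact hneg (hx0 i) (by rw [← hk, h])
  rcases hrel with ⟨h1, h2⟩ | ⟨h1, h2⟩ | ⟨h1, h2⟩ | ⟨h1, h2⟩ | ⟨h1, h2⟩
  · exact Or.inl ⟨x 0 ^ 2, forall_fin_six.2 (by simp [x1, x3, x5, h1, h2])⟩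
  · exact Or.inr (Or.inl ⟨y 0 ^ 2, forall_fin_six.2 (by simp [y5, y2, y4, h1, h2])⟩)
  · have h1' : x 0 ^ 2 = -x 4 ^ 2 := by linear_combination h1
    have h2' : y 1 ^ 2 = -y 3 ^ 2 := by linear_combination h2
    refine case (c := x 0 ^ 2) 2 (forall_fin_six.2 (by simp [x1, x3, x5, h1]))
      (forall_fin_six.2 ⟨?_, ?_, ?_, ?_, ?_, ?_⟩) <;> rintro ⟨hs, ht⟩
    · exact hs 4 h1
    · exact hs 4 (by rw [x1]; linear_combination h1)
    · exact ht 3 (by rw [y2]; linear_combination h2)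
    · exact ht 1 h2'
    · exact hs 0 h1'
    · exact hs 0 (by rw [x5]; linear_combination h1')
  · have h1' : x 2 ^ 2 = -x 0 ^ 2 := by linear_combination h1
    have h2' : y 3 ^ 2 = -y 0 ^ 2 := by linear_combination h2
    refine case (c := x 0 ^ 2) 4 (forall_fin_six.2 (by simp [x1, x3, x5, h1']))
      (forall_fin_six.2 ⟨?_, ?_, ?_, ?_, ?_, ?_⟩) <;> rintro ⟨hs, ht⟩
    · exact hs 2 h1'
    · exact hs 2 (by rw [x1]; linear_combination h1')
    · exact hs 0 h1
    · exact hs 0 (by rw [x3]; linear_combination h1)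
    · exact ht 0 (by rw [y4]; linear_combination h2)
    · exact ht 3 (by rw [y5]; linear_combination h2')
  · have h1' : x 4 ^ 2 = -x 2 ^ 2 := by linear_combination h1
    have h2' : y 0 ^ 2 = -y 1 ^ 2 := by linear_combination h2
    refine case (c := x 2 ^ 2) 0 (forall_fin_six.2 (by simp [x1, x3, x5, h1']))
      (forall_fin_six.2 ⟨?_, ?_, ?_, ?_, ?_, ?_⟩) <;> rintro ⟨hs, ht⟩
    · exact ht 1 h2
    · exact ht 0 h2'
    · exact hs 4 h1'
    · exact hs 4 (by rw [x3]; linear_combination h1')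
    · exact hs 2 h1
    · exact hs 2 (by rw [x5]; linear_combination h1)

/-- For z = y/x one has z₄ = z₅ and z₀z₂ = z₁z₃. The antipodal partners of the indices 4 and 5 lie
among 0, …, 3, and the other two of these indices are partners of each other. The product relation
then gives their squares as -z₄², or is contradictory. -/
theorem quadOrSpecial_of_share {x y : Fin 6 → ℂ} (hx0 : ∀ j, x j ≠ 0) (hy0 : ∀ j, y j ≠ 0)
    (hx : ∀ j, x (pairPerm j) = -x j) (hy : ∀ j, y (sharePerm j) = -y j)
    (hz : NegPaired fun j => y j / x j) : QuadOrSpecial x y := by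
  have hz0 : ∀ j, y j / x j ≠ 0 := fun j => div_ne_zero (hy0 j) (hx0 j)
  refine Or.inr (Or.inr (Or.inl ?_))
  have hsum := hz.sum_odd_pow (n := 1) (by decide)
  simp only [pow_one, Fin.sum_univ_six] at hsum
  obtain ⟨r, hr, hz⟩ := hz
  have hr' := ne_of_apply_eq_neg hz0 hz
  have x1 : x 1 = -x 0 := hx 0
  have x3 : x 3 = -x 2 := hx 2
  have x5 : x 5 = -x 4 := hx 4
  have y3 : y 3 = -y 0 := hy 0
  have y2 : y 2 = -y 1 := hy 1
  have y5 : y 5 = -y 4 := hy 4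
  have a0 := hx0 0
  have a2 := hx0 2
  have hprod : y 0 / x 0 * (y 2 / x 2) = y 1 / x 1 * (y 3 / x 3) := by
    rw [x1, x3, y3, y2]; field_simp
  have h54 : y 5 / x 5 = y 4 / x 4 := by rw [x5, y5, neg_div_neg_eq]
  have h4 : y (r 4) / x (r 4) = -(y 4 / x 4) := hz 4
  have h5 : y (r 5) / x (r 5) = -(y 5 / x 5) := hz 5
  have hne : r 4 ≠ r 5 := fun h => by simpa using r.injective h
  have hr45 : r 4 ≠ 5 := fun h => by
    rw [h] at h4
    rw [h54, self_eq_neg] at h4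
    exact hz0 4 h4
  have hr54 : r 5 ≠ 4 := fun h => hr45 (by rw [← h, hr])
  have hr44 := hr' 4
  have hr55 := hr' 5
  have key : ∀ p q : Fin 6, p ≠ q → p ≠ 4 → p ≠ 5 → q ≠ 4 → q ≠ 5 →
      (p = 0 ∧ q = 1 ∨ p = 0 ∧ q = 2 ∨ p = 0 ∧ q = 3 ∨ p = 1 ∧ q = 2 ∨ p = 1 ∧ q = 3 ∨
      p = 2 ∧ q = 3) ∨
      (q = 0 ∧ p = 1 ∨ q = 0 ∧ p = 2 ∨ q = 0 ∧ p = 3 ∨ q = 1 ∧ p = 2 ∨ q = 1 ∧ p = 3 ∨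
      q = 2 ∧ p = 3) := by decide
  have key := key _ _ hne hr44 hr45 hr54 hr55
  have z0 := hz0 0
  have z1 := hz0 1
  have z2 := hz0 2
  have z3 := hz0 3
  have z4 := hz0 4
  refine ⟨(y 4 / x 4) ^ 2, ?_⟩
  rw [forall_fin_six]
  beta_reduce
  clear hx hy hz hr hr' hz0 hx0 hy0 x1 x3 x5 y3 y2 y5 a0 a2
  rw [h54] at hsum h5 ⊢
  rcases key with (⟨e1, e2⟩ | ⟨e1, e2⟩ | ⟨e1, e2⟩ | ⟨e1, e2⟩ | ⟨e1, e2⟩ | ⟨e1, e2⟩) |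
    (⟨e1, e2⟩ | ⟨e1, e2⟩ | ⟨e1, e2⟩ | ⟨e1, e2⟩ | ⟨e1, e2⟩ | ⟨e1, e2⟩) <;>
  simp only [e1, e2] at h4 h5 <;>
  clear hne hr45 hr54 hr44 hr55 e1 e2 h54 <;>
  generalize y 0 / x 0 = u0 at * <;>
  generalize y 1 / x 1 = u1 at * <;>
  generalize y 2 / x 2 = u2 at * <;>
  generalize y 3 / x 3 = u3 at * <;>
  generalize y 4 / x 4 = s at * <;>
  have hs := mul_inv_cancel₀ z4 <;>
  first
  | (exfalso; grind)
  | (refine ⟨?_, ?_, ?_, ?_, Or.inl rfl, Or.inl rfl⟩ <;>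
      first
      | (left; grind)
      | (right; grind))

/-- Two rows that are, with their quotient, split into antipodal pairs. -/
theorem quadOrSpecial {x y : Fin 6 → ℂ} (hx0 : ∀ j, x j ≠ 0) (hy0 : ∀ j, y j ≠ 0)
    (hx : NegPaired x) (hy : NegPaired y) (hz : NegPaired fun j => y j / x j) :
    QuadOrSpecial x y := by
  obtain ⟨m, hm, hx⟩ := hx
  obtain ⟨n, hn, hy⟩ := hy
  obtain ⟨σ, hσ, h⟩ := exists_conj_two_pairings hm (ne_of_apply_eq_neg hx0 hx) hn
    (ne_of_apply_eq_neg hy0 hy)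
  refine QuadOrSpecial.of_comp σ ?_
  have hx1 : ∀ j, x (σ (pairPerm j)) = -x (σ j) := fun j => by rw [← hσ, hx]
  rcases h with h | h | h
  -- With the same pairing for x and y, the quotient takes values u, v, t, each twice, with u + v +
  -- t = 0 and u³ + v³ + t³ = 3uvt = 0. This is impossible for nonzero numbers.
  · exfalso
    have hy1 : ∀ j, y (σ (pairPerm j)) = -y (σ j) := fun j => by rw [← h, hy]
    have hz' := hz.comp σ
    have hz1 : ∀ j, y (σ (pairPerm j)) / x (σ (pairPerm j)) = y (σ j) / x (σ j) := fun j => by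
      rw [hx1, hy1, neg_div_neg_eq]
    have s1 := hz'.sum_odd_pow (n := 1) (by decide)
    have s3 := hz'.sum_odd_pow (n := 3) (by decide)
    have e1 : y (σ 1) / x (σ 1) = _ := hz1 0
    have e3 : y (σ 3) / x (σ 3) = _ := hz1 2
    have e5 : y (σ 5) / x (σ 5) = _ := hz1 4
    simp only [Fin.sum_univ_six, e1, e3, e5] at s1 s3
    have n0 := div_ne_zero (hy0 (σ 0)) (hx0 (σ 0))
    have n2 := div_ne_zero (hy0 (σ 2)) (hx0 (σ 2))
    have n4 := div_ne_zero (hy0 (σ 4)) (hx0 (σ 4))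
    generalize y (σ 0) / x (σ 0) = u at *
    generalize y (σ 2) / x (σ 2) = v at *
    generalize y (σ 4) / x (σ 4) = t at *
    have ht : t = -u - v := by linear_combination s1 / 2
    rw [ht] at s3
    have : u * v * (-u - v) = 0 := by linear_combination s3 / 6
    rw [← ht] at this
    simp_all
  · exact quadOrSpecial_of_share (fun j => hx0 _) (fun j => hy0 _) hx1
      (fun j => by rw [← h, hy]) (hz.comp σ)
  · exact quadOrSpecial_of_hexagon (fun j => hx0 _) (fun j => hy0 _) hx1
      (fun j => by rw [← h, hy]) (hz.comp σ)

/-! ### Haagerup matrices -/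

/-- If all quotients of rows split into antipodal pairs, then some quotient has squares agreeing
up to sign. -/
theorem exists_isQuadUpToScalar {H : Matrix (Fin 6) (Fin 6) ℂ} (hH : IsComplexHadamard H)
    (h : ∀ i k, i ≠ k → NegPaired (ratio H i k)) :
    ∃ i k, i ≠ k ∧ IsQuadUpToScalar (ratio H i k) := by
  classical
  by_contra! hno
  have key : ∀ k l : Fin 5, k ≠ l → (∃ j, IsSpecial (ratio H k.succ 0) j) ∧
      ∀ j, ¬ (IsSpecial (ratio H k.succ 0) j ∧ IsSpecial (ratio H l.succ 0) j) := by
    intro k l hkl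
    have hlk : l.succ ≠ k.succ := fun h => hkl (Fin.succ_injective _ h).symm
    have hd : (fun j => ratio H l.succ 0 j / ratio H k.succ 0 j) = ratio H l.succ k.succ :=
      ratio_div_ratio hH.1 _ _ _
    rcases quadOrSpecial (ratio_ne_zero hH.1 k.succ 0) (ratio_ne_zero hH.1 l.succ 0)
      (h _ _ (Fin.succ_ne_zero k)) (h _ _ (Fin.succ_ne_zero l)) (by rw [hd]; exact h _ _ hlk)
      with h' | h' | h' | h'
    · exact absurd h' (hno _ _ (Fin.succ_ne_zero k))
    · exact absurd h' (hno _ _ (Fin.succ_ne_zero l))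
    · rw [hd] at h'
      exact absurd h' (hno _ _ hlk)
    · exact h'
  -- If no quotient were of the desired kind, the five quotients by row 0 would have pairwise
  -- disjoint sets of special columns. Each set is stable under the antipodal pairing, hence has at
  -- least two elements: ten columns among six.
  let S : Fin 5 → Finset (Fin 6) := fun k =>
    Finset.univ.filter fun j => IsSpecial (ratio H k.succ 0) j
  have hS : ∀ k, 2 ≤ (S k).card := by
    intro k
    obtain ⟨l, hl⟩ : ∃ l : Fin 5, k ≠ l := by revert k; decide
    obtain ⟨j, hj⟩ := (key k l hl).1
    obtain ⟨m, -, hm⟩ := h _ _ (Fin.succ_ne_zero k)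
    refine Finset.one_lt_card.2 ⟨j, by simpa [S] using hj, m j, ?_,
      (ne_of_apply_eq_neg (ratio_ne_zero hH.1 _ _) hm j).symm⟩
    simp only [S, Finset.mem_filter, Finset.mem_univ, true_and]
    intro i
    rw [hm, neg_sq]
    exact hj i
  have hdisj : ∀ k l, k ≠ l → Disjoint (S k) (S l) := fun k l hkl =>
    Finset.disjoint_filter.2 fun j _ h1 h2 => (key k l hkl).2 j ⟨h1, h2⟩
  have hcard := Finset.card_biUnion (s := Finset.univ) (t := S) fun k _ l _ hkl => hdisj k l hkl
  have h1 : ∑ _k : Fin 5, 2 ≤ ∑ k, (S k).card := Finset.sum_le_sum fun k _ => hS k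
  have h2 := (Finset.univ.biUnion S).card_le_univ
  rw [hcard] at h2
  simp at h1 h2
  omega

/-! ### Normal form of a quotient and the rows of a Haagerup matrix -/

theorem quad_normal_form_aux {z : Fin 6 → ℂ} (i : Fin 6 → Fin 6) (hi : Function.Injective i)
    (h1 : z (i 1) = -z (i 0)) (h3 : z (i 3) = -z (i 2)) (h5 : z (i 5) = -z (i 4))
    (h2 : z (i 2) ^ 2 = -z (i 0) ^ 2) (h4 : z (i 4) ^ 2 = -z (i 0) ^ 2) :
    ∃ σ : Equiv.Perm (Fin 6), ∀ j, z (σ j) = z (σ 0) *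
      ![1, -1, Complex.I, Complex.I, -Complex.I, -Complex.I] j := by
  have key : ∀ f : Fin 6 → Fin 6, Function.Injective f →
      (∀ j, z (i (f j)) = z (i (f 0)) *
        ![1, -1, Complex.I, Complex.I, -Complex.I, -Complex.I] j) →
      ∃ σ : Equiv.Perm (Fin 6), ∀ j, z (σ j) = z (σ 0) *
      ![1, -1, Complex.I, Complex.I, -Complex.I, -Complex.I] j := fun f hf h =>
    ⟨Equiv.ofBijective _ (Finite.injective_iff_bijective.1 (hi.comp hf)), h⟩
  have h2' : z (i 2) ^ 2 = (z (i 0) * Complex.I) ^ 2 := by rw [h2, mul_pow, Complex.I_sq]; ring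
  have h4' : z (i 4) ^ 2 = (z (i 0) * Complex.I) ^ 2 := by rw [h4, mul_pow, Complex.I_sq]; ring
  rcases sq_eq_sq_iff_eq_or_eq_neg.1 h2' with e2 | e2 <;>
  rcases sq_eq_sq_iff_eq_or_eq_neg.1 h4' with e4 | e4
  · exact key ![0, 1, 2, 4, 3, 5] (by decide) (forall_fin_six.2 (by simp [h1, h3, h5, e2, e4]))
  · exact key ![0, 1, 2, 5, 3, 4] (by decide) (forall_fin_six.2 (by simp [h1, h3, h5, e2, e4]))
  · exact key ![0, 1, 3, 4, 2, 5] (by decide) (forall_fin_six.2 (by simp [h1, h3, h5, e2, e4]))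
  · exact key ![0, 1, 3, 5, 2, 4] (by decide) (forall_fin_six.2 (by simp [h1, h3, h5, e2, e4]))

/-- Each antipodal pair has square μ or -μ. If the three signs agree, z is real up to a scalar;
otherwise the pair with the isolated sign goes first. -/
theorem IsQuadUpToScalar.normal_form {z : Fin 6 → ℂ} (hz : ∀ j, z j ≠ 0) (h : NegPaired z)
    (hq : IsQuadUpToScalar z) : IsRealUpToScalar z ∨
    ∃ σ : Equiv.Perm (Fin 6), ∀ j, z (σ j) = z (σ 0) *
      ![1, -1, Complex.I, Complex.I, -Complex.I, -Complex.I] j := by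
  obtain ⟨μ, hμ⟩ := hq
  obtain ⟨σ, h1, h3, h5⟩ := h.exists_perm hz
  have real : z (σ 2) ^ 2 = z (σ 0) ^ 2 → z (σ 4) ^ 2 = z (σ 0) ^ 2 → IsRealUpToScalar z := by
    intro h2 h4
    have : ∀ j, z (σ j) ^ 2 = z (σ 0) ^ 2 := forall_fin_six.2 (by simp [h1, h3, h5, h2, h4])
    intro j k
    have a := this (σ.symm j)
    have b := this (σ.symm k)
    rw [Equiv.apply_symm_apply] at a b
    rw [a, b]
  have inj : ∀ f : Fin 6 → Fin 6, Function.Injective f → Function.Injective fun j => σ (f j) :=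
    fun f hf => σ.injective.comp hf
  rcases hμ (σ 0) with m0 | m0 <;> rcases hμ (σ 2) with m2 | m2 <;>
    rcases hμ (σ 4) with m4 | m4
  · exact Or.inl (real (by rw [m2, m0]) (by rw [m4, m0]))
  · exact Or.inr (quad_normal_form_aux (fun j => σ (![4, 5, 0, 1, 2, 3] j)) (inj _ (by decide))
      h5 h1 h3 (by simp [m0, m4]) (by simp [m2, m4]))
  · exact Or.inr (quad_normal_form_aux (fun j => σ (![2, 3, 0, 1, 4, 5] j)) (inj _ (by decide))
      h3 h1 h5 (by simp [m0, m2]) (by simp [m2, m4]))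
  · exact Or.inr (quad_normal_form_aux (fun j => σ j) σ.injective
      h1 h3 h5 (by simp [m0, m2]) (by simp [m0, m4]))
  · exact Or.inr (quad_normal_form_aux (fun j => σ j) σ.injective
      h1 h3 h5 (by simp [m0, m2]) (by simp [m0, m4]))
  · exact Or.inr (quad_normal_form_aux (fun j => σ (![2, 3, 0, 1, 4, 5] j)) (inj _ (by decide))
      h3 h1 h5 (by simp [m0, m2]) (by simp [m2, m4]))
  · exact Or.inr (quad_normal_form_aux (fun j => σ (![4, 5, 0, 1, 2, 3] j)) (inj _ (by decide))
      h5 h1 h3 (by simp [m0, m4]) (by simp [m2, m4]))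
  · exact Or.inl (real (by rw [m2, m0]) (by rw [m4, m0]))

/-- Two numbers of modulus one are determined by their nonzero sum. -/
theorem eq_or_eq_of_add_eq {u v s t : ℂ} (hu : ‖u‖ = 1) (hv : ‖v‖ = 1) (hs : ‖s‖ = 1)
    (ht : ‖t‖ = 1) (h : u + v = s + t) (h0 : s + t ≠ 0) : (u = s ∧ v = t) ∨ (u = t ∧ v = s) := by
  have hc := congrArg conj h
  simp only [map_add] at hc
  have u1 := conj_mul_self hu
  have v1 := conj_mul_self hv
  have s1 := conj_mul_self hs
  have t1 := conj_mul_self ht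
  -- Conjugation gives (u + v)/(uv) = (s + t)/(st). So both pairs have the same sum and product.
  have huv : u * v = s * t := by
    refine mul_left_cancel₀ h0 ?_
    linear_combination -u * v * s * t * hc + s * t * v * u1 + s * t * u * v1 - u * v * t * s1 -
      u * v * s * t1 + s * t * h
  have hprod : (u - s) * (u - t) = 0 := by linear_combination u * h - huv
  rcases mul_eq_zero.1 hprod with h' | h'
  · exact Or.inl ⟨by linear_combination h', by linear_combination h - h'⟩
  · exact Or.inr ⟨by linear_combination h', by linear_combination h - h'⟩

/-- Taking moduli gives |1 - p|² = 2, so the real part of p vanishes and p = ±i. -/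
theorem sq_eq_neg_one_of_norm {p c u : ℂ} (hp : ‖p‖ = 1) (hu : ‖u‖ = 1) (hc : c * conj c = 2)
    (h : 2 * u = (1 - p) * c) : p ^ 2 = -1 := by
  have hc' := congrArg conj h
  simp only [map_mul, map_sub, map_one, map_ofNat] at hc'
  have p1 := conj_mul_self hp
  have u1 := conj_mul_self hu
  have h4 : 4 = (1 - p) * (1 - conj p) * 2 := by
    linear_combination -4 * u1 + 2 * conj u * h + (1 - p) * c * hc' +
      (1 - p) * (1 - conj p) * hc
  linear_combination p * h4 / 2 + (p - 1) * p1

/-- The rows orthogonal to `1` and `(1, -1, i, i, -i, -i)` in the sense of antipodal pairs. -/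
theorem haagerup_row_cases {y : Fin 6 → ℂ} (hy : ∀ j, ‖y j‖ = 1) (h0 : y 0 = 1)
    (h : NegPaired y)
    (h' : NegPaired fun j => y j / ![1, -1, Complex.I, Complex.I, -Complex.I, -Complex.I] j) :
    (∃ q, ‖q‖ = 1 ∧ (y = ![1, Complex.I, -1, -Complex.I, q, -q] ∨
      y = ![1, Complex.I, -Complex.I, -1, -q, q])) ∨
    (∃ q, ‖q‖ = 1 ∧ (y = ![1, -Complex.I, q, -q, Complex.I, -1] ∨
      y = ![1, -Complex.I, -q, q, -1, Complex.I])) := by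
  have hI := Complex.I_sq
  have hy0 : ∀ j, y j ≠ 0 := fun j => ne_zero_of_norm (hy j)
  have s1 := h.sum_odd_pow (n := 1) (by decide)
  have s2 := h'.sum_odd_pow (n := 1) (by decide)
  simp only [Fin.sum_univ_six, pow_one, h0] at s1 s2
  simp [div_neg, Complex.div_I] at s2
  have hA : 2 * (y 2 + y 3) = -(1 + y 1) - Complex.I * (1 - y 1) := by
    linear_combination s1 + Complex.I * s2 + (y 2 + y 3 - y 4 - y 5) * hI
  have hB : 2 * (y 4 + y 5) = -(1 + y 1) + Complex.I * (1 - y 1) := by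
    linear_combination s1 - Complex.I * s2 - (y 2 + y 3 - y 4 - y 5) * hI
  have hyvec : y = ![1, y 1, y 2, y 3, y 4, y 5] := by
    ext j; fin_cases j <;> simp [h0]
  -- The partner of index 0 in `y` has entry -1. If it is one of 2, …, 5, the sum of its block gives
  -- y₁ = ±i. If it is 1, consider instead the partner of 0 in the quotient by (1, -1, i, i, -i,
  -- -i): it lies in a block where the two entries sum to -1, so the other entry there would be
  -- zero.
  have hp : y 1 ^ 2 = -1 := by
    obtain ⟨m, hm, hneg⟩ := h
    have hne := ne_of_apply_eq_neg hy0 hneg 0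
    have e0 := hneg 0
    rw [h0] at e0
    have c1 : (-1 + Complex.I) * conj (-1 + Complex.I) = 2 := by
      simp only [map_add, map_neg, map_one, Complex.conj_I]; linear_combination -hI
    have c2 : (1 - Complex.I) * conj (1 - Complex.I) = 2 := by
      simp only [map_sub, map_one, Complex.conj_I]; linear_combination -hI
    have c3 : (1 + Complex.I) * conj (1 + Complex.I) = 2 := by
      simp only [map_add, map_one, Complex.conj_I]; linear_combination -hI
    generalize m 0 = k at e0 hne
    fin_cases k
    · exact absurd rfl hne
    · exfalso
      have e0 : y 1 = -1 := e0
      rw [e0] at hA hB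
      obtain ⟨n, hn, hneg'⟩ := h'
      have e1 : y (n 0) / ![1, -1, Complex.I, Complex.I, -Complex.I, -Complex.I] (n 0) = -1 :=
        (hneg' 0).trans (by simp [h0])
      have f2 : y 2 / Complex.I + y 3 / Complex.I = -1 := by
        rw [Complex.div_I, Complex.div_I]; linear_combination -Complex.I / 2 * hA + hI
      have f4 : y 4 / -Complex.I + y 5 / -Complex.I = -1 := by
        rw [div_neg, div_neg, Complex.div_I, Complex.div_I]
        linear_combination Complex.I / 2 * hB + hI
      have g : ∀ {c d : ℂ}, c + d = -1 → c = -1 → d ≠ 0 → False := fun h1 h2 h3 =>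
        h3 (by linear_combination h1 - h2)
      have I0 := Complex.I_ne_zero
      have I0' := neg_ne_zero.2 Complex.I_ne_zero
      have hone : (1 : ℂ) ≠ -1 := by norm_num
      generalize n 0 = k at e1
      fin_cases k
      · exact hone (by simpa [h0] using e1)
      · exact hone (by simpa [e0] using e1)
      · exact g f2 e1 (div_ne_zero (hy0 3) I0)
      · exact g ((add_comm _ _).trans f2) e1 (div_ne_zero (hy0 2) I0)
      · exact g f4 e1 (div_ne_zero (hy0 5) I0')
      · exact g ((add_comm _ _).trans f4) e1 (div_ne_zero (hy0 4) I0')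
    · have e0 : y 2 = -1 := e0
      exact sq_eq_neg_one_of_norm (hy 1) (hy 3) c2 (by linear_combination hA - 2 * e0)
    · have e0 : y 3 = -1 := e0
      exact sq_eq_neg_one_of_norm (hy 1) (hy 2) c2 (by linear_combination hA - 2 * e0)
    · have e0 : y 4 = -1 := e0
      exact sq_eq_neg_one_of_norm (hy 1) (hy 5) c3 (by linear_combination hB - 2 * e0)
    · have e0 : y 5 = -1 := e0
      exact sq_eq_neg_one_of_norm (hy 1) (hy 4) c3 (by linear_combination hB - 2 * e0)
  have hp' : y 1 ^ 2 = Complex.I ^ 2 := by rw [hp, hI]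
  have nI := Complex.norm_I
  rcases sq_eq_sq_iff_eq_or_eq_neg.1 hp' with e | e
  · left
    have hA' : y 2 + y 3 = -1 + -Complex.I := by rw [e] at hA; linear_combination hA / 2 + hI / 2
    have hB' : y 4 + y 5 = 0 := by rw [e] at hB; linear_combination hB / 2 - hI / 2
    rcases eq_or_eq_of_add_eq (hy 2) (hy 3) (by simp) (by simp) hA'
      (fun h => by simpa using congrArg Complex.re h) with ⟨a, b⟩ | ⟨a, b⟩
    · refine ⟨y 4, hy 4, Or.inl ?_⟩
      rw [hyvec, e, a, b, show y 5 = -y 4 by linear_combination hB']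
      simp
    · refine ⟨y 5, hy 5, Or.inr ?_⟩
      rw [hyvec, e, a, b, show y 4 = -y 5 by linear_combination hB']
      simp
  · right
    have hA' : y 2 + y 3 = 0 := by rw [e] at hA; linear_combination hA / 2 - hI / 2
    have hB' : y 4 + y 5 = Complex.I + -1 := by
      rw [e] at hB; linear_combination hB / 2 + hI / 2
    rcases eq_or_eq_of_add_eq (hy 4) (hy 5) (by simp) (by simp) hB'
      (fun h => by simpa using congrArg Complex.re h) with ⟨a, b⟩ | ⟨a, b⟩
    · refine ⟨y 2, hy 2, Or.inl ?_⟩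
      rw [hyvec, e, a, b, show y 3 = -y 2 by linear_combination hA']
      simp
    · refine ⟨y 3, hy 3, Or.inr ?_⟩
      rw [hyvec, e, a, b, show y 2 = -y 3 by linear_combination hA']
      simp

/-- Sorting by type, where no type is shared. -/
theorem exists_perm_of_types {α : Type*} {R : Fin 6 → α → Prop} {K : Fin 6 → α}
    (h : ∀ l, ∃ k, R k (K l)) (hne : ∀ k l l', l ≠ l' → R k (K l) → ¬ R k (K l')) :
    ∃ ρ : Equiv.Perm (Fin 6), ∀ k, R k (K (ρ k)) := by
  choose t ht using h
  have hinj : Function.Injective t := fun l l' e => by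
    by_contra hl
    exact hne _ _ _ hl (ht l) (e ▸ ht l')
  let e := Equiv.ofBijective t (Finite.injective_iff_bijective.1 hinj)
  refine ⟨e.symm, fun k => ?_⟩
  have := ht (e.symm k)
  rwa [show t (e.symm k) = k from e.apply_symm_apply k] at this

/-- The shapes of the rows of a Haagerup matrix. -/
def haagerupShape : Fin 6 → (Fin 6 → ℂ) → Prop :=
  ![fun y => y = 1, fun y => y = ![1, -1, Complex.I, Complex.I, -Complex.I, -Complex.I],
    fun y => ∃ q, ‖q‖ = 1 ∧ y = ![1, Complex.I, -1, -Complex.I, q, -q],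
    fun y => ∃ q, ‖q‖ = 1 ∧ y = ![1, Complex.I, -Complex.I, -1, -q, q],
    fun y => ∃ q, ‖q‖ = 1 ∧ y = ![1, -Complex.I, q, -q, Complex.I, -1],
    fun y => ∃ q, ‖q‖ = 1 ∧ y = ![1, -Complex.I, -q, q, -1, Complex.I]]

/-- Two rows of the same shape have scalar product 6 or 4 + 2qq̄', which cannot vanish for
unimodular parameters. So six orthogonal rows exhaust the six shapes. -/
theorem not_haagerupShape_of_orthogonal {k : Fin 6} {y z : Fin 6 → ℂ} (hy : haagerupShape k y)
    (hz : haagerupShape k z) (h : ∑ j, y j * conj (z j) = 0) : False := by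
  have hI := Complex.I_mul_I
  have two : ∀ {q q' : ℂ}, ‖q‖ = 1 → ‖q'‖ = 1 → 4 + 2 * (q * conj q') = 0 → False := by
    intro q q' hq hq' h
    have h2 : q * conj q' = -2 := by linear_combination h / 2
    have := congrArg norm h2
    rw [norm_mul, RCLike.norm_conj, hq, hq'] at this
    norm_num at this
  rw [Fin.sum_univ_six] at h
  fin_cases k
  · obtain rfl : y = 1 := hy
    obtain rfl : z = 1 := hz
    norm_num at h
  · obtain rfl : y = ![1, -1, Complex.I, Complex.I, -Complex.I, -Complex.I] := hy
    obtain rfl : z = ![1, -1, Complex.I, Complex.I, -Complex.I, -Complex.I] := hz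
    simp at h
    norm_num at h
  all_goals
    obtain ⟨q, hq, rfl⟩ := hy
    obtain ⟨q', hq', rfl⟩ := hz
    simp at h
    exact two hq hq' (by linear_combination h)

/-- Orthogonality of row 2 to rows 3, 4 and 5 forces the parameters of these rows to be q, q̄ and
q̄. -/
theorem haagerup_of_shapes {K : Matrix (Fin 6) (Fin 6) ℂ} (hK : IsComplexHadamard K)
    (h : ∀ k, haagerupShape k (K k)) : ∃ q, ‖q‖ = 1 ∧ K = haagerup q := by
  have hI := Complex.I_mul_I
  have h0 : K 0 = 1 := h 0
  have h1 : K 1 = ![1, -1, Complex.I, Complex.I, -Complex.I, -Complex.I] := h 1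
  obtain ⟨q, hq, h2⟩ : ∃ q, ‖q‖ = 1 ∧ K 2 = ![1, Complex.I, -1, -Complex.I, q, -q] := h 2
  obtain ⟨r, hr, h3⟩ : ∃ q, ‖q‖ = 1 ∧ K 3 = ![1, Complex.I, -Complex.I, -1, -q, q] := h 3
  obtain ⟨s, hs, h4⟩ : ∃ q, ‖q‖ = 1 ∧ K 4 = ![1, -Complex.I, q, -q, Complex.I, -1] := h 4
  obtain ⟨t, ht, h5⟩ : ∃ q, ‖q‖ = 1 ∧ K 5 = ![1, -Complex.I, -q, q, -1, Complex.I] := h 5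
  have e3 := hK.2 2 3 (by decide)
  have e4 := hK.2 2 4 (by decide)
  have e5 := hK.2 2 5 (by decide)
  rw [Fin.sum_univ_six, h2, h3] at e3
  rw [Fin.sum_univ_six, h2, h4] at e4
  rw [Fin.sum_univ_six, h2, h5] at e5
  simp at e3 e4 e5
  have hI1 : Complex.I - 1 ≠ 0 := fun h => by simpa using congrArg Complex.re h
  have r1 := conj_mul_self hr
  have hrq : r = q := by linear_combination r * e3 / 2 + q * r1
  have hst : conj s = q := by
    refine mul_left_cancel₀ hI1 ?_
    linear_combination e4
  have htt : conj t = q := by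
    refine mul_left_cancel₀ hI1 ?_
    linear_combination -e5
  have hs' : s = conj q := by rw [← hst, Complex.conj_conj]
  have ht' : t = conj q := by rw [← htt, Complex.conj_conj]
  refine ⟨q, hq, ?_⟩
  subst hs' ht' hrq
  ext l j
  have : K l j = ![1, ![1, -1, Complex.I, Complex.I, -Complex.I, -Complex.I],
      ![1, Complex.I, -1, -Complex.I, r, -r], ![1, Complex.I, -Complex.I, -1, -r, r],
      ![1, -Complex.I, conj r, -conj r, Complex.I, -1],
      ![1, -Complex.I, -conj r, conj r, -1, Complex.I]] l j := by
    fin_cases l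
    · exact congrFun h0 j
    · exact congrFun h1 j
    · exact congrFun h2 j
    · exact congrFun h3 j
    · exact congrFun h4 j
    · exact congrFun h5 j
  rw [this]
  fin_cases l <;> fin_cases j <;> rfl

theorem NegPaired.of_equiv {H K : Matrix (Fin 6) (Fin 6) ℂ} (h : HadamardEquiv H K)
    (hH : ∀ i k, i ≠ k → NegPaired (ratio H i k)) :
    ∀ i k, i ≠ k → NegPaired (ratio K i k) := by
  obtain ⟨σ, τ, hr⟩ := h.exists_ratio
  intro i k hik
  obtain ⟨c, -, hc⟩ := hr i k
  rw [hc]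
  exact ((hH _ _ (σ.injective.ne hik)).comp τ).const_mul c

/-- The classification when all quotients of rows split into antipodal pairs. -/
theorem classified_of_negPaired {H : Matrix (Fin 6) (Fin 6) ℂ} (hH : IsComplexHadamard H)
    (h : ∀ i k, i ≠ k → NegPaired (ratio H i k)) : IsClassified H := by
  obtain ⟨k, i, hik, hq⟩ := exists_isQuadUpToScalar hH h
  rcases hq.normal_form (ratio_ne_zero hH.1 _ _) (h _ _ hik) with hr | ⟨τ, hτ⟩
  · exact classified_of_real hH hik.symm hr
  obtain ⟨σ, rfl, rfl⟩ := exists_perm_two hik.symm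
  refine IsClassified.of_equiv ?_ (equiv_dephase hH σ τ)
  have hN := NegPaired.of_equiv (equiv_dephase hH σ τ) h
  have h1 : dephase H σ τ 1 = ![1, -1, Complex.I, Complex.I, -Complex.I, -Complex.I] := by
    ext j
    rw [dephase, hτ j, mul_div_cancel_left₀ _ (ratio_ne_zero hH.1 _ _ _)]
  have h0 : dephase H σ τ 0 = 1 := funext (dephase_zero_left hH σ τ)
  have hc : ∀ l, dephase H σ τ l 0 = 1 := dephase_zero_right hH σ τ
  have hK : IsComplexHadamard (dephase H σ τ) := isComplexHadamard_dephase hH σ τ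
  generalize dephase H σ τ = K at *
  obtain ⟨ρ, hρ⟩ := exists_perm_of_types (R := haagerupShape) (K := K) (fun l => by
    by_cases l0 : l = 0
    · exact ⟨0, by rw [l0]; exact h0⟩
    by_cases l1 : l = 1
    · exact ⟨1, by rw [l1]; exact h1⟩
    have n0 := hN l 0 l0
    have n1 := hN l 1 l1
    have r0 : ratio K l 0 = K l := funext fun j =>
      (congrArg (K l j / ·) (congrFun h0 j)).trans (div_one _)
    have r1 : ratio K l 1 = fun j => K l j /
        ![1, -1, Complex.I, Complex.I, -Complex.I, -Complex.I] j := funext fun j =>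
      congrArg (K l j / ·) (congrFun h1 j)
    rw [r0] at n0
    rw [r1] at n1
    rcases haagerup_row_cases (hK.1 l) (hc l) n0 n1 with ⟨q, hq, e | e⟩ | ⟨q, hq, e | e⟩
    · exact ⟨2, q, hq, e⟩
    · exact ⟨3, q, hq, e⟩
    · exact ⟨4, q, hq, e⟩
    · exact ⟨5, q, hq, e⟩)
    fun k l l' hl a b => not_haagerupShape_of_orthogonal a b (hK.2 l l' hl)
  have hE : HadamardEquiv K fun l j => K (ρ l) j := HadamardEquiv.reindex K ρ 1
  obtain ⟨q, hq, hKq⟩ := haagerup_of_shapes (hE.isComplexHadamard hK) hρ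
  exact Or.inr (Or.inl ⟨q, hq, hKq ▸ hE⟩)

/-! ### The Tao matrix -/

/-- The cube roots of unity, indexed by their exponents. -/
noncomputable def cubeRoot (a : Fin 3) : ℂ := w ^ (a : ℕ)

theorem cubeRoot_add (a b : Fin 3) : cubeRoot (a + b) = cubeRoot a * cubeRoot b := by
  rw [cubeRoot, cubeRoot, cubeRoot, ← pow_add, Fin.val_add, ← pow_mod_orderOf,
    ← isPrimitiveRoot_w.eq_orderOf, Nat.mod_mod]
  conv_rhs => rw [← pow_mod_orderOf, ← isPrimitiveRoot_w.eq_orderOf]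

theorem cubeRoot_ne_zero (a : Fin 3) : cubeRoot a ≠ 0 := pow_ne_zero _ w_ne_zero

theorem cubeRoot_sub (a b : Fin 3) : cubeRoot (a - b) = cubeRoot a / cubeRoot b := by
  rw [eq_div_iff (cubeRoot_ne_zero b), ← cubeRoot_add, sub_add_cancel]

theorem cubeRoot_injective : Function.Injective cubeRoot := fun a b h =>
  Fin.ext (isPrimitiveRoot_w.pow_inj a.isLt b.isLt h)

theorem exists_cubeRoot {z : ℂ} (h : z ^ 3 = 1) : ∃ a, cubeRoot a = z := by
  obtain ⟨i, hi, h⟩ := isPrimitiveRoot_w.eq_pow_of_pow_eq_one h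
  exact ⟨⟨i, hi⟩, h⟩

/-- Every exponent is taken twice. -/
def Balanced (f : Fin 6 → Fin 3) : Prop := ∀ c, (Finset.univ.filter fun j => f j = c).card = 2

instance : DecidablePred Balanced := fun f => by unfold Balanced; infer_instance

theorem Balanced.exists_perm {f g : Fin 6 → Fin 3} (hf : Balanced f) (hg : Balanced g) :
    ∃ σ : Equiv.Perm (Fin 6), ∀ j, g (σ j) = f j := by
  refine exists_perm_of_map_eq (Multiset.ext.2 fun c => ?_)
  have key : ∀ {f : Fin 6 → Fin 3}, Balanced f →
      ((Finset.univ : Finset (Fin 6)).val.map f).count c = 2 := fun h => by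
    rw [← h c, Multiset.count_map]
    simp only [eq_comm (a := c)]
    rfl
  rw [key hf, key hg]

/-- Multiplication by w shifts exponents by one, so the three fibres of `f` have equal size, namely
2. -/
theorem cubeSplit_iff_balanced (f : Fin 6 → Fin 3) :
    (CubeSplit fun j => cubeRoot (f j)) ↔ Balanced f := by
  have hw : cubeRoot 1 = w := by simp [cubeRoot]
  constructor
  · rintro ⟨g, -, hg⟩
    have hg' : ∀ j, f (g j) = 1 + f j := fun j =>
      cubeRoot_injective ((hg j).trans (by rw [cubeRoot_add, hw]))
    let N : Fin 3 → ℕ := fun c => (Finset.univ.filter fun j => f j = c).card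
    have hstep : ∀ c, N c = N (1 + c) := fun c =>
      Finset.card_bij (fun j _ => g j) (fun j hj => by simp_all) (fun a _ b _ h => g.injective h)
        fun b hb => ⟨g.symm b, by
          have := hg' (g.symm b)
          simp_all, by simp⟩
    have h0 : N 0 = N 1 := hstep 0
    have h1 : N 1 = N 2 := hstep 1
    have hsum : 6 = ∑ c, N c := Finset.card_eq_sum_card_fiberwise (s := Finset.univ)
      (t := Finset.univ) (f := f) (by simp)
    rw [Fin.sum_univ_three] at hsum
    have : N 0 = 2 ∧ N 1 = 2 ∧ N 2 = 2 := by omega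
    intro c
    fin_cases c
    · exact this.1
    · exact this.2.1
    · exact this.2.2
  · intro h
    obtain ⟨σ, hσ⟩ := Balanced.exists_perm (f := ![0, 1, 2, 0, 1, 2]) (by decide) h
    refine cubeSplit_of_perm σ ?_ ?_ ?_ ?_ <;> simp [hσ, cubeRoot]

/-- The exponents of the entries of the Tao matrix. -/
def taoExponent : Fin 6 → Fin 6 → Fin 3 :=
  ![![0, 0, 0, 0, 0, 0], ![0, 0, 1, 1, 2, 2], ![0, 1, 0, 2, 2, 1], ![0, 1, 2, 0, 1, 2],
    ![0, 2, 2, 1, 0, 1], ![0, 2, 1, 2, 1, 0]]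

theorem tao_apply (i j : Fin 6) : tao i j = cubeRoot (taoExponent i j) := by
  fin_cases i <;> fin_cases j <;> simp [tao, taoExponent, cubeRoot]

/-- The exponents of the rows orthogonal to the first two rows of the Tao matrix. -/
def orthogonalExponent : Fin 9 → Fin 6 → Fin 3 :=
  ![![0, 0, 2, 2, 1, 1], ![0, 1, 0, 2, 1, 2], ![0, 1, 0, 2, 2, 1], ![0, 1, 2, 0, 1, 2],
    ![0, 1, 2, 0, 2, 1], ![0, 2, 1, 2, 0, 1], ![0, 2, 1, 2, 1, 0], ![0, 2, 2, 1, 0, 1],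
    ![0, 2, 2, 1, 1, 0]]

set_option maxRecDepth 100000 in
theorem exists_orthogonalExponent_aux : ∀ a b c d e : Fin 3, Balanced ![0, a, b, c, d, e] →
    Balanced ![0, a, b - 1, c - 1, d - 2, e - 2] →
    ∃ k, ![0, a, b, c, d, e] = orthogonalExponent k := by
  decide +kernel

theorem exists_orthogonalExponent {f : Fin 6 → Fin 3} (h0 : f 0 = 0) (hf : Balanced f)
    (hf' : Balanced fun j => f j - taoExponent 1 j) : ∃ k, f = orthogonalExponent k := by
  have e : f = ![0, f 1, f 2, f 3, f 4, f 5] := by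
    ext j; fin_cases j <;> simp [h0]
  have e' : (fun j => f j - taoExponent 1 j) =
      ![0, f 1, f 2 - 1, f 3 - 1, f 4 - 2, f 5 - 2] := by
    ext j; fin_cases j <;> simp [h0, taoExponent]
  rw [e'] at hf'
  rw [e] at hf ⊢
  exact exists_orthogonalExponent_aux _ _ _ _ _ hf hf'

/-- The orthogonality relation between the rows of `orthogonalExponent`. -/
def Compatible (a b : Fin 9) : Prop :=
  Balanced fun j => orthogonalExponent a j - orthogonalExponent b j

instance : DecidableRel Compatible := fun a b => by unfold Compatible; infer_instance

-- The four remaining rows form a clique in the orthogonality graph on the nine candidates. Its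
-- cliques of four lie in {2, 3, 6, 7}, which are rows of the Tao matrix, or in {1, 4, 5, 8}, which
-- become such rows after exchanging the columns 4 and 5.
set_option synthInstance.maxHeartbeats 400000 in
set_option synthInstance.maxSize 10000 in
set_option maxRecDepth 100000 in
theorem compatible_cases : ∀ a b : Fin 9, Compatible a b → ∀ c, Compatible a c →
    Compatible b c → ∀ d, Compatible a d → Compatible b d → Compatible c d →
    ((a = 2 ∨ a = 3 ∨ a = 6 ∨ a = 7) ∧ (b = 2 ∨ b = 3 ∨ b = 6 ∨ b = 7) ∧
      (c = 2 ∨ c = 3 ∨ c = 6 ∨ c = 7) ∧ (d = 2 ∨ d = 3 ∨ d = 6 ∨ d = 7)) ∨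
    ((a = 1 ∨ a = 4 ∨ a = 5 ∨ a = 8) ∧ (b = 1 ∨ b = 4 ∨ b = 5 ∨ b = 8) ∧
      (c = 1 ∨ c = 4 ∨ c = 5 ∨ c = 8) ∧ (d = 1 ∨ d = 4 ∨ d = 5 ∨ d = 8)) := by
  decide +kernel

theorem exists_taoExponent : ∀ a : Fin 9, (a = 2 ∨ a = 3 ∨ a = 6 ∨ a = 7) →
    ∃ k, orthogonalExponent a = taoExponent k := by
  decide +kernel

theorem exists_taoExponent_swap : ∀ a : Fin 9, (a = 1 ∨ a = 4 ∨ a = 5 ∨ a = 8) →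
    ∃ k, (fun j => orthogonalExponent a (Equiv.swap 4 5 j)) = taoExponent k := by
  decide +kernel

theorem exists_perm_taoExponent {e : Fin 6 → Fin 6 → Fin 3} (h0 : e 0 = taoExponent 0)
    (h1 : e 1 = taoExponent 1) (hc : ∀ l, e l 0 = 0)
    (hb : ∀ l l', l ≠ l' → Balanced fun j => e l j - e l' j) :
    ∃ ρ τ : Equiv.Perm (Fin 6), ∀ k j, e (ρ k) (τ j) = taoExponent k j := by
  have hz : taoExponent 0 = 0 := by decide
  have hk : ∀ l, l ≠ 0 → l ≠ 1 → ∃ k, e l = orthogonalExponent k := fun l hl0 hl1 => by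
    have b0 := hb l 0 hl0
    have b1 := hb l 1 hl1
    rw [h0, hz] at b0
    rw [h1] at b1
    simp only [Pi.zero_apply, sub_zero] at b0
    exact exists_orthogonalExponent (hc l) b0 b1
  obtain ⟨a, ha⟩ := hk 2 (by decide) (by decide)
  obtain ⟨b, hb'⟩ := hk 3 (by decide) (by decide)
  obtain ⟨c, hc'⟩ := hk 4 (by decide) (by decide)
  obtain ⟨d, hd⟩ := hk 5 (by decide) (by decide)
  have hab := hb 2 3 (by decide)
  have hac := hb 2 4 (by decide)
  have hbc := hb 3 4 (by decide)
  have had := hb 2 5 (by decide)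
  have hbd := hb 3 5 (by decide)
  have hcd := hb 4 5 (by decide)
  rw [ha, hb'] at hab
  rw [ha, hc'] at hac
  rw [hb', hc'] at hbc
  rw [ha, hd] at had
  rw [hb', hd] at hbd
  rw [hc', hd] at hcd
  have key : ∀ τ : Equiv.Perm (Fin 6), (∀ l, ∃ k, (fun j => e l (τ j)) = taoExponent k) →
      ∃ ρ τ : Equiv.Perm (Fin 6), ∀ k j, e (ρ k) (τ j) = taoExponent k j := by
    intro τ h
    obtain ⟨ρ, hρ⟩ := exists_perm_of_types (R := fun k f => (fun j => f (τ j)) = taoExponent k)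
      (K := e) h (fun k l l' hl h1 h2 => by
        have := hb l l' hl
        have heq : e l = e l' := funext fun j => by
          simpa using congrFun (h1.trans h2.symm) (τ.symm j)
        rw [heq] at this
        simp only [sub_self] at this
        exact absurd this (by decide))
    exact ⟨ρ, τ, fun k j => congrFun (hρ k) j⟩
  rcases compatible_cases a b hab c hac hbc d had hbd hcd with ⟨pa, pb, pc, pd⟩ | ⟨pa, pb, pc, pd⟩
  · refine key 1 (forall_fin_six.2 ⟨⟨0, h0⟩, ⟨1, h1⟩, ?_, ?_, ?_, ?_⟩)
    · rw [ha]; exact exists_taoExponent a pa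
    · rw [hb']; exact exists_taoExponent b pb
    · rw [hc']; exact exists_taoExponent c pc
    · rw [hd]; exact exists_taoExponent d pd
  · refine key (Equiv.swap 4 5) (forall_fin_six.2 ⟨⟨0, ?_⟩, ⟨1, ?_⟩, ?_, ?_, ?_, ?_⟩)
    · rw [h0]; decide
    · rw [h1]; decide
    · rw [ha]; exact exists_taoExponent_swap a pa
    · rw [hb']; exact exists_taoExponent_swap b pb
    · rw [hc']; exact exists_taoExponent_swap c pc
    · rw [hd]; exact exists_taoExponent_swap d pd

theorem CubeSplit.of_equiv {H K : Matrix (Fin 6) (Fin 6) ℂ} (h : HadamardEquiv H K)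
    (hH : ∀ i k, i ≠ k → CubeSplit (ratio H i k)) :
    ∀ i k, i ≠ k → CubeSplit (ratio K i k) := by
  obtain ⟨σ, τ, hr⟩ := h.exists_ratio
  intro i k hik
  obtain ⟨c, -, hc⟩ := hr i k
  rw [hc]
  exact ((hH _ _ (σ.injective.ne hik)).comp τ).const_mul c

/-- If all quotients of rows split into `3`-cycles, then the matrix is the Tao matrix. -/
theorem equiv_tao_of_cubeSplit {H : Matrix (Fin 6) (Fin 6) ℂ} (hH : IsComplexHadamard H)
    (h : ∀ i k, i ≠ k → CubeSplit (ratio H i k)) : HadamardEquiv H tao := by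
  have hcube : ∀ τ l j, dephase H 1 τ l j ^ 3 = 1 := by
    intro τ l j
    by_cases hl : l = 0
    · rw [hl, dephase_zero_left hH, one_pow]
    -- `cube_ratio_eq` needs two auxiliary rows besides l and 0.
    obtain ⟨a, b, h1, h2, h3, h4, h5⟩ : ∃ a b : Fin 6, a ≠ l ∧ b ≠ l ∧ a ≠ 0 ∧ b ≠ 0 ∧ a ≠ b := by
      revert l; decide
    have := cube_ratio_eq hH.1 (h l 0 hl) (h a l h1) (h b l h2) (h a 0 h3) (h b 0 h4) (h a b h5)
      (τ j) (τ 0)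
    rw [dephase, div_pow]
    exact (div_eq_one_iff_eq (pow_ne_zero 3 (ratio_ne_zero hH.1 _ _ _))).2 this
  have hC : ∀ τ {e : Fin 6 → Fin 6 → Fin 3}, (∀ l j, cubeRoot (e l j) = dephase H 1 τ l j) →
      (∀ l l', l ≠ l' → Balanced fun j => e l j - e l' j) := by
    intro τ e he l l' hl
    have := CubeSplit.of_equiv (equiv_dephase hH 1 τ) h l l' hl
    rw [← cubeSplit_iff_balanced]
    simp only [cubeRoot_sub, he]
    exact this
  have hone : cubeRoot 0 = 1 := by simp [cubeRoot]
  have hrow : ∀ τ {e : Fin 6 → Fin 6 → Fin 3}, (∀ l j, cubeRoot (e l j) = dephase H 1 τ l j) →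
      e 0 = 0 := fun τ e he => funext fun j => cubeRoot_injective (by
    rw [he, dephase_zero_left hH, Pi.zero_apply, hone])
  -- There is one table of exponents for each column order `τ`. The table for the identity order is
  -- used to find the `τ` that makes row 1 equal to the second Tao row.
  choose e he using fun τ l j => exists_cubeRoot (hcube τ l j)
  obtain ⟨τ, hτ⟩ := Balanced.exists_perm (f := taoExponent 1) (g := e 1 1) (by decide) (by
    have := hC 1 (he 1) 1 0 (by decide)
    rw [hrow 1 (he 1)] at this
    simpa using this)
  have h1 : e τ 1 = taoExponent 1 := by
    funext j
    apply cubeRoot_injective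
    have a : cubeRoot (e 1 1 (τ j)) = _ := he 1 1 (τ j)
    have b : cubeRoot (e 1 1 (τ 0)) = _ := he 1 1 (τ 0)
    rw [hτ] at a b
    have b' : taoExponent 1 0 = 0 := rfl
    rw [b', hone] at b
    rw [he τ, a]
    simp only [dephase, Equiv.Perm.one_apply] at b ⊢
    rw [eq_comm, div_eq_one_iff_eq (ratio_ne_zero hH.1 _ _ _)] at b
    rw [b]
  obtain ⟨ρ, τ', hρ⟩ := exists_perm_taoExponent (e := e τ)
    (by rw [hrow τ (he τ)]; decide) h1
    (fun l => cubeRoot_injective (by rw [he, dephase_zero_right hH, hone])) (hC τ (he τ))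
  have heq : tao = fun k j => dephase H 1 τ (ρ k) (τ' j) := by
    ext k j
    rw [tao_apply, ← hρ, he]
  rw [heq]
  exact (equiv_dephase hH 1 τ).trans (HadamardEquiv.reindex _ ρ τ')

/-! ### The classification -/

/-- If at every vertex all edges had the same type, then edges sharing a vertex would have the same
type. As any two edges are linked by such steps, the types could not be mixed. -/
theorem exists_mixed_triple {C : Fin 6 → Fin 6 → Prop} (hC : ∀ i k, C i k → C k i)
    {a b c d : Fin 6} (hab : a ≠ b) (hcd : c ≠ d) (h : C a b) (h' : ¬ C c d) :
    ∃ i k l, i ≠ k ∧ i ≠ l ∧ k ≠ l ∧ C i k ∧ ¬ C i l := by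
  by_contra! hno
  have step : ∀ i k l, i ≠ k → i ≠ l → C i k → C i l := fun i k l h1 h2 h3 => by
    by_cases h4 : k = l
    · exact h4 ▸ h3
    · exact hno i k l h1 h2 h4 h3
  refine h' (hC _ _ ?_)
  by_cases hd : d = a
  · subst hd
    exact step d b c hab hcd.symm h
  · exact step d a c hd hcd.symm (hC _ _ (step a b d hab (Ne.symm hd) h))

theorem isClassified_of_isRegular {H : Matrix (Fin 6) (Fin 6) ℂ} (h : IsRegularHadamard H) :
    IsClassified H := by
  have hH := h.1
  have hr := (isRegularHadamard_iff.1 h).2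
  have hinv : ∀ i k, CubeSplit (ratio H i k) → CubeSplit (ratio H k i) := fun i k h => by
    have := h.inv
    rwa [ratio_inv] at this
  by_cases hall : ∀ i k, i ≠ k → CubeSplit (ratio H i k)
  · exact Or.inr (Or.inr (equiv_tao_of_cubeSplit hH hall))
  by_cases hnone : ∀ i k, i ≠ k → ¬ CubeSplit (ratio H i k)
  · exact classified_of_negPaired hH fun i k hik => (hr i k hik).resolve_right (hnone i k hik)
  push Not at hall hnone
  obtain ⟨c, d, hcd, hcd'⟩ := hall
  obtain ⟨a, b, hab, hab'⟩ := hnone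
  obtain ⟨i, k, l, hik, hil, hkl, cik, cil⟩ :=
    exists_mixed_triple (C := fun i k => CubeSplit (ratio H i k)) hinv hab hcd hab' hcd'
  have nil := (hr i l hil).resolve_right cil
  have x0 := fun i k => ratio_ne_zero hH.1 i k
  -- If k/l is `CubeSplit`, then l/i is an antipodal quotient tied to the 3-cycle sums k/i and k/l.
  -- If not, both i/l and k/l are antipodal while k/i is a sum of 3-cycles; a pairing common to both
  -- is symmetric for k/i.
  by_cases ckl : CubeSplit (ratio H k l)
  · have cli : ¬ CubeSplit (ratio H l i) := fun h => cil (hinv _ _ h)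
    refine classified_of_real hH hil (isRealUpToScalar_of_cubeSplit (x0 l i) (x0 k i)
      ((hr l i hil.symm).resolve_right cli) cli (hinv _ _ cik) ?_)
    rw [ratio_div_ratio hH.1]
    exact ckl
  · have hd := ratio_div_ratio hH.1 k i l
    rcases real_or_common_pairing (x0 i l) (x0 k l) nil ((hr k l hkl).resolve_right ckl)
      (by rw [hd]; exact hinv _ _ cik) cil with h | ⟨r, hr, hx, hy⟩
    · exact classified_of_real hH hil.symm h
    · refine classified_of_common_pairing hH hik hil hkl hr (fun j => ?_) fun j => ?_
      · rw [← hd]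
        simp only [hx, hy, neg_div_neg_eq]
      · rw [← ratio_inv]
        simp only [hx, inv_neg]

/-! ### Regularity of the matrices in the classification -/

section Regular

variable {H : Matrix (Fin 6) (Fin 6) ℂ}

theorem isRegularHadamard_of_lt (hH : ∀ i j, ‖H i j‖ = 1)
    (h : ∀ i k, i < k → NegPaired (ratio H i k) ∨ CubeSplit (ratio H i k)) :
    IsRegularHadamard H := by
  refine isRegularHadamard_iff.2 ⟨hH, fun i k hik => ?_⟩
  rcases lt_or_gt_of_ne hik with hlt | hlt
  · exact h i k hlt
  · rw [← ratio_inv]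
    exact (h k i hlt).imp NegPaired.inv CubeSplit.inv

theorem negPaired_ratio (hH : ∀ i j, ‖H i j‖ = 1) {i k : Fin 6} (f : Fin 6 → Fin 6)
    (hf : ∀ j, f (f j) = j) (h : ∀ j, H i (f j) * H k j + H i j * H k (f j) = 0) :
    NegPaired (ratio H i k) := by
  refine ⟨Function.Involutive.toPerm f hf, hf, fun j => ?_⟩
  have h1 := ne_zero_of_norm (hH k j)
  have h2 := ne_zero_of_norm (hH k (f j))
  change H i (f j) / H k (f j) = -(H i j / H k j)
  rw [← neg_div, div_eq_div_iff h2 h1]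
  linear_combination h j

theorem forall_lt_fin_six {P : Fin 6 → Fin 6 → Prop} (h01 : P 0 1) (h02 : P 0 2) (h03 : P 0 3)
    (h04 : P 0 4) (h05 : P 0 5) (h12 : P 1 2) (h13 : P 1 3) (h14 : P 1 4) (h15 : P 1 5)
    (h23 : P 2 3) (h24 : P 2 4) (h25 : P 2 5) (h34 : P 3 4) (h35 : P 3 5) (h45 : P 4 5) :
    ∀ i k, i < k → P i k := by
  intro i k h
  fin_cases i <;> fin_cases k <;> first | exact absurd h (by decide) | assumption

end Regular

theorem norm_haagerup {q : ℂ} (hq : ‖q‖ = 1) (i j : Fin 6) : ‖haagerup q i j‖ = 1 := by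
  fin_cases i <;> fin_cases j <;> simp [haagerup, hq]

theorem negPaired_ratio_haagerup {q : ℂ} (hq : ‖q‖ = 1) :
    ∀ i k, i < k → NegPaired (ratio (haagerup q) i k) := by
  have hI := Complex.I_mul_I
  have hqq := conj_mul_self hq
  have hH := norm_haagerup hq
  apply forall_lt_fin_six
  · exact negPaired_ratio hH ![1, 0, 4, 5, 2, 3] (by decide) (forall_fin_six.2 (by
      simp [haagerup]))
  · exact negPaired_ratio hH ![2, 3, 0, 1, 5, 4] (by decide) (forall_fin_six.2 (by
      simp [haagerup]))
  · exact negPaired_ratio hH ![3, 2, 1, 0, 5, 4] (by decide) (forall_fin_six.2 (by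
      simp [haagerup]))
  · exact negPaired_ratio hH ![5, 4, 3, 2, 1, 0] (by decide) (forall_fin_six.2 (by
      simp [haagerup]))
  · exact negPaired_ratio hH ![4, 5, 3, 2, 0, 1] (by decide) (forall_fin_six.2 (by
      simp [haagerup]))
  · exact negPaired_ratio hH ![3, 2, 1, 0, 5, 4] (by decide) (forall_fin_six.2 (by
      simp [haagerup]))
  · exact negPaired_ratio hH ![2, 3, 0, 1, 5, 4] (by decide) (forall_fin_six.2 (by
      simp [haagerup]))
  · exact negPaired_ratio hH ![4, 5, 3, 2, 0, 1] (by decide) (forall_fin_six.2 (by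
      simp [haagerup]))
  · exact negPaired_ratio hH ![5, 4, 3, 2, 1, 0] (by decide) (forall_fin_six.2 (by
      simp [haagerup]))
  · exact negPaired_ratio hH ![4, 5, 3, 2, 0, 1] (by decide) (forall_fin_six.2 (by
      simp [haagerup]; grind))
  · exact negPaired_ratio hH ![1, 0, 5, 4, 3, 2] (by decide) (forall_fin_six.2 (by
      simp [haagerup]; grind))
  · exact negPaired_ratio hH ![1, 0, 4, 5, 2, 3] (by decide) (forall_fin_six.2 (by
      simp [haagerup]; grind))
  · exact negPaired_ratio hH ![1, 0, 4, 5, 2, 3] (by decide) (forall_fin_six.2 (by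
      simp [haagerup]; grind))
  · exact negPaired_ratio hH ![1, 0, 5, 4, 3, 2] (by decide) (forall_fin_six.2 (by
      simp [haagerup]; grind))
  · exact negPaired_ratio hH ![2, 3, 0, 1, 5, 4] (by decide) (forall_fin_six.2 (by
      simp [haagerup]; grind))

/-- The second power sum of a `CubeSplit` vector vanishes, so this excludes that type for every pair
of rows. -/
theorem sum_sq_ratio_haagerup_ne_zero {q : ℂ} (hq : ‖q‖ = 1) :
    ∀ i k, i < k → ∑ j, ratio (haagerup q) i k j ^ 2 ≠ 0 := by
  have hI := Complex.I_mul_I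
  have hqq := conj_mul_self hq
  have hinv : ∀ i k j, ratio (haagerup q) i k j = haagerup q i j * conj (haagerup q k j) :=
    fun i k j => by
      rw [conj_eq_inv (norm_haagerup hq k j), ← div_eq_mul_inv, ratio]
  simp only [hinv, Fin.sum_univ_six]
  apply forall_lt_fin_six <;> intro h <;> simp [haagerup] at h <;> grind

theorem not_cubeSplit_ratio_haagerup {q : ℂ} (hq : ‖q‖ = 1) {i k : Fin 6} (hik : i ≠ k) :
    ¬ CubeSplit (ratio (haagerup q) i k) := by
  intro h
  rcases lt_or_gt_of_ne hik with hlt | hlt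
  · exact sum_sq_ratio_haagerup_ne_zero hq i k hlt (h.sum_pow (by norm_num))
  · have h' := h.inv
    rw [ratio_inv] at h'
    exact sum_sq_ratio_haagerup_ne_zero hq k i hlt (h'.sum_pow (by norm_num))

theorem isRegularHadamard_haagerup {q : ℂ} (hq : ‖q‖ = 1) : IsRegularHadamard (haagerup q) :=
  isRegularHadamard_of_lt (norm_haagerup hq) fun i k hik =>
    Or.inl (negPaired_ratio_haagerup hq i k hik)

theorem norm_cubeRoot (a : Fin 3) : ‖cubeRoot a‖ = 1 := by
  rw [cubeRoot, norm_pow, norm_w, one_pow]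

theorem cubeSplit_ratio_tao {i k : Fin 6} (hik : i ≠ k) : CubeSplit (ratio tao i k) := by
  have h : ratio tao i k = fun j => cubeRoot (taoExponent i j - taoExponent k j) :=
    funext fun j => by rw [ratio, tao_apply, tao_apply, cubeRoot_sub]
  rw [h, cubeSplit_iff_balanced (fun j => taoExponent i j - taoExponent k j)]
  clear h
  revert i k
  decide +kernel

/-- The entries are cube roots of unity, so their cubes sum to 6, whereas antipodal pairs give 0. -/
theorem not_negPaired_ratio_tao {i k : Fin 6} : ¬ NegPaired (ratio tao i k) := by
  intro h
  have h3 := h.sum_odd_pow (n := 3) (by decide)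
  have hc : ∀ a, cubeRoot a ^ 3 = 1 := fun a => by
    rw [cubeRoot, ← pow_mul, mul_comm, pow_mul, w_pow_three, one_pow]
  simp [ratio, tao_apply, div_pow, hc] at h3

theorem isRegularHadamard_tao : IsRegularHadamard tao :=
  isRegularHadamard_iff.2 ⟨fun i j => by rw [tao_apply, norm_cubeRoot], fun _ _ hik =>
    Or.inr (cubeSplit_ratio_tao hik)⟩

/-- The exponents in `fourierA`. -/
def fourierAExponent : Fin 6 → Fin 6 → Fin 3 :=
  ![![0, 0, 0, 0, 0, 0], ![0, 1, 2, 0, 1, 2], ![0, 2, 1, 0, 2, 1],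
    ![0, 0, 0, 0, 0, 0], ![0, 1, 2, 0, 1, 2], ![0, 2, 1, 0, 2, 1]]

/-- The parameters in `fourierA`. -/
noncomputable def fourierAParameter (r s : ℂ) : Fin 2 → Fin 6 → ℂ :=
  ![![1, 1, 1, 1, 1, 1], ![1, r, s, -1, -r, -s]]

theorem fourierA_apply (r s : ℂ) (i j : Fin 6) : fourierA r s i j =
    cubeRoot (fourierAExponent i j) * fourierAParameter r s (![0, 0, 0, 1, 1, 1] i) j := by
  fin_cases i <;> fin_cases j <;>
    simp [fourierA, fourierAExponent, fourierAParameter, cubeRoot]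

theorem norm_fourierA {r s : ℂ} (hr : ‖r‖ = 1) (hs : ‖s‖ = 1) (i j : Fin 6) :
    ‖fourierA r s i j‖ = 1 := by
  rw [fourierA_apply, norm_mul, norm_cubeRoot, one_mul]
  generalize (![0, 0, 0, 1, 1, 1] i : Fin 2) = c
  fin_cases c <;> fin_cases j <;> simp [fourierAParameter, hr, hs]

/-- Rows in the same half carry the same parameters, which cancel; only the exponents remain. -/
theorem cubeSplit_ratio_fourierA {r s : ℂ} (hr : ‖r‖ = 1) (hs : ‖s‖ = 1) {i k : Fin 6}
    (hik : i ≠ k) (hc : (![0, 0, 0, 1, 1, 1] i : Fin 2) = ![0, 0, 0, 1, 1, 1] k) :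
    CubeSplit (ratio (fourierA r s) i k) := by
  have h : ratio (fourierA r s) i k =
      fun j => cubeRoot (fourierAExponent i j - fourierAExponent k j) :=
    funext fun j => by
      have := ne_zero_of_norm (norm_fourierA hr hs i j)
      rw [fourierA_apply] at this
      rw [ratio, fourierA_apply, fourierA_apply, cubeRoot_sub, ← hc,
        mul_div_mul_right _ _ (right_ne_zero_of_mul this)]
  rw [h, cubeSplit_iff_balanced (fun j => fourierAExponent i j - fourierAExponent k j)]
  clear h
  revert i k
  decide +kernel

theorem negPaired_ratio_fourierA {r s : ℂ} (hr : ‖r‖ = 1) (hs : ‖s‖ = 1) {i k : Fin 6}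
    (hi : i < 3) (hk : 3 ≤ k) : NegPaired (ratio (fourierA r s) i k) := by
  refine negPaired_ratio (norm_fourierA hr hs) (fun j => j + 3) (by decide) fun j => ?_
  have e : ∀ i j, fourierAExponent i (j + 3) = fourierAExponent i j := by decide
  have ci : ∀ i : Fin 6, i < 3 → (![0, 0, 0, 1, 1, 1] i : Fin 2) = 0 := by decide
  have ck : ∀ i : Fin 6, 3 ≤ i → (![0, 0, 0, 1, 1, 1] i : Fin 2) = 1 := by decide
  have p0 : fourierAParameter r s 0 (j + 3) = fourierAParameter r s 0 j := by
    fin_cases j <;> rfl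
  have p1 : fourierAParameter r s 1 (j + 3) = -fourierAParameter r s 1 j := by
    fin_cases j <;> simp [fourierAParameter]
  simp only [fourierA_apply, e, ci i hi, ck k hk, p0, p1]
  ring

theorem isRegularHadamard_fourierA {r s : ℂ} (hr : ‖r‖ = 1) (hs : ‖s‖ = 1) :
    IsRegularHadamard (fourierA r s) := by
  refine isRegularHadamard_of_lt (norm_fourierA hr hs) fun i k hik => ?_
  by_cases hc : (![0, 0, 0, 1, 1, 1] i : Fin 2) = ![0, 0, 0, 1, 1, 1] k
  · exact Or.inr (cubeSplit_ratio_fourierA hr hs hik.ne hc)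
  · have : ∀ i k : Fin 6, i < k → (![0, 0, 0, 1, 1, 1] i : Fin 2) ≠ ![0, 0, 0, 1, 1, 1] k →
        i < 3 ∧ 3 ≤ k := by decide
    exact Or.inl (negPaired_ratio_fourierA hr hs (this i k hik hc).1 (this i k hik hc).2)

/-- The exponents in `fourierB`. -/
def fourierBExponent : Fin 3 → Fin 6 → Fin 3 :=
  ![![0, 0, 0, 0, 0, 0], ![0, 0, 1, 1, 2, 2], ![0, 0, 2, 2, 1, 1]]

theorem fourierB_apply (r s : ℂ) (i j : Fin 6) : fourierB r s i j =
    cubeRoot (fourierBExponent (![0, 0, 1, 1, 2, 2] i) j) *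
      ![1, ![1, -1, r, -r, s, -s] i] (![0, 1, 0, 1, 0, 1] j) := by
  fin_cases i <;> fin_cases j <;> simp [fourierB, fourierBExponent, cubeRoot]

theorem norm_fourierB {r s : ℂ} (hr : ‖r‖ = 1) (hs : ‖s‖ = 1) (i j : Fin 6) :
    ‖fourierB r s i j‖ = 1 := by
  rw [fourierB_apply, norm_mul, norm_cubeRoot, one_mul]
  generalize (![0, 1, 0, 1, 0, 1] j : Fin 2) = c
  fin_cases c <;> fin_cases i <;> simp [hr, hs]

theorem negPaired_ratio_fourierB {r s : ℂ} (hr : ‖r‖ = 1) (hs : ‖s‖ = 1) {i k : Fin 6}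
    (hik : i ≠ k) (hc : (![0, 0, 1, 1, 2, 2] i : Fin 3) = ![0, 0, 1, 1, 2, 2] k) :
    NegPaired (ratio (fourierB r s) i k) := by
  refine negPaired_ratio (norm_fourierB hr hs) pairPerm (by decide) fun j => ?_
  have e : ∀ c j, fourierBExponent c (pairPerm j) = fourierBExponent c j := by decide
  have hp : (![1, -1, r, -r, s, -s] : Fin 6 → ℂ) k = -![1, -1, r, -r, s, -s] i := by
    have : k = pairPerm i := by revert i k; decide
    rw [this]
    fin_cases i <;> simp [pairPerm_apply]
  simp only [fourierB_apply, e, hc, hp]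
  generalize cubeRoot _ = u
  generalize (![1, -1, r, -r, s, -s] : Fin 6 → ℂ) i = v
  fin_cases j <;> simp [pairPerm_apply] <;> ring

/-- The parameters depend only on the parity of the column. A cyclic shift by 2 or 4 preserves
parity and raises the difference of exponents by one. -/
theorem cubeSplit_ratio_fourierB {r s : ℂ} {i k : Fin 6}
    (hc : (![0, 0, 1, 1, 2, 2] i : Fin 3) ≠ ![0, 0, 1, 1, 2, 2] k) :
    CubeSplit (ratio (fourierB r s) i k) := by
  have hw : cubeRoot 1 = w := by simp [cubeRoot]
  have hz : ∀ j, ratio (fourierB r s) i k j =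
      cubeRoot (fourierBExponent (![0, 0, 1, 1, 2, 2] i) j -
        fourierBExponent (![0, 0, 1, 1, 2, 2] k) j) *
      (![1, ![1, -1, r, -r, s, -s] i] (![0, 1, 0, 1, 0, 1] j) /
        ![1, ![1, -1, r, -r, s, -s] k] (![0, 1, 0, 1, 0, 1] j)) := fun j => by
    rw [ratio, fourierB_apply, fourierB_apply, cubeRoot_sub, mul_div_mul_comm]
  have key : ∀ c d : Fin 3, c ≠ d →
      (∀ j : Fin 6, fourierBExponent c (j + 2) - fourierBExponent d (j + 2) =
        1 + (fourierBExponent c j - fourierBExponent d j)) ∨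
      (∀ j : Fin 6, fourierBExponent c (j + 4) - fourierBExponent d (j + 4) =
        1 + (fourierBExponent c j - fourierBExponent d j)) := by decide
  have p2 : ∀ j : Fin 6, (![0, 1, 0, 1, 0, 1] (j + 2) : Fin 2) = ![0, 1, 0, 1, 0, 1] j := by
    decide
  have p4 : ∀ j : Fin 6, (![0, 1, 0, 1, 0, 1] (j + 4) : Fin 2) = ![0, 1, 0, 1, 0, 1] j := by
    decide
  rcases key _ _ hc with h | h
  · refine ⟨Equiv.addRight 2, by decide, fun j => ?_⟩
    rw [Equiv.coe_addRight, hz, hz, h, p2, cubeRoot_add, hw, mul_assoc]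
  · refine ⟨Equiv.addRight 4, by decide, fun j => ?_⟩
    rw [Equiv.coe_addRight, hz, hz, h, p4, cubeRoot_add, hw, mul_assoc]

theorem isRegularHadamard_fourierB {r s : ℂ} (hr : ‖r‖ = 1) (hs : ‖s‖ = 1) :
    IsRegularHadamard (fourierB r s) := by
  refine isRegularHadamard_iff.2 ⟨norm_fourierB hr hs, fun i k hik => ?_⟩
  by_cases hc : (![0, 0, 1, 1, 2, 2] i : Fin 3) = ![0, 0, 1, 1, 2, 2] k
  · exact Or.inl (negPaired_ratio_fourierB hr hs hik hc)
  · exact Or.inr (cubeSplit_ratio_fourierB hc)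

theorem isRegular_of_isClassified {H : Matrix (Fin 6) (Fin 6) ℂ} (h : IsClassified H) :
    IsRegularHadamard H := by
  rcases h with ⟨r, s, hr, hs, h | h⟩ | ⟨q, hq, h⟩ | h
  · exact isRegularHadamard_of_equiv h.symm (isRegularHadamard_fourierA hr hs)
  · exact isRegularHadamard_of_equiv h.symm (isRegularHadamard_fourierB hr hs)
  · exact isRegularHadamard_of_equiv h.symm (isRegularHadamard_haagerup hq)
  · exact isRegularHadamard_of_equiv h.symm isRegularHadamard_tao

/-! ### Disjointness -/

theorem not_equiv_haagerup {H : Matrix (Fin 6) (Fin 6) ℂ} {q : ℂ} (hq : ‖q‖ = 1) {i k : Fin 6}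
    (hik : i ≠ k) (h : CubeSplit (ratio H i k)) : ¬ HadamardEquiv H (haagerup q) := by
  intro he
  obtain ⟨σ, τ, hr⟩ := he.exists_ratio
  obtain ⟨c, -, hc⟩ := hr (σ.symm i) (σ.symm k)
  simp only [Equiv.apply_symm_apply] at hc
  refine not_cubeSplit_ratio_haagerup hq (σ.symm.injective.ne hik) ?_
  rw [hc]
  exact (h.comp τ).const_mul c

theorem not_equiv_tao {H : Matrix (Fin 6) (Fin 6) ℂ} {i k : Fin 6} (h : NegPaired (ratio H i k)) :
    ¬ HadamardEquiv H tao := by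
  intro he
  obtain ⟨σ, τ, hr⟩ := he.exists_ratio
  obtain ⟨c, -, hc⟩ := hr (σ.symm i) (σ.symm k)
  simp only [Equiv.apply_symm_apply] at hc
  refine not_negPaired_ratio_tao (i := σ.symm i) (k := σ.symm k) ?_
  rw [hc]
  exact (h.comp τ).const_mul c

end CHadamard

theorem theorem6p20 :
    (∀ H : Matrix (Fin 6) (Fin 6) ℂ,
      CHadamard.IsRegularHadamard H ↔
        (∃ r s : ℂ, ‖r‖ = 1 ∧ ‖s‖ = 1 ∧
          (CHadamard.HadamardEquiv H (CHadamard.fourierA r s) ∨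
            CHadamard.HadamardEquiv H (CHadamard.fourierB r s))) ∨
        (∃ q : ℂ, ‖q‖ = 1 ∧ CHadamard.HadamardEquiv H (CHadamard.haagerup q)) ∨
        CHadamard.HadamardEquiv H CHadamard.tao) ∧
    (∀ r s q : ℂ, ‖r‖ = 1 → ‖s‖ = 1 → ‖q‖ = 1 →
      ¬ CHadamard.HadamardEquiv (CHadamard.fourierA r s) (CHadamard.haagerup q) ∧
      ¬ CHadamard.HadamardEquiv (CHadamard.fourierB r s) (CHadamard.haagerup q) ∧
      ¬ CHadamard.HadamardEquiv (CHadamard.fourierA r s) CHadamard.tao ∧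
      ¬ CHadamard.HadamardEquiv (CHadamard.fourierB r s) CHadamard.tao ∧
      ¬ CHadamard.HadamardEquiv (CHadamard.haagerup q) CHadamard.tao) := by
  open CHadamard in
  refine ⟨fun H => ⟨isClassified_of_isRegular, isRegular_of_isClassified⟩,
    fun r s q hr hs hq => ⟨?_, ?_, ?_, ?_, ?_⟩⟩
  · exact not_equiv_haagerup hq (by decide) (cubeSplit_ratio_fourierA hr hs (i := 1) (k := 0)
      (by decide) (by decide))
  · exact not_equiv_haagerup hq (by decide) (cubeSplit_ratio_fourierB (i := 2) (k := 0)
      (by decide))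
  · exact not_equiv_tao (negPaired_ratio_fourierA hr hs (i := 0) (k := 3) (by decide) (by decide))
  · exact not_equiv_tao (negPaired_ratio_fourierB hr hs (i := 0) (k := 1) (by decide) (by decide))
  · exact not_equiv_tao (negPaired_ratio_haagerup hq 0 1 (by decide))
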